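/- **Setting.** Let $k$ be a field. For a small category $\mathcal{C}$, a $k\mathcal{C}$-module is a functor from $\mathcal{C}$ to finite-dimensional $k$-vector spaces, and $\mathrm{Gr}(k\mathcal{C})$ is the split Grothendieck group, i.e. the group completion of the monoid of isomorphism classes of $k\mathcal{C}$-modules under $\oplus$. Let $[n]$ denote the poset $0<1<\dots<n$, regarded as a category. The simplicial envelope $\widetilde{\mathcal{E}}^{\mathcal{C}}_\bullet$ is the simplicial object in categories given by the functor categories $\widetilde{\mathcal{E}}^{\mathcal{C}}_n=\mathcal{C}^{[n]}$, with faces $\partial_i$ omitting the $i$-th vertex. For a poset $\mathcal{C}$, let $\mathcal{E}^{\mathcal{C}}_n\subseteq\mathcal{C}^{[n]}$ be the full subcategory on the non-degenerate $n$-simplices of the nerve, and let $\mathcal{G}^{\mathcal{C}}_n\subseteq\mathcal{E}^{\mathcal{C}}_n$ be the subcategory with the same objects, whose morphisms $\underline{x}\to\underline{y}$ are the identities and those induced by a morphism $x_n\to y_0$ of $\mathcal{C}$ (with components $x_i\to x_n\to y_0\to y_i$). For each of these semi-simplicial categories $\mathcal{D}_\bullet$, the groups $\mathrm{Gr}(k\mathcal{D}_n)$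 with differential $d^n=\sum_{i=0}^{n+1}(-1)^i\delta^i$, $\delta^i[M]=[M\circ\partial_i]$, form a cochain complex; its cohomology is denoted $\widetilde{\mathscr{E}}^*(\mathcal{C},k)$, $\mathscr{E}^*(\mathcal{C},k)$, $\mathscr{G}^*(\mathcal{C},k)$ respectively. The inclusion $\mathcal{G}^{\mathcal{C}}_\bullet\subseteq\mathcal{E}^{\mathcal{C}}_\bullet$ induces a natural map $\mathscr{E}^*(\mathcal{C},k)\to\mathscr{G}^*(\mathcal{C},k)$. **Theorem.** 1. For $n\ge 1$, $\mathscr{E}^0([n],k)\cong\mathbb{Z}^2$ and the natural map $\mathscr{E}^0([n],k)\to\mathscr{G}^0([n],k)$ is split injective. For $n\ge 2$, $\mathscr{G}^0([n],k)\cong\mathbb{Z}^3$. 2. For $n\ge 2$ let $\mathcal{D}_n$ be the poset with elements $0,1,\dots,n+1$ and relations $0<1<j$ for all $j\ge 2$. Then $\mathscr{G}^i(\mathcal{D}_n,k)=0$ for all $i>0$, and $\mathscr{G}^0(\mathcal{D}_n,k)$ is a free abelian group on a set of generators in bijective correspondence with the isomorphism classes of indecomposable $k\mathcal{D}_n$-modules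 $M$ with $M(0)\neq 0$. In particular, $\mathscr{G}^0(\mathcal{D}_n,k)$ is finitely generated if and only if $n\le 2$. 3. Let $\mathcal{Q}$ be a finite quiver whose underlying undirected graph is a cycle (of any length $m\ge 1$; for $m=1$ a single loop, for $m=2$ two vertices joined by two arrows), with arbitrary orientations of the arrows, and let $\mathbb{P}(\mathcal{Q})$ be its path category. Then $\widetilde{\mathscr{E}}^0(\mathbb{P}(\mathcal{Q}),k)$ is a free abelian group on generators indexed by the pairs $(p(t),m)$, where $p(t)\in k[t]$ is a monic irreducible polynomial with $p(0)\neq 0$ and $m\ge 1$ is an integer. -/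

import Mathlib

open CategoryTheory CategoryTheory.Limits

universe w v u u₁ v₁ u₂ v₂

namespace RepCoh

noncomputable section

/-! ### The split Grothendieck group of an additive category -/

section Grothendieck

/-- Isomorphism classes of objects of a category. -/
def IsoClass (A : Type u₁) [Category.{v₁} A] : Type u₁ :=
  Quotient (isIsomorphicSetoid A)

/-- The isomorphism class of an object. -/
def IsoClass.mk {A : Type u₁} [Category.{v₁} A] (X : A) : IsoClass A :=
  Quotient.mk (isIsomorphicSetoid A) X

theorem IsoClass.sound {A : Type u₁} [Category.{v₁} A] {X Y : A} (e : X ≅ Y) :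
    IsoClass.mk X = IsoClass.mk Y :=
  Quotient.sound (s := isIsomorphicSetoid A) ⟨e⟩

variable (A : Type u₁) [Category.{v₁} A] [Preadditive A] [HasZeroObject A]
  [HasBinaryBiproducts A]

open ZeroObject

instance : Zero (IsoClass A) := ⟨IsoClass.mk 0⟩

instance : Add (IsoClass A) :=
  ⟨Quotient.map₂ (fun X Y => X ⊞ Y) (fun _ _ ⟨e⟩ _ _ ⟨f⟩ => ⟨biprod.mapIso e f⟩)⟩

/-- Isomorphism classes form a commutative monoid under direct sum. -/
instance : AddCommMonoid (IsoClass A) where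
  add_assoc := by
    rintro ⟨X⟩ ⟨Y⟩ ⟨Z⟩
    exact IsoClass.sound (biprod.associator X Y Z)
  zero_add := by
    rintro ⟨X⟩
    exact IsoClass.sound (isoZeroBiprod (isZero_zero A)).symm
  add_zero := by
    rintro ⟨X⟩
    exact IsoClass.sound (isoBiprodZero (isZero_zero A)).symm
  add_comm := by
    rintro ⟨X⟩ ⟨Y⟩
    exact IsoClass.sound (biprod.braiding X Y)
  nsmul := nsmulRec

/-- The split Grothendieck group: the group completion of the monoid of isomorphism classes of
objects under direct sum. -/
abbrev Gr : Type u₁ := Algebra.GrothendieckAddGroup (IsoClass A)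

variable {A}
variable {B : Type u₂} [Category.{v₂} B] [Preadditive B] [HasZeroObject B]
  [HasBinaryBiproducts B]

/-- The class `[X]` in the Grothendieck group. -/
def Gr.cls (X : A) : Gr A := Algebra.GrothendieckAddGroup.of (IsoClass.mk X)

/-- The map on isomorphism classes induced by an additive functor. -/
def IsoClass.map (F : A ⥤ B) [F.Additive] : IsoClass A →+ IsoClass B where
  toFun := Quotient.map F.obj (fun _ _ ⟨e⟩ => ⟨F.mapIso e⟩)
  map_zero' := IsoClass.sound (F.map_isZero (isZero_zero A)).isoZero
  map_add' := by
    rintro ⟨X⟩ ⟨Y⟩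
    have := preservesBinaryBiproducts_of_preservesBiproducts F
    exact IsoClass.sound (F.mapBiprod X Y)

/-- The homomorphism of Grothendieck groups induced by an additive functor, `[X] ↦ [F X]`. -/
def Gr.map (F : A ⥤ B) [F.Additive] : Gr A →+ Gr B :=
  Algebra.GrothendieckAddGroup.lift (Algebra.GrothendieckAddGroup.of.comp (IsoClass.map F))

theorem Gr.map_cls (F : A ⥤ B) [F.Additive] (X : A) : Gr.map F (Gr.cls X) = Gr.cls (F.obj X) :=
  DFunLike.congr_fun (Algebra.GrothendieckAddGroup.lift.symm_apply_apply
    (Algebra.GrothendieckAddGroup.of.comp (IsoClass.map F))) (IsoClass.mk X)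

/-- Homomorphisms out of the Grothendieck group agree if they agree on all classes `[X]`. -/
theorem Gr.hom_ext {M : Type w} [AddCommGroup M] {f g : Gr A →+ M}
    (h : ∀ X : A, f (Gr.cls X) = g (Gr.cls X)) : f = g := by
  apply Algebra.GrothendieckAddGroup.lift.symm.injective
  ext c
  obtain ⟨X⟩ := c
  exact h X

end Grothendieck

/-! ### Representations -/

/-- Representations of `C` over `k`: functors to finite-dimensional `k`-vector spaces. -/
abbrev Rep (k : Type u) [Field k] (C : Type u₁) [Category.{v₁} C] :=
  C ⥤ FGModuleCat.{u} k

/-- Restriction of representations along a functor, `F^* M = M ∘ F`. -/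
abbrev Rep.res (k : Type u) [Field k] {C : Type u₁} [Category.{v₁} C] {D : Type u₂}
    [Category.{v₂} D] (F : C ⥤ D) : Rep k D ⥤ Rep k C :=
  (Functor.whiskeringLeft C D (FGModuleCat.{u} k)).obj F

instance (k : Type u) [Field k] {C : Type u₁} [Category.{v₁} C] {D : Type u₂}
    [Category.{v₂} D] (F : C ⥤ D) : (Rep.res k F).Additive where

/-! ### Semi-simplicial subobjects of the simplicial envelope -/

section Envelope

variable (C : Type w) [Category.{v} C]

/-- The `i`-th face functor `C^[n+1] ⥤ C^[n]`, omitting the `i`-th vertex. -/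
abbrev face (n : ℕ) (i : Fin (n + 2)) : ComposableArrows C (n + 1) ⥤ ComposableArrows C n :=
  ComposableArrows.whiskerLeftFunctor (Fin.succAboveOrderEmb i).monotone.functor

/-- A semi-simplicial subobject of the simplicial envelope `n ↦ C^[n]` (the functor category from
`[n]` to `C`) in the category of categories: in each degree a set of objects and a set of
morphisms containing identities and closed under composition, both preserved by all faces. -/
structure SemiSub where
  objs : ∀ n, Set (ComposableArrows C n)
  homs : ∀ n, MorphismProperty (ComposableArrows C n)
  id_mem : ∀ n x, homs n (𝟙 x)
  comp_mem : ∀ n {x y z : ComposableArrows C n} (f : x ⟶ y) (g : y ⟶ z),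
    homs n f → homs n g → homs n (f ≫ g)
  face_objs : ∀ n i x, x ∈ objs (n + 1) → (face C n i).obj x ∈ objs n
  face_homs : ∀ n i {x y : ComposableArrows C (n + 1)} (f : x ⟶ y),
    homs (n + 1) f → homs n ((face C n i).map f)

namespace SemiSub

variable {C}

/-- The degree `n` category of a semi-simplicial subobject. -/
structure Level (S : SemiSub C) (n : ℕ) where
  val : ComposableArrows C n
  mem : val ∈ S.objs n

instance (S : SemiSub C) (n : ℕ) : Category (S.Level n) where
  Hom x y := {f : x.val ⟶ y.val // S.homs n f}
  id x := ⟨𝟙 x.val, S.id_mem n _⟩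
  comp f g := ⟨f.1 ≫ g.1, S.comp_mem n _ _ f.2 g.2⟩

/-- The face functors of a semi-simplicial subobject. -/
def d (S : SemiSub C) (n : ℕ) (i : Fin (n + 2)) : S.Level (n + 1) ⥤ S.Level n where
  obj x := ⟨(face C n i).obj x.val, S.face_objs n i _ x.mem⟩
  map f := ⟨(face C n i).map f.1, S.face_homs n i _ f.2⟩

/-- Precomposition with an order preserving map of vertices, as a functor between levels. -/
def pull (S : SemiSub C) {m n : ℕ} (Φ : Fin (n + 1) ⥤ Fin (m + 1))
    (ho : ∀ x : S.Level m, x.val.whiskerLeft Φ ∈ S.objs n)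
    (hm : ∀ {x y : S.Level m} (f : x ⟶ y), S.homs n (Functor.whiskerLeft Φ f.1)) :
    S.Level m ⥤ S.Level n where
  obj x := ⟨x.val.whiskerLeft Φ, ho x⟩
  map f := ⟨Functor.whiskerLeft Φ f.1, hm f⟩

/-- The simplicial identity between faces. -/
theorem d_comp_d (S : SemiSub C) (n : ℕ) (i : Fin (n + 2)) (j : Fin (n + 3)) (h : (j : ℕ) ≤ i) :
    S.d (n + 1) j ⋙ S.d n i =
      S.d (n + 1) i.succ ⋙ S.d n (j.castLT (lt_of_le_of_lt h i.isLt)) := by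
  have aux : ∀ (Φ Φ' : Fin (n + 1) ⥤ Fin (n + 2 + 1)) (_ : Φ = Φ') ho hm ho' hm',
      S.pull Φ ho hm = S.pull Φ' ho' hm' := by
    rintro Φ _ rfl _ _ _ _
    rfl
  refine aux ((Fin.succAboveOrderEmb i).monotone.functor ⋙
      (Fin.succAboveOrderEmb j).monotone.functor)
    ((Fin.succAboveOrderEmb (j.castLT (lt_of_le_of_lt h i.isLt))).monotone.functor ⋙
      (Fin.succAboveOrderEmb i.succ).monotone.functor) ?_
    (fun x => (S.d n i).obj ((S.d (n + 1) j).obj x) |>.mem)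
    (fun f => ((S.d n i).map ((S.d (n + 1) j).map f)).2)
    (fun x => (S.d n _).obj ((S.d (n + 1) i.succ).obj x) |>.mem)
    (fun f => ((S.d n _).map ((S.d (n + 1) i.succ).map f)).2)
  refine CategoryTheory.Functor.ext (fun a => ?_)
  change j.succAbove (i.succAbove a) = i.succ.succAbove (Fin.succAbove _ a)
  ext
  simp only [Fin.succAbove, Fin.lt_def, Fin.val_castSucc, Fin.val_succ, Fin.val_castLT]
  split_ifs <;> simp at * <;> lia

/-- The inclusion functors between nested semi-simplicial subobjects. -/
def incl {S T : SemiSub C} (ho : ∀ n, S.objs n ⊆ T.objs n) (hm : ∀ n, S.homs n ≤ T.homs n)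
    (n : ℕ) : S.Level n ⥤ T.Level n where
  obj x := ⟨x.val, ho n x.mem⟩
  map f := ⟨f.1, hm n _ f.2⟩

end SemiSub

end Envelope

/-! ### Representation cohomology -/

section Cohomology

variable (k : Type u) [Field k] {C : Type w} [Category.{v} C]

/-- The group of `n`-cochains: the Grothendieck group of representations of the degree `n`
category. -/
abbrev Cochain (S : SemiSub C) (n : ℕ) := Gr (Rep k (S.Level n))

/-- The coface homomorphism `δ^i [M] = [M ∘ ∂_i]`. -/
abbrev coface (S : SemiSub C) (n : ℕ) (i : Fin (n + 2)) : Cochain k S n →+ Cochain k S (n + 1) :=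
  Gr.map (Rep.res k (S.d n i))

/-- The coboundary operator, the alternating sum of the cofaces. -/
def coboundary (S : SemiSub C) (n : ℕ) : Cochain k S n →+ Cochain k S (n + 1) :=
  ∑ i : Fin (n + 2), (-1 : ℤ) ^ (i : ℕ) • coface k S n i

theorem coboundary_coboundary (S : SemiSub C) (n : ℕ) (x : Cochain k S n) :
    coboundary k S (n + 1) (coboundary k S n x) = 0 := by
  have e : ∀ (i : Fin (n + 2)) (j : Fin (n + 3)) (h : (j : ℕ) ≤ i),
      coface k S (n + 1) j (coface k S n i x) =
        coface k S (n + 1) i.succ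
          (coface k S n (j.castLT (lt_of_le_of_lt h i.isLt)) x) := by
    intro i j h
    have key : (coface k S (n + 1) j).comp (coface k S n i) =
        (coface k S (n + 1) i.succ).comp
          (coface k S n (j.castLT (lt_of_le_of_lt h i.isLt))) := Gr.hom_ext fun M => by
      simp only [AddMonoidHom.comp_apply, coface, Gr.map_cls]
      exact congrArg (fun F => Gr.cls (F ⋙ M)) (S.d_comp_d n i j h)
    exact DFunLike.congr_fun key x
  simp only [coboundary, AddMonoidHom.finsetSum_apply, AddMonoidHom.smul_apply, map_sum,
    map_zsmul]
  simp only [Finset.smul_sum, ← Finset.sum_product']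
  let Q := Fin (n + 2) × Fin (n + 3)
  let R : Finset Q := {ij : Q | (ij.2 : ℕ) ≤ (ij.1 : ℕ)}
  rw [Finset.univ_product_univ, ← Finset.sum_add_sum_compl R, ← eq_neg_iff_add_eq_zero,
    ← Finset.sum_neg_distrib]
  let φ : ∀ ij : Q, ij ∈ R → Q := fun ij hij =>
    (Fin.castLT ij.2 (lt_of_le_of_lt (Finset.mem_filter.mp hij).right ij.1.isLt), ij.1.succ)
  apply Finset.sum_bij φ
  · intro ij hij
    simp_rw [R, φ, Finset.compl_filter, Finset.mem_filter_univ, Fin.val_succ,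
      Fin.val_castLT] at hij ⊢
    lia
  · rintro ⟨i, j⟩ hij ⟨i', j'⟩ hij' h
    have h₁ := congrArg (fun t : Q => (t.1 : ℕ)) h
    have h₂ := congrArg (fun t : Q => (t.2 : ℕ)) h
    simp only [φ, Fin.val_succ, Fin.val_castLT] at h₁ h₂
    exact Prod.ext (Fin.ext (by lia)) (Fin.ext h₁)
  · rintro ⟨i', j'⟩ hij'
    simp_rw [R, Finset.compl_filter, Finset.mem_filter_univ, not_le] at hij'
    refine ⟨(j'.pred ?_, Fin.castSucc i'), ?_, ?_⟩
    · rintro rfl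
      simp at hij'
    · simp [R]
      lia
    · simp [φ]
  · rintro ⟨i, j⟩ hij
    have hij' : (j : ℕ) ≤ i := by simpa [R] using hij
    dsimp only [φ]
    rw [e i j hij']
    simp only [smul_smul, ← neg_smul, Fin.val_succ, Fin.val_castLT]
    congr 1
    ring

/-- The subgroup of `n`-cocycles. -/
def cocycles (S : SemiSub C) (n : ℕ) : AddSubgroup (Cochain k S n) :=
  (coboundary k S n).ker

/-- The subgroup of `n`-coboundaries (zero for `n = 0`). -/
def coboundaries (S : SemiSub C) : ∀ n : ℕ, AddSubgroup (Cochain k S n)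
  | 0 => ⊥
  | n + 1 => (coboundary k S n).range

theorem coboundaries_le_cocycles (S : SemiSub C) : ∀ n, coboundaries k S n ≤ cocycles k S n
  | 0 => bot_le
  | n + 1 => by
    rintro _ ⟨x, rfl⟩
    exact coboundary_coboundary k S n x

/-- The representation cohomology `H^n(Gr(k S_•))`. -/
abbrev H (S : SemiSub C) (n : ℕ) :=
  cocycles k S n ⧸ (coboundaries k S n).addSubgroupOf (cocycles k S n)

/-- Restriction of cochains along an inclusion of semi-simplicial subobjects. -/
def resCochain {S T : SemiSub C} (ho : ∀ n, S.objs n ⊆ T.objs n) (hm : ∀ n, S.homs n ≤ T.homs n)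
    (n : ℕ) : Cochain k T n →+ Cochain k S n :=
  Gr.map (Rep.res k (SemiSub.incl ho hm n))

theorem resCochain_coboundary {S T : SemiSub C} (ho : ∀ n, S.objs n ⊆ T.objs n)
    (hm : ∀ n, S.homs n ≤ T.homs n) (n : ℕ) (x : Cochain k T n) :
    resCochain k ho hm (n + 1) (coboundary k T n x) =
      coboundary k S n (resCochain k ho hm n x) := by
  have key : ∀ i, (resCochain k ho hm (n + 1)).comp (coface k T n i) =
      (coface k S n i).comp (resCochain k ho hm n) := fun i => Gr.hom_ext fun M => by
    simp only [AddMonoidHom.comp_apply, resCochain, Gr.map_cls]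
    rfl
  have key' := fun i => DFunLike.congr_fun (key i) x
  simp only [AddMonoidHom.comp_apply] at key'
  simp only [coboundary, AddMonoidHom.finsetSum_apply, AddMonoidHom.smul_apply, map_sum,
    map_zsmul, key']

/-- Restriction of cocycles along an inclusion of semi-simplicial subobjects. -/
def resCocycles {S T : SemiSub C} (ho : ∀ n, S.objs n ⊆ T.objs n)
    (hm : ∀ n, S.homs n ≤ T.homs n) (n : ℕ) : cocycles k T n →+ cocycles k S n :=
  ((resCochain k ho hm n).comp (cocycles k T n).subtype).codRestrict _ (by
    rintro ⟨x, hx⟩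
    change coboundary k S n (resCochain k ho hm n x) = 0
    rw [← resCochain_coboundary, show coboundary k T n x = 0 from hx, map_zero])

/-- The map on representation cohomology induced by an inclusion of semi-simplicial
subobjects. -/
def resH {S T : SemiSub C} (ho : ∀ n, S.objs n ⊆ T.objs n) (hm : ∀ n, S.homs n ≤ T.homs n)
    (n : ℕ) : H k T n →+ H k S n :=
  QuotientAddGroup.map _ _ (resCocycles k ho hm n) (by
    rintro ⟨x, hx⟩ hx'
    change resCochain k ho hm n x ∈ coboundaries k S n
    change x ∈ coboundaries k T n at hx'
    cases n with
    | zero => rw [show x = 0 from hx', map_zero]; exact zero_mem _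
    | succ n =>
      obtain ⟨y, rfl⟩ := hx'
      exact ⟨resCochain k ho hm n y, (resCochain_coboundary k ho hm n y).symm⟩)

end Cohomology

/-! ### The three theories -/

section Theories

/-- The whole simplicial envelope, `n ↦ C^[n]`. -/
def Etilde (C : Type w) [Category.{v} C] : SemiSub C where
  objs _ := Set.univ
  homs _ := ⊤
  id_mem _ _ := trivial
  comp_mem _ _ _ _ _ _ _ _ := trivial
  face_objs _ _ _ _ := trivial
  face_homs _ _ _ _ _ _ := trivial

/-- A morphism `x ⟶ y` of `n`-simplices is compositional if it is an identity or is induced by a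
morphism `x_n ⟶ y_0`: all its components are the composites `x_i ⟶ x_n ⟶ y_0 ⟶ y_i`. -/
def IsCompositional {C : Type w} [Category.{v} C] (n : ℕ) :
    MorphismProperty (ComposableArrows C n) := fun x y f =>
  (∃ h : x = y, f = eqToHom h) ∨
    ∃ g : x.obj (Fin.last n) ⟶ y.obj 0, ∀ i : Fin (n + 1),
      f.app i = x.map (homOfLE (Fin.le_last i)) ≫ g ≫ y.map (homOfLE (Fin.zero_le i))

theorem IsCompositional.comp {C : Type w} [Category.{v} C] (n : ℕ)
    {x y z : ComposableArrows C n} (f : x ⟶ y) (g : y ⟶ z) (hf : IsCompositional n f)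
    (hg : IsCompositional n g) : IsCompositional n (f ≫ g) := by
  obtain ⟨rfl, rfl⟩ | ⟨a, ha⟩ := hf
  · simpa using hg
  obtain ⟨rfl, rfl⟩ | ⟨b, hb⟩ := hg
  · exact Or.inr ⟨a, by simpa using ha⟩
  · exact Or.inr ⟨a ≫ y.map (homOfLE (Fin.zero_le _)) ≫ b, fun i => by
      simp only [NatTrans.comp_app, ha, hb, Category.assoc, ← Functor.map_comp_assoc]
      rfl⟩

theorem IsCompositional.face {C : Type w} [Category.{v} C] (n : ℕ) (i : Fin (n + 2))
    {x y : ComposableArrows C (n + 1)} (f : x ⟶ y) (hf : IsCompositional (n + 1) f) :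
    IsCompositional n ((face C n i).map f) := by
  obtain ⟨rfl, rfl⟩ | ⟨a, ha⟩ := hf
  · exact Or.inl ⟨rfl, (RepCoh.face C n i).map_id x⟩
  · have hx : ∀ {p q r : Fin (n + 2)} (h : p ≤ q) (h' : q ≤ r),
        x.map (homOfLE (h.trans h')) = x.map (homOfLE h) ≫ x.map (homOfLE h') := fun h h' => by
      rw [← x.map_comp]; rfl
    have hy : ∀ {p q r : Fin (n + 2)} (h : p ≤ q) (h' : q ≤ r),
        y.map (homOfLE (h.trans h')) = y.map (homOfLE h) ≫ y.map (homOfLE h') := fun h h' => by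
      rw [← y.map_comp]; rfl
    refine Or.inr ⟨x.map (homOfLE (Fin.le_last _)) ≫ a ≫ y.map (homOfLE (Fin.zero_le _)),
      fun j => ?_⟩
    have h₁ : i.succAbove j ≤ i.succAbove (Fin.last n) :=
      (Fin.succAboveOrderEmb i).monotone (Fin.le_last j)
    have h₂ : i.succAbove 0 ≤ i.succAbove j := (Fin.succAboveOrderEmb i).monotone (Fin.zero_le j)
    refine (ha (i.succAbove j)).trans ?_
    rw [hx h₁ (Fin.le_last _), hy (Fin.zero_le _) h₂]
    change _ = x.map _ ≫ (x.map _ ≫ a ≫ y.map _) ≫ y.map _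
    simp only [Category.assoc]
    rfl

variable (P : Type w) [PartialOrder P]

theorem face_nonDegenerate (n : ℕ) (i : Fin (n + 2)) (x : ComposableArrows P (n + 1))
    (hx : x ∈ (nerve P).nonDegenerate (n + 1)) :
    (face P n i).obj x ∈ (nerve P).nonDegenerate n :=
  (PartialOrder.mem_nerve_nonDegenerate_iff_strictMono (X := P) _).2
    (((PartialOrder.mem_nerve_nonDegenerate_iff_strictMono (X := P) _).1 hx).comp
      (Fin.succAboveOrderEmb i).strictMono)

/-- For a poset `P`: the full subcategories of `P^[n]` on the nondegenerate simplices of the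
nerve. -/
def E : SemiSub P where
  objs n := (nerve P).nonDegenerate n
  homs _ := ⊤
  id_mem _ _ := trivial
  comp_mem _ _ _ _ _ _ _ _ := trivial
  face_objs := face_nonDegenerate P
  face_homs _ _ _ _ _ _ := trivial

/-- For a poset `P`: nondegenerate simplices of the nerve with compositional morphisms. -/
def G : SemiSub P where
  objs n := (nerve P).nonDegenerate n
  homs n := IsCompositional n
  id_mem _ _ := Or.inl ⟨rfl, rfl⟩
  comp_mem n _ _ _ f g := IsCompositional.comp n f g
  face_objs := face_nonDegenerate P
  face_homs n i _ _ f := IsCompositional.face n i f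

/-- The natural map on representation cohomology from `E_•` to `G_•` induced by the inclusion `G_• ⊆ E_•`. -/
def natEG (k : Type u) [Field k] (n : ℕ) : H k (E P) n →+ H k (G P) n :=
  resH k (S := G P) (T := E P) (fun _ => subset_rfl) (fun _ => le_top) n

end Theories

/-! ### The posets and quivers -/

/-- The poset with elements `0, 1, …, n + 1` and `0 < 1 < j` for all `j ≥ 2`; the `n` elements
`j ≥ 2` are the leaves. -/
inductive Dandelion (n : ℕ) : Type
  | zero
  | one
  | leaf (j : Fin n)

namespace Dandelion

/-- The order relation. -/
protected inductive Le {n : ℕ} : Dandelion n → Dandelion n → Prop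
  | refl (x) : Dandelion.Le x x
  | zero_le (x) : Dandelion.Le zero x
  | one_le_leaf (j) : Dandelion.Le one (leaf j)

instance (n : ℕ) : PartialOrder (Dandelion n) where
  le := Dandelion.Le
  le_refl := Dandelion.Le.refl
  le_trans := by
    rintro _ _ _ (_ | _ | j) (_ | _ | j') <;> constructor
  le_antisymm := by
    rintro _ _ (_ | _ | j) h <;> cases h <;> rfl

end Dandelion

/-- Isomorphism classes of indecomposable representations `M` of the dandelion poset with
`M(0) ≠ 0`. -/
def IndecAtZero (k : Type u) [Field k] (n : ℕ) :=
  {c : IsoClass (Rep k (Dandelion n)) // ∃ M : Rep k (Dandelion n),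
    IsoClass.mk M = c ∧ Indecomposable M ∧ ¬ IsZero (M.obj Dandelion.zero)}

/-- A quiver whose underlying undirected (multi)graph is a cycle: for some `m ≥ 1` its vertices
can be listed as `v_i` and its arrows as `e_i`, `i ∈ ℤ/m`, so that `e_i` joins `v_i` and `v_{i+1}`
in one of the two directions. -/
def IsCyclicQuiver (V : Type w) [Quiver.{v} V] : Prop :=
  ∃ m : ℕ, 1 ≤ m ∧ ∃ (vert : ZMod m ≃ V) (arr : ZMod m ≃ Quiver.Total V), ∀ i : ZMod m,
    ((arr i).left = vert i ∧ (arr i).right = vert (i + 1)) ∨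
      ((arr i).left = vert (i + 1) ∧ (arr i).right = vert i)

end

end RepCoh

universe u₃ v₃
set_option linter.unusedSectionVars false
set_option linter.unusedVariables false

namespace RepCoh

noncomputable section

/-! ### Grothendieck groups: elementary properties -/

section GrBasic

variable {A : Type u₁} [Category.{v₁} A] [Preadditive A] [HasZeroObject A]
  [HasBinaryBiproducts A]

/-! Degree zero cohomology is the group of solutions of `δ⁰x = δ¹x` in a split Grothendieck group,
so the work lies in finding additive invariants that decide this equation. By Krull–Schmidt
(`ksEquiv`) the group is free on indecomposables as soon as Hom spaces are finite-dimensional and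
idempotents split. The multiplicity `mult` of a local object `Z` only needs finite Hom spaces out of
`Z`, so it also works over a category of edges with infinitely many objects.

Linear orders: representations of a chain are detected by the ranks of their structure maps
(`linear_complete`). A cocycle thus becomes a function rank(i, j), and a morphism of edges (i, j) →
(i', j') forces rank(i, i') = rank(j, j'). With all morphisms of edges, every rank except rank(0, n)
takes one common value. Compositional morphisms leave the diagonal ranks and the remaining
off-diagonal ranks independent, which gives a third parameter. The constant class, `jumpClass` and
`discClass` realise all values, and the two ranks used for `E` can be read on `G` as well, which
splits the natural map.

Dandelions: chains have at most three elements. The long edges 0 < j and the triangles 0 < 1 < j are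
isolated objects matched by `δ¹`; this kills degree two and reduces 1-cocycles to their part on
short edges, a copy of the poset above 0. There the coboundary of a class supported above 0 is `1 -
spread` with `spread` of square zero, hence invertible. So each 1-cocycle has exactly one primitive
supported above 0, and 0-cocycles are all classes modulo those supported above 0. Finite generation
then asks for finitely many indecomposables alive at 0: two leaves allow a short list
(`classification`), three leaves contain the four subspace problem (`family`). The identities
between cofaces are checked on objects alone, through partial functors of thin categories extended
by zero (`PMap.gr_congr`).

Cycles: morphisms out of a pullback along the source functor, or into a pullback along the target
functor, are determined on degenerate edges. Hence the source pullback of an indecomposable `J` is a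
summand of the target pullback of `I` only if `I ≅ J` and all morphisms act invertibly on `J`
(`isLocalSystem_of_mem`). Cocycles are therefore free on indecomposable local systems. On a cycle a
local system is its monodromy, an automorphism of a vector space, and the structure theorem over
`k[X]` lists the indecomposable ones. -/

theorem Gr.cls_iso {X Y : A} (e : X ≅ Y) : Gr.cls X = Gr.cls Y := by
  unfold Gr.cls
  rw [IsoClass.sound e]

theorem Gr.cls_biprod (X Y : A) : Gr.cls (X ⊞ Y) = Gr.cls X + Gr.cls Y :=
  map_add Algebra.GrothendieckAddGroup.of (IsoClass.mk X) (IsoClass.mk Y)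

theorem Gr.cls_zero {X : A} (h : IsZero X) : Gr.cls X = 0 := by
  have e : Gr.cls (X ⊞ X) = Gr.cls X := Gr.cls_iso (isoBiprodZero h).symm
  rw [Gr.cls_biprod] at e
  simpa using e

/-- A function on objects that is additive and invariant under isomorphism extends to the
Grothendieck group. -/
def Gr.lift {M : Type w} [AddCommGroup M] (f : A → M) (hi : ∀ X Y, (X ≅ Y) → f X = f Y)
    (ha : ∀ X Y, f (X ⊞ Y) = f X + f Y) : Gr A →+ M :=
  Algebra.GrothendieckAddGroup.lift
    (AddMonoidHom.mk' (M := IsoClass A) (G := M)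
      (Quotient.lift f fun X Y ⟨e⟩ => hi X Y e) (by
        rintro ⟨X⟩ ⟨Y⟩
        exact ha X Y))

theorem Gr.lift_cls {M : Type w} [AddCommGroup M] (f : A → M)
    (hi : ∀ X Y, (X ≅ Y) → f X = f Y) (ha : ∀ X Y, f (X ⊞ Y) = f X + f Y) (X : A) :
    Gr.lift f hi ha (Gr.cls X) = f X :=
  DFunLike.congr_fun (Algebra.GrothendieckAddGroup.lift.symm_apply_apply _) (IsoClass.mk X)

theorem Gr.exists_sub (x : Gr A) : ∃ X Y : A, x = Gr.cls X - Gr.cls Y := by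
  obtain ⟨⟨⟨X⟩, ⟨⟨Y⟩, h'⟩⟩, h⟩ := (AddLocalization.addMonoidOf (⊤ : AddSubmonoid (IsoClass A))).surj x
  exact ⟨X, Y, eq_sub_of_add_eq h⟩

end GrBasic

/-! ### Retracts and indecomposable objects -/

section Indecomposables

variable {A : Type u₁} [Category.{v₁} A] [Preadditive A] [HasZeroObject A]
  [HasBinaryBiproducts A]

/-- The images of the complementary idempotents `p` and `𝟙 - p` are the two summands. -/
theorem exists_iso_biprod_of_idempotent [IsIdempotentComplete A] {X : A} (p : X ⟶ X)
    (hp : p ≫ p = p) : ∃ (Y Z : A) (i : Y ⟶ X) (r : X ⟶ Y) (j : Z ⟶ X) (s : X ⟶ Z),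
      i ≫ r = 𝟙 Y ∧ r ≫ i = p ∧ j ≫ s = 𝟙 Z ∧ s ≫ j = 𝟙 X - p ∧ Nonempty (X ≅ Y ⊞ Z) := by
  obtain ⟨Y, i, r, h1, h2⟩ := IsIdempotentComplete.idempotents_split X p hp
  obtain ⟨Z, j, s, h3, h4⟩ := IsIdempotentComplete.idempotents_split X (𝟙 X - p)
    (Idempotents.idem_of_id_sub_idem p hp)
  have mi : Mono i := ⟨fun a b h => by simpa [h1] using congrArg (· ≫ r) h⟩
  have mj : Mono j := ⟨fun a b h => by simpa [h3] using congrArg (· ≫ s) h⟩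
  have er : Epi r := ⟨fun a b h => by simpa [reassoc_of% h1] using congrArg (i ≫ ·) h⟩
  have es : Epi s := ⟨fun a b h => by simpa [reassoc_of% h3] using congrArg (j ≫ ·) h⟩
  have h5 : i ≫ s = 0 := by
    rw [← cancel_mono j, Category.assoc, h4, ← h2, Preadditive.comp_sub, reassoc_of% h1]
    simp
  have h6 : j ≫ r = 0 := by
    rw [← cancel_mono i, Category.assoc, h2, ← cancel_epi s, reassoc_of% h4,
      Preadditive.sub_comp, hp]
    simp
  refine ⟨Y, Z, i, r, j, s, h1, h2, h3, h4, ⟨⟨biprod.lift r s, biprod.desc i j, ?_, ?_⟩⟩⟩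
  · simp [biprod.lift_desc, h2, h4]
  · ext <;> simp [h1, h3, h5, h6]

/-- The composite `r ≫ i` is an idempotent whose image is isomorphic to `Y`, and the complementary
image is `Z`. Direct summands are produced throughout by exhibiting such a pair `i`, `r`. -/
theorem exists_iso_biprod_of_retract [IsIdempotentComplete A] {X Y : A} (i : Y ⟶ X) (r : X ⟶ Y)
    (h : i ≫ r = 𝟙 Y) : ∃ Z : A, Nonempty (X ≅ Y ⊞ Z) := by
  obtain ⟨Y', Z, i', r', j, s, h1, h2, -, -, ⟨e⟩⟩ :=
    exists_iso_biprod_of_idempotent (r ≫ i) (by simp [reassoc_of% h])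
  refine ⟨Z, ⟨e ≪≫ biprod.mapIso ⟨i' ≫ r, i ≫ r', ?_, ?_⟩ (Iso.refl Z)⟩⟩
  · simp only [Category.assoc, ← reassoc_of% h2]
    simp [h1]
  · simp only [Category.assoc, reassoc_of% h2]
    simp [h]

theorem iso_of_retract_indecomposable [IsIdempotentComplete A] {X Y : A} (hX : Indecomposable X)
    (hY : ¬ IsZero Y) (i : Y ⟶ X) (r : X ⟶ Y) (h : i ≫ r = 𝟙 Y) : Nonempty (X ≅ Y) := by
  obtain ⟨Z, ⟨e⟩⟩ := exists_iso_biprod_of_retract i r h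
  have hZ := (hX.2 _ _ e).resolve_left hY
  exact ⟨e ≪≫ (isoBiprodZero hZ).symm⟩

theorem idempotent_of_indecomposable [IsIdempotentComplete A] {X : A} (hX : Indecomposable X)
    (p : X ⟶ X) (hp : p ≫ p = p) : p = 0 ∨ p = 𝟙 X := by
  obtain ⟨Y, Z, i, r, j, s, -, h2, -, h4, ⟨e⟩⟩ := exists_iso_biprod_of_idempotent p hp
  rcases hX.2 _ _ e with h | h
  · left; rw [← h2, h.eq_of_src i 0]; simp
  · right; rw [h.eq_of_src j 0, comp_zero] at h4; exact (sub_eq_zero.1 h4.symm).symm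

theorem indecomposable_of_idempotent {X : A} (h0 : ¬ IsZero X)
    (h : ∀ p : X ⟶ X, p ≫ p = p → p = 0 ∨ p = 𝟙 X) : Indecomposable X := by
  refine ⟨h0, fun Y Z e => ?_⟩
  have e1 : e.inv ≫ e.hom = 𝟙 _ := e.inv_hom_id
  rcases h (e.hom ≫ biprod.fst ≫ biprod.inl ≫ e.inv) (by simp) with h | h
  · left
    rw [IsZero.iff_id_eq_zero]
    have := congrArg (fun f => biprod.inl ≫ e.inv ≫ f ≫ e.hom ≫ biprod.fst) h
    simpa using this
  · right
    rw [IsZero.iff_id_eq_zero]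
    have := congrArg (fun f => biprod.inr ≫ e.inv ≫ f ≫ e.hom ≫ biprod.snd) h
    simpa using this.symm

theorem indecomposable_of_iso {X Y : A} (e : X ≅ Y) (h : Indecomposable X) : Indecomposable Y :=
  ⟨fun h' => h.1 (h'.of_iso e), fun _ _ e' => h.2 _ _ (e ≪≫ e')⟩

end Indecomposables

/-- In a finite-dimensional algebra without nontrivial idempotents each element is nilpotent or a
unit. -/
theorem isNilpotent_or_isUnit_of_idempotents {k R : Type*} [Field k] [Ring R] [Algebra k R]
    [Module.Finite k R] (h : ∀ e : R, e * e = e → e = 0 ∨ e = 1) (x : R) :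
    IsNilpotent x ∨ IsUnit x := by
  classical
  obtain ⟨q, hq, hq0⟩ := (Algebra.IsIntegral.isIntegral (R := k) x)
  -- The extra factor `X` makes 0 a root, so the exponent `n` below is positive; the unit case needs
  -- this.
  have hq1 : (Polynomial.X * q : Polynomial k) ≠ 0 :=
    mul_ne_zero Polynomial.X_ne_zero hq.ne_zero
  obtain ⟨r, hr, hr'⟩ := Polynomial.exists_eq_pow_rootMultiplicity_mul_and_not_dvd _ hq1 0
  set n := Polynomial.rootMultiplicity 0 (Polynomial.X * q) with hn
  have hnpos : 0 < n := by
    rw [hn, Polynomial.rootMultiplicity_pos hq1]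
    simp
  rw [Polynomial.C_0, sub_zero] at hr hr'
  have hco : IsCoprime (Polynomial.X ^ n) r :=
    ((Polynomial.irreducible_X.coprime_iff_not_dvd).2 hr').pow_left
  obtain ⟨a, b, hab⟩ := hco
  have hz : Polynomial.aeval x (Polynomial.X ^ n * r) = 0 := by
    rw [← hr, map_mul, Polynomial.aeval_def (p := q), hq0, mul_zero]
  have h1 : Polynomial.aeval x (a * Polynomial.X ^ n) + Polynomial.aeval x (b * r) = 1 := by
    rw [← map_add, hab, map_one]
  have h2 : Polynomial.aeval x (a * Polynomial.X ^ n) * Polynomial.aeval x (b * r) = 0 := by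
    rw [← map_mul, show a * Polynomial.X ^ n * (b * r) = a * b * (Polynomial.X ^ n * r) by ring,
      map_mul, hz, mul_zero]
  -- The two Bézout terms evaluate to complementary orthogonal idempotents. If the one divisible by
  -- `x ^ n` is 0, then `x ^ n = 0`; if it is 1, then `x` divides 1.
  rcases h (Polynomial.aeval x (a * Polynomial.X ^ n)) (by
    conv_rhs => rw [← mul_one (Polynomial.aeval x (a * Polynomial.X ^ n)), ← h1, mul_add, h2,
      add_zero]) with h3 | h3
  · left
    rw [h3, zero_add] at h1
    refine ⟨n, ?_⟩
    have : Polynomial.aeval x (Polynomial.X ^ n * (b * r)) = x ^ n := by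
      rw [map_mul, h1]; simp
    rw [← this, show Polynomial.X ^ n * (b * r) = b * (Polynomial.X ^ n * r) by ring, map_mul, hz,
      mul_zero]
  · right
    clear_value n
    obtain ⟨m, rfl⟩ : ∃ m, n = m + 1 := ⟨n - 1, by lia⟩
    refine ⟨⟨x, Polynomial.aeval x (a * Polynomial.X ^ m), ?_, ?_⟩, rfl⟩
    · rw [← h3]
      conv_lhs => rw [← Polynomial.aeval_X (R := k) x]
      simp only [Polynomial.aeval_X]
      conv_lhs => enter [1]; rw [← Polynomial.aeval_X (R := k) x]
      rw [← map_mul]; congr 1; ring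
    · rw [← h3]
      conv_lhs => enter [2]; rw [← Polynomial.aeval_X (R := k) x]
      rw [← map_mul]; congr 1; ring

/-! ### Multiplicities of objects with local endomorphism ring. -/

section Local

variable (k : Type u) [Field k] {A : Type u₁} [Category.{v₁} A] [Preadditive A] [HasZeroObject A]
  [HasBinaryBiproducts A] [Linear k A]

/-- An object is local if its non-invertible endomorphisms are closed under addition. -/
def IsLocalObj (Z : A) : Prop :=
  ¬ IsZero Z ∧ ∀ f g : Z ⟶ Z, IsIso (f + g) → IsIso f ∨ IsIso g

/-- After multiplication by the inverse of `f + g` the two endomorphisms add up to 1; if the first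
is nilpotent, the second is 1 minus a nilpotent, hence a unit. -/
theorem isLocalObj_of_idempotent {Z : A} [Module.Finite k (Z ⟶ Z)] (h0 : ¬ IsZero Z)
    (h : ∀ p : Z ⟶ Z, p ≫ p = p → p = 0 ∨ p = 𝟙 Z) : IsLocalObj Z := by
  refine ⟨h0, fun f g hfg => ?_⟩
  have : Module.Finite k (End Z) := inferInstanceAs (Module.Finite k (Z ⟶ Z))
  rw [← isUnit_iff_isIso] at hfg
  rw [← isUnit_iff_isIso, ← isUnit_iff_isIso]
  obtain ⟨t, ht⟩ := hfg
  have key := isNilpotent_or_isUnit_of_idempotents (k := k) (R := End Z) h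
  have e : (↑t⁻¹ : End Z) * (show End Z from f) + (↑t⁻¹ : End Z) * (show End Z from g) = 1 := by
    rw [← mul_add]
    exact (congrArg (fun x : End Z => (↑t⁻¹ : End Z) * x) ht.symm).trans t.inv_mul
  rcases key ((↑t⁻¹ : End Z) * (show End Z from f)) with h1 | h1
  · right
    have := h1.isUnit_one_sub
    rw [← e, add_sub_cancel_left, Units.isUnit_units_mul] at this
    exact this
  · left
    rwa [Units.isUnit_units_mul] at h1

/-- The radical morphisms `Z ⟶ M`: those that are not the inclusion of a direct summand. -/
def radHom {Z : A} (hZ : IsLocalObj Z) (M : A) : Submodule k (Z ⟶ M) where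
  carrier := {f | ∀ g : M ⟶ Z, ¬ IsIso (f ≫ g)}
  zero_mem' g h := by
    rw [zero_comp] at h
    exact hZ.1 ((IsZero.iff_id_eq_zero Z).2 (by
      rw [← IsIso.hom_inv_id (0 : Z ⟶ Z), zero_comp]))
  add_mem' {f f'} hf hf' g h := by
    rw [Preadditive.add_comp] at h
    exact (hZ.2 _ _ h).elim (hf g) (hf' g)
  smul_mem' c f hf g h := by
    rw [Linear.smul_comp, ← Linear.comp_smul] at h
    exact hf _ h

theorem mem_radHom {Z : A} (hZ : IsLocalObj Z) {M : A} (f : Z ⟶ M) :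
    f ∈ radHom k hZ M ↔ ∀ g : M ⟶ Z, ¬ IsIso (f ≫ g) := Iff.rfl

/-- Morphisms to a biproduct as a product. -/
def homBiprodEquiv (Z M N : A) : (Z ⟶ M ⊞ N) ≃ₗ[k] (Z ⟶ M) × (Z ⟶ N) where
  toFun f := (f ≫ biprod.fst, f ≫ biprod.snd)
  invFun f := biprod.lift f.1 f.2
  map_add' := by simp
  map_smul' := by simp
  left_inv f := by ext <;> simp
  right_inv f := by simp

/-- Locality enters here: an invertible composite through `M ⊞ N` is the sum of a composite through
`M` and one through `N`, so one of these is already invertible. The additivity of `mult` rests on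
this. -/
theorem radHom_biprod {Z : A} (hZ : IsLocalObj Z) (M N : A) :
    (radHom k hZ (M ⊞ N)).map (homBiprodEquiv k Z M N).toLinearMap =
      (radHom k hZ M).prod (radHom k hZ N) := by
  ext ⟨f, g⟩
  rw [Submodule.mem_map_equiv, Submodule.mem_prod, mem_radHom, mem_radHom, mem_radHom]
  change (∀ h, ¬ IsIso (biprod.lift f g ≫ h)) ↔ _
  constructor
  · exact fun h => ⟨fun a ha => h (biprod.fst ≫ a) (by simpa using ha),
      fun a ha => h (biprod.snd ≫ a) (by simpa using ha)⟩
  · rintro ⟨h1, h2⟩ a ha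
    have e : biprod.lift f g ≫ a = f ≫ biprod.inl ≫ a + g ≫ biprod.inr ≫ a := by
      rw [biprod.lift_eq]; simp
    rw [e] at ha
    exact (hZ.2 _ _ ha).elim (h1 _) (h2 _)

/-- Composition with an isomorphism as a linear equivalence. -/
def homCongrRight (Z : A) {M N : A} (e : M ≅ N) : (Z ⟶ M) ≃ₗ[k] (Z ⟶ N) where
  toFun f := f ≫ e.hom
  invFun f := f ≫ e.inv
  map_add' := by simp
  map_smul' := by simp
  left_inv f := by simp
  right_inv f := by simp

theorem radHom_iso {Z : A} (hZ : IsLocalObj Z) {M N : A} (e : M ≅ N) :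
    (radHom k hZ M).map (homCongrRight k Z e).toLinearMap = radHom k hZ N := by
  ext f
  rw [Submodule.mem_map_equiv, mem_radHom, mem_radHom]
  change (∀ h, ¬ IsIso ((f ≫ e.inv) ≫ h)) ↔ _
  exact ⟨fun h g => by simpa using h (e.hom ≫ g), fun h g => by simpa using h (e.inv ≫ g)⟩

/-- A product of submodules as a product of modules. -/
def submoduleProdEquiv {V W : Type*} [AddCommGroup V] [Module k V] [AddCommGroup W] [Module k W]
    (p : Submodule k V) (q : Submodule k W) : p.prod q ≃ₗ[k] p × q where
  toFun x := (⟨x.1.1, x.2.1⟩, ⟨x.1.2, x.2.2⟩)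
  invFun x := ⟨(x.1, x.2), x.1.2, x.2.2⟩
  map_add' _ _ := rfl
  map_smul' _ _ := rfl

/-- The (dimension weighted) multiplicity of a local object `Z`. -/
def mult {Z : A} (hZ : IsLocalObj Z) [∀ M : A, Module.Finite k (Z ⟶ M)] : Gr A →+ ℤ :=
  Gr.lift (fun M => (Module.finrank k (Z ⟶ M) : ℤ) - Module.finrank k (radHom k hZ M))
    (fun M N e => by
      have h1 := (homCongrRight k Z e).finrank_eq
      have h2 := LinearEquiv.finrank_map_eq (homCongrRight k Z e) (radHom k hZ M)
      rw [radHom_iso] at h2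
      simp only [h1, h2])
    (fun M N => by
      have h1 := (homBiprodEquiv k Z M N).finrank_eq
      have h2 := LinearEquiv.finrank_map_eq (homBiprodEquiv k Z M N) (radHom k hZ (M ⊞ N))
      have h3 := (submoduleProdEquiv k (radHom k hZ M) (radHom k hZ N)).finrank_eq
      rw [radHom_biprod, h3] at h2
      rw [Module.finrank_prod] at h1 h2
      rw [h1, ← h2]
      push_cast
      ring)

/-- The identity of `Z` is not radical, so the radical is a proper subspace of the endomorphisms. -/
theorem mult_cls_self {Z : A} (hZ : IsLocalObj Z) [∀ M : A, Module.Finite k (Z ⟶ M)] :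
    mult k hZ (Gr.cls Z) ≠ 0 := by
  rw [mult, Gr.lift_cls, sub_ne_zero]
  have : radHom k hZ Z ≠ ⊤ := fun h => by
    have h1 : 𝟙 Z ∈ radHom k hZ Z := h ▸ Submodule.mem_top
    exact h1 (𝟙 Z) (by simpa using IsIso.id Z)
  exact_mod_cast (Submodule.finrank_lt this).ne'

theorem mult_cls_eq_zero {Z : A} (hZ : IsLocalObj Z) [∀ M : A, Module.Finite k (Z ⟶ M)] {M : A}
    (h : ∀ (f : Z ⟶ M) (g : M ⟶ Z), ¬ IsIso (f ≫ g)) : mult k hZ (Gr.cls M) = 0 := by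
  have : radHom k hZ M = ⊤ := by
    ext f
    exact ⟨fun _ => trivial, fun _ => h f⟩
  rw [mult, Gr.lift_cls, this, finrank_top, sub_self]

end Local

/-! ### The Krull–Schmidt theorem -/

section KrullSchmidt

variable (k : Type u) [Field k] (A : Type u₁) [Category.{v₁} A] [Preadditive A] [HasZeroObject A]
  [HasBinaryBiproducts A]

/-- Isomorphism classes of indecomposable objects. -/
def Ind : Type u₁ := {c : IsoClass A // ∃ X : A, IsoClass.mk X = c ∧ Indecomposable X}

variable {A}

/-- A representative of a class of indecomposable objects. -/
def Ind.out (I : Ind A) : A := I.2.choose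

theorem Ind.mk_out (I : Ind A) : IsoClass.mk I.out = I.1 := I.2.choose_spec.1

theorem Ind.indecomposable (I : Ind A) : Indecomposable I.out := I.2.choose_spec.2

/-- The class of an indecomposable object. -/
def Ind.mk {X : A} (h : Indecomposable X) : Ind A := ⟨IsoClass.mk X, X, rfl, h⟩

theorem IsoClass.exact {X Y : A} (h : IsoClass.mk X = IsoClass.mk Y) : Nonempty (X ≅ Y) :=
  Quotient.exact (s := isIsomorphicSetoid A) h

theorem Ind.out_mk {X : A} (h : Indecomposable X) : Nonempty ((Ind.mk h).out ≅ X) :=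
  IsoClass.exact (Ind.mk_out _)

theorem Ind.eq_of_iso {I J : Ind A} (e : I.out ≅ J.out) : I = J :=
  Subtype.ext (by rw [← I.mk_out, ← J.mk_out, IsoClass.sound e])

/-- The homomorphism from the free abelian group on the indecomposables. -/
def ksHom : (Ind A →₀ ℤ) →+ Gr A :=
  (Finsupp.linearCombination ℤ fun I : Ind A => Gr.cls I.out).toAddMonoidHom

theorem ksHom_single (I : Ind A) (n : ℤ) : ksHom (Finsupp.single I n) = n • Gr.cls I.out :=
  Finsupp.linearCombination_single ℤ n I

variable [Linear k A] [IsIdempotentComplete A]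

theorem isLocalObj_of_indecomposable {Z : A} [Module.Finite k (Z ⟶ Z)] (h : Indecomposable Z) :
    IsLocalObj Z :=
  isLocalObj_of_idempotent k h.1 (idempotent_of_indecomposable h)

theorem not_isIso_comp_of_indecomposable {X Y : A} (hX : Indecomposable X) (hY : Indecomposable Y)
    (h : IsEmpty (X ≅ Y)) (f : X ⟶ Y) (g : Y ⟶ X) : ¬ IsIso (f ≫ g) := fun _ =>
  let ⟨e⟩ := iso_of_retract_indecomposable hY hX.1 f (g ≫ inv (f ≫ g)) (by
    rw [← Category.assoc, IsIso.hom_inv_id])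
  h.false e.symm

variable [∀ X Y : A, Module.Finite k (X ⟶ Y)]

/-- The matrix of multiplicities against classes of indecomposables is diagonal, because an
indecomposable is not a retract of a non-isomorphic one. Injectivity of `ksHom` follows. -/
theorem mult_ksHom (I : Ind A) (f : Ind A →₀ ℤ) :
    mult k (isLocalObj_of_indecomposable k I.indecomposable) (ksHom f) =
      f I * mult k (isLocalObj_of_indecomposable k I.indecomposable) (Gr.cls I.out) := by
  change mult k _ (Finsupp.linearCombination ℤ (fun I : Ind A => Gr.cls I.out) f) = _
  rw [Finsupp.linearCombination_apply, Finsupp.sum, map_sum, Finset.sum_eq_single I]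
  · rw [map_zsmul, smul_eq_mul]
  · intro J _ hJ
    rw [map_zsmul, mult_cls_eq_zero, smul_zero]
    exact not_isIso_comp_of_indecomposable I.indecomposable J.indecomposable ⟨fun e => hJ (Ind.eq_of_iso e).symm⟩
  · intro h
    rw [Finsupp.notMem_support_iff.1 h, zero_smul, map_zero]

include k in
theorem ksHom_injective : Function.Injective (ksHom (A := A)) := by
  rw [injective_iff_map_eq_zero]
  intro f hf
  ext I
  have h1 := mult_ksHom k I f
  rw [hf, map_zero, eq_comm, mul_eq_zero] at h1
  exact h1.resolve_right (mult_cls_self k _)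

/-- Block-diagonal endomorphisms embed `End Y × End Z` into `End X`, and `End Z` is nonzero. This is
the decreasing quantity in the decomposition into indecomposables. -/
theorem finrank_end_lt {X Y Z : A} (e : X ≅ Y ⊞ Z) (h : ¬ IsZero Z) :
    Module.finrank k (Y ⟶ Y) < Module.finrank k (X ⟶ X) := by
  let φ : ((Y ⟶ Y) × (Z ⟶ Z)) →ₗ[k] (X ⟶ X) :=
    { toFun := fun f => e.hom ≫ biprod.map f.1 f.2 ≫ e.inv
      map_add' := fun f g => by
        rw [← Preadditive.comp_add, ← Preadditive.add_comp]
        congr 2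
        ext <;> simp
      map_smul' := fun c f => by
        simp only [RingHom.id_apply]
        rw [← Linear.comp_smul, ← Linear.smul_comp]
        congr 2
        ext <;> simp }
  have hφ : Function.Injective φ := by
    rintro ⟨f, g⟩ ⟨f', g'⟩ h
    have h' : e.hom ≫ biprod.map f g ≫ e.inv = e.hom ≫ biprod.map f' g' ≫ e.inv := h
    rw [cancel_epi, cancel_mono] at h'
    refine Prod.ext ?_ ?_
    · simpa using congrArg (fun t => biprod.inl ≫ t ≫ biprod.fst) h'
    · simpa using congrArg (fun t => biprod.inr ≫ t ≫ biprod.snd) h'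
  have h1 := LinearMap.finrank_le_finrank_of_injective hφ
  have : Nontrivial (Z ⟶ Z) := ⟨𝟙 Z, 0, fun h' => h ((IsZero.iff_id_eq_zero Z).2 h')⟩
  have h2 : 0 < Module.finrank k (Z ⟶ Z) := Module.finrank_pos
  rw [Module.finrank_prod] at h1
  lia

include k in
theorem cls_mem_range_ksHom (X : A) : Gr.cls X ∈ (ksHom (A := A)).range := by
  induction hn : Module.finrank k (X ⟶ X) using Nat.strong_induction_on generalizing X with
  | _ n ih =>
    by_cases h0 : IsZero X
    · rw [Gr.cls_zero h0]
      exact zero_mem _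
    by_cases hX : Indecomposable X
    · obtain ⟨e⟩ := Ind.out_mk hX
      exact ⟨Finsupp.single (Ind.mk hX) 1, by rw [ksHom_single, one_smul, Gr.cls_iso e]⟩
    · have h : ∃ Y Z, ∃ _ : X ≅ Y ⊞ Z, ¬ IsZero Y ∧ ¬ IsZero Z := by
        by_contra! h
        exact hX ⟨h0, fun Y Z e => or_iff_not_imp_left.2 (h Y Z e)⟩
      obtain ⟨Y, Z, e, hY, hZ⟩ := h
      rw [Gr.cls_iso e, Gr.cls_biprod]
      exact add_mem (ih _ (hn ▸ finrank_end_lt k e hZ) Y rfl)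
        (ih _ (hn ▸ finrank_end_lt k (e ≪≫ biprod.braiding Y Z) hY) Z rfl)

include k in
theorem ksHom_surjective : Function.Surjective (ksHom (A := A)) := fun x => by
  obtain ⟨X, Y, rfl⟩ := Gr.exists_sub x
  exact sub_mem (cls_mem_range_ksHom k X) (cls_mem_range_ksHom k Y)

variable (A) in
/-- Krull–Schmidt: the Grothendieck group is free on the indecomposables. -/
def ksEquiv : (Ind A →₀ ℤ) ≃+ Gr A :=
  AddEquiv.ofBijective ksHom ⟨ksHom_injective k, ksHom_surjective k⟩

end KrullSchmidt

end

end RepCoh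

namespace RepCoh

noncomputable section

/-! ### Representations: elementwise constructions -/

section RepBasic

variable {k : Type u} [Field k] {C : Type u₁} [Category.{v₁} C]

/-- The linear map by which a morphism acts in a representation. -/
def lin (M : Rep k C) {x y : C} (f : x ⟶ y) : M.obj x →ₗ[k] M.obj y := (M.map f).hom.hom

/-- The linear map at an object of a morphism of representations. -/
def app {M N : Rep k C} (f : M ⟶ N) (x : C) : M.obj x →ₗ[k] N.obj x := (f.app x).hom.hom

@[simp]
theorem lin_id (M : Rep k C) (x : C) : lin M (𝟙 x) = LinearMap.id := by
  simp only [lin, M.map_id]; rfl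

@[simp]
theorem lin_comp (M : Rep k C) {x y z : C} (f : x ⟶ y) (g : y ⟶ z) :
    lin M (f ≫ g) = lin M g ∘ₗ lin M f := by
  simp only [lin, M.map_comp]; rfl

theorem lin_comp_apply (M : Rep k C) {x y z : C} (f : x ⟶ y) (g : y ⟶ z) (v : M.obj x) :
    lin M (f ≫ g) v = lin M g (lin M f v) := by
  rw [lin_comp]; rfl

@[simp]
theorem app_id (M : Rep k C) (x : C) : app (𝟙 M) x = LinearMap.id := rfl

@[simp]
theorem app_comp {M N L : Rep k C} (f : M ⟶ N) (g : N ⟶ L) (x : C) :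
    app (f ≫ g) x = app g x ∘ₗ app f x := rfl

@[simp]
theorem app_zero (M N : Rep k C) (x : C) : app (0 : M ⟶ N) x = 0 := rfl

@[simp]
theorem app_add {M N : Rep k C} (f g : M ⟶ N) (x : C) : app (f + g) x = app f x + app g x := rfl

theorem app_lin {M N : Rep k C} (f : M ⟶ N) {x y : C} (g : x ⟶ y) (v : M.obj x) :
    app f y (lin M g v) = lin N g (app f x v) := by
  have := congrArg (fun t => t.hom.hom v) (f.naturality g)
  exact this

theorem Rep.hom_ext {M N : Rep k C} {f g : M ⟶ N} (h : ∀ x, app f x = app g x) : f = g := by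
  ext x : 2
  exact FGModuleCat.hom_ext (h x)

/-- A representation from its linear maps. -/
def repMk (V : C → Type u) [∀ x, AddCommGroup (V x)] [∀ x, Module k (V x)]
    [∀ x, Module.Finite k (V x)] (φ : ∀ {x y : C}, (x ⟶ y) → (V x →ₗ[k] V y))
    (h1 : ∀ x, φ (𝟙 x) = LinearMap.id)
    (h2 : ∀ {x y z : C} (f : x ⟶ y) (g : y ⟶ z), φ (f ≫ g) = φ g ∘ₗ φ f) : Rep k C where
  obj x := FGModuleCat.of k (V x)
  map f := FGModuleCat.ofHom (φ f)
  map_id x := by rw [h1]; rfl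
  map_comp f g := by rw [h2]; rfl

/-- A morphism of representations from its linear maps. -/
def homMk {M N : Rep k C} (f : ∀ x, M.obj x →ₗ[k] N.obj x)
    (h : ∀ {x y : C} (g : x ⟶ y) (v : M.obj x), f y (lin M g v) = lin N g (f x v)) : M ⟶ N where
  app x := FGModuleCat.ofHom (f x)
  naturality _ _ g := FGModuleCat.hom_ext (LinearMap.ext (h g))

@[simp]
theorem app_homMk {M N : Rep k C} (f : ∀ x, M.obj x →ₗ[k] N.obj x)
    (h : ∀ {x y : C} (g : x ⟶ y) (v : M.obj x), f y (lin M g v) = lin N g (f x v)) (x : C) :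
    app (homMk f h) x = f x := rfl

/-- An isomorphism of representations from linear equivalences. -/
def isoMk {M N : Rep k C} (f : ∀ x, M.obj x ≃ₗ[k] N.obj x)
    (h : ∀ {x y : C} (g : x ⟶ y) (v : M.obj x), f y (lin M g v) = lin N g (f x v)) : M ≅ N where
  hom := homMk (fun x => (f x).toLinearMap) h
  inv := homMk (fun x => (f x).symm.toLinearMap) fun g v => by
    rw [LinearEquiv.coe_coe, LinearEquiv.symm_apply_eq, h g]
    simp
  hom_inv_id := Rep.hom_ext fun x => by simp
  inv_hom_id := Rep.hom_ext fun x => by simp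

/-- The linear equivalences of an isomorphism of representations. -/
def isoApp {M N : Rep k C} (e : M ≅ N) (x : C) : M.obj x ≃ₗ[k] N.obj x :=
  LinearEquiv.ofLinearMap (app e.hom x) (app e.inv x)
    (by rw [← app_comp, e.inv_hom_id, app_id]) (by rw [← app_comp, e.hom_inv_id, app_id])

theorem Rep.isZero_iff (M : Rep k C) : IsZero M ↔ ∀ x, Subsingleton (M.obj x) := by
  rw [IsZero.iff_id_eq_zero]
  constructor
  · refine fun h x => ⟨fun a b => ?_⟩
    have h' : ∀ v : M.obj x, v = 0 := fun v => by
      have := DFunLike.congr_fun (congrArg (fun t => app t x) h) v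
      exact this
    rw [h' a, h' b]
  · intro h
    exact Rep.hom_ext fun x => LinearMap.ext fun v => (h x).elim _ _

instance (M N : Rep k C) [Finite C] : Module.Finite k (M ⟶ N) := by
  let φ : (M ⟶ N) →ₗ[k] (∀ x, M.obj x →ₗ[k] N.obj x) :=
    { toFun := fun f x => app f x
      map_add' := fun _ _ => rfl
      map_smul' := fun _ _ => rfl }
  exact Module.Finite.of_injective φ fun f g h => Rep.hom_ext fun x => congrFun h x

/-- The values of a direct sum of representations. -/
def biprodObj (M N : Rep k C) (x : C) : (M ⊞ N).obj x ≃ₗ[k] M.obj x × N.obj x where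
  toFun v := (app biprod.fst x v, app biprod.snd x v)
  map_add' := by simp
  map_smul' := by simp
  invFun v := app biprod.inl x v.1 + app biprod.inr x v.2
  left_inv v := by
    have := DFunLike.congr_fun (congrArg (fun t => app t x) (biprod.total (X := M) (Y := N))) v
    exact this
  right_inv v := by
    have h {X Y Z : Rep k C} (f : X ⟶ Y) (g : Y ⟶ Z) (u) : app g x (app f x u) = app (f ≫ g) x u :=
      rfl
    ext <;> simp [h]

theorem biprodObj_lin (M N : Rep k C) {x y : C} (f : x ⟶ y) (v : (M ⊞ N).obj x) :
    biprodObj M N y (lin (M ⊞ N) f v) =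
      ((lin M f).prodMap (lin N f)) (biprodObj M N x v) := by
  ext
  · exact app_lin _ f v
  · exact app_lin _ f v

/-- Linear maps conjugate under equivalences have ranges of the same dimension. -/
theorem finrank_range_eq_of_conj {V W V' W' : Type*} [AddCommGroup V] [Module k V]
    [AddCommGroup W] [Module k W] [AddCommGroup V'] [Module k V'] [AddCommGroup W'] [Module k W']
    (a : V ≃ₗ[k] V') (b : W ≃ₗ[k] W') (f : V →ₗ[k] W) (g : V' →ₗ[k] W')
    (h : ∀ v, b (f v) = g (a v)) :
    Module.finrank k (LinearMap.range f) = Module.finrank k (LinearMap.range g) := by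
  have e : (LinearMap.range f).map b.toLinearMap = LinearMap.range g := by
    ext w
    constructor
    · rintro ⟨_, ⟨v, rfl⟩, rfl⟩
      exact ⟨a v, (h v).symm⟩
    · rintro ⟨v, rfl⟩
      exact ⟨f (a.symm v), ⟨_, rfl⟩, by simp [h]⟩
  rw [← e]
  exact (LinearEquiv.finrank_map_eq b _).symm

variable (k) in
/-- The rank of the action of a morphism. -/
def rk {x y : C} (f : x ⟶ y) : Gr (Rep k C) →+ ℤ :=
  Gr.lift (fun M => (Module.finrank k (LinearMap.range (lin M f)) : ℤ))
    (fun M N e => congrArg _ (finrank_range_eq_of_conj (isoApp e x) (isoApp e y) _ _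
      (app_lin e.hom f)))
    (fun M N => by
      rw [finrank_range_eq_of_conj (biprodObj M N x) (biprodObj M N y) _ _ (biprodObj_lin M N f),
        LinearMap.range_prodMap, (submoduleProdEquiv k _ _).finrank_eq, Module.finrank_prod]
      push_cast
      rfl)

theorem rk_cls {x y : C} (f : x ⟶ y) (M : Rep k C) :
    rk k f (Gr.cls M) = Module.finrank k (LinearMap.range (lin M f)) :=
  Gr.lift_cls _ _ _ M

theorem rk_map_res {D : Type u₂} [Category.{v₂} D] (F : C ⥤ D) {x y : C} (f : x ⟶ y)
    (z : Gr (Rep k D)) : rk k f (Gr.map (Rep.res k F) z) = rk k (F.map f) z := by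
  have : (rk k f).comp (Gr.map (Rep.res k F)) = rk k (F.map f) := Gr.hom_ext fun M => by
    rw [AddMonoidHom.comp_apply, Gr.map_cls, rk_cls, rk_cls]
    rfl
  exact DFunLike.congr_fun this z

end RepBasic

/-! ### Partial restriction along partial maps of thin categories -/

section Partial

/-- A functor to a thin category defined on a convex part of a category. -/
structure PMap (B : Type u₁) [Category.{v₁} B] (A : Type u₂) [Category.{v₂} A] where
  P : B → Prop
  f : B → A
  hom : ∀ {x y : B}, P x → P y → (x ⟶ y) → Nonempty (f x ⟶ f y)
  convex : ∀ {x y z : B}, (x ⟶ y) → (y ⟶ z) → P x → P z → P y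

variable (k : Type u) [Field k] {B : Type u₁} [Category.{v₁} B] {A : Type u₂} [Category.{v₂} A]
  {D : Type u₃} [Category.{v₃} D] [Quiver.IsThin A] [Quiver.IsThin B] [Quiver.IsThin D]

/-- The chosen morphism. -/
def PMap.map (φ : PMap B A) {x y : B} (hx : φ.P x) (hy : φ.P y) (g : x ⟶ y) : φ.f x ⟶ φ.f y :=
  (φ.hom hx hy g).some

variable {k} in
theorem lin_thin (M : Rep k A) {x y : A} (f g : x ⟶ y) : lin M f = lin M g := by
  rw [Subsingleton.elim f g]

open Classical in
/-- The action of morphisms in an extension by zero. -/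
def extMap (φ : PMap B A) (M : Rep k A) {x y : B} (g : x ⟶ y) :
    (PLift (φ.P x) → M.obj (φ.f x)) →ₗ[k] (PLift (φ.P y) → M.obj (φ.f y)) :=
  LinearMap.pi fun hy =>
    if hx : φ.P x then lin M (φ.map hx hy.down g) ∘ₗ LinearMap.proj ⟨hx⟩ else 0

variable {k} in
theorem extMap_apply (φ : PMap B A) (M : Rep k A) {x y : B} (g : x ⟶ y) (hx : φ.P x) (hy : φ.P y)
    (v) (h : φ.f x ⟶ φ.f y) : extMap k φ M g v ⟨hy⟩ = lin M h (v ⟨hx⟩) := by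
  rw [extMap, LinearMap.pi_apply, dif_pos hx, lin_thin M h (φ.map hx hy g)]
  rfl

variable {k} in
theorem extMap_apply_of_not (φ : PMap B A) (M : Rep k A) {x y : B} (g : x ⟶ y) (hx : ¬ φ.P x)
    (v) : extMap k φ M g v = 0 := by
  ext hy
  rw [extMap, LinearMap.pi_apply, dif_neg hx]
  rfl

/-- The restriction of a representation along a partial functor, extended by zero. -/
def extObj (φ : PMap B A) (M : Rep k A) : Rep k B :=
  repMk (fun x => PLift (φ.P x) → M.obj (φ.f x)) (extMap k φ M)
    (fun x => by
      refine LinearMap.ext fun v => funext fun ⟨hx⟩ => ?_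
      rw [extMap_apply φ M (𝟙 x) hx hx v (𝟙 _)]
      simp)
    (fun {x y z} g h => by
      refine LinearMap.ext fun v => funext fun ⟨hz⟩ => ?_
      rw [LinearMap.comp_apply]
      by_cases hx : φ.P x
      -- Convexity makes the extension by zero functorial: a composite between two points of the
      -- domain never passes through a point where the value was replaced by zero.
      · have hy := φ.convex g h hx hz
        rw [extMap_apply φ M h hy hz _ (φ.map hy hz h),
          extMap_apply φ M g hx hy _ (φ.map hx hy g),
          extMap_apply φ M (g ≫ h) hx hz _ (φ.map hx hy g ≫ φ.map hy hz h), lin_comp_apply]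
      · rw [extMap_apply_of_not φ M _ hx, extMap_apply_of_not φ M _ hx, map_zero])

/-- The functor of partial restriction. -/
def ext (φ : PMap B A) : Rep k A ⥤ Rep k B where
  obj M := extObj k φ M
  map {M N} f := homMk (M := extObj k φ M) (N := extObj k φ N)
    (fun x => LinearMap.pi fun hx => app f _ ∘ₗ LinearMap.proj hx) (by
      intro x y g
      suffices H : ∀ (v : PLift (φ.P x) → M.obj (φ.f x)) (hy : φ.P y),
          app f _ (extMap k φ M g v ⟨hy⟩) =
            extMap k φ N g (fun hx : PLift (φ.P x) => app f _ (v hx)) ⟨hy⟩ from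
        fun v => funext fun ⟨hy⟩ => H v hy
      intro v hy
      by_cases hx : φ.P x
      · rw [extMap_apply φ M g hx hy v (φ.map hx hy g), extMap_apply φ N g hx hy _ (φ.map hx hy g),
          app_lin]
      · rw [extMap_apply_of_not _ _ _ hx, extMap_apply_of_not _ _ _ hx]
        exact map_zero _)
  map_id M := rfl
  map_comp f g := rfl

instance (φ : PMap B A) : (ext k φ).Additive where
  map_add := rfl

/-- The homomorphism of Grothendieck groups given by partial restriction. -/
def PMap.gr (φ : PMap B A) : Gr (Rep k A) →+ Gr (Rep k B) := Gr.map (ext k φ)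

theorem PMap.gr_cls (φ : PMap B A) (M : Rep k A) : φ.gr k (Gr.cls M) = Gr.cls (extObj k φ M) :=
  Gr.map_cls _ M

variable {k} in
/-- The data of an isomorphism with an extension by zero. -/
def extIso (φ : PMap B A) (M : Rep k A) (N : Rep k B)
    (e : ∀ x, φ.P x → (M.obj (φ.f x) ≃ₗ[k] N.obj x))
    (h0 : ∀ x, ¬ φ.P x → Subsingleton (N.obj x))
    (h : ∀ {x y} (hx : φ.P x) (hy : φ.P y) (g : x ⟶ y) (v),
      e y hy (lin M (φ.map hx hy g) v) = lin N g (e x hx v)) : extObj k φ M ≅ N := by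
  classical
  let e' (x : B) : (PLift (φ.P x) → M.obj (φ.f x)) ≃ₗ[k] N.obj x :=
    if hx : φ.P x then
      haveI : Unique (PLift (φ.P x)) := ⟨⟨⟨hx⟩⟩, fun _ => rfl⟩
      (LinearEquiv.funUnique (PLift (φ.P x)) k (M.obj (φ.f x))) ≪≫ₗ e x hx
    else
      haveI := h0 x hx
      haveI : IsEmpty (PLift (φ.P x)) := ⟨fun t => hx t.down⟩
      ⟨⟨⟨fun _ => 0, fun _ _ => by simp⟩, fun _ _ => by simp⟩, fun _ => 0,
        fun _ => Subsingleton.elim _ _, fun _ => Subsingleton.elim _ _⟩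
  have he' (x : B) (hx : φ.P x) (v) : e' x v = e x hx (v ⟨hx⟩) := by
    simp only [e', dif_pos hx]
    rfl
  refine isoMk (M := extObj k φ M) e' fun {x y : B} g => ?_
  suffices H : ∀ v : PLift (φ.P x) → M.obj (φ.f x), e' y (extMap k φ M g v) = lin N g (e' x v) from H
  intro v
  by_cases hx : φ.P x
  · by_cases hy : φ.P y
    · rw [he' _ hx, he' _ hy, extMap_apply φ M g hx hy v (φ.map hx hy g), h]
    · have := h0 y hy
      exact Subsingleton.elim _ _
  · have h1 : v = 0 := funext fun t => (hx t.down).elim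
    rw [h1, map_zero, map_zero, map_zero, map_zero]

variable {k} in
/-- The value of an extension by zero on its domain. -/
def extEval (φ : PMap B A) (M : Rep k A) (x : B) (h : φ.P x) :
    (extObj k φ M).obj x ≃ₗ[k] M.obj (φ.f x) :=
  haveI : Unique (PLift (φ.P x)) := ⟨⟨⟨h⟩⟩, fun _ => rfl⟩
  LinearEquiv.funUnique (PLift (φ.P x)) k (M.obj (φ.f x))

variable {k} in
theorem extEval_lin (φ : PMap B A) (M : Rep k A) {x y : B} (hx : φ.P x) (hy : φ.P y) (g : x ⟶ y)
    (h : φ.f x ⟶ φ.f y) (v) :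
    extEval φ M y hy (lin (extObj k φ M) g v) = lin M h (extEval φ M x hx v) :=
  extMap_apply φ M g hx hy v h

variable {k} in
theorem subsingleton_extObj (φ : PMap B A) (M : Rep k A) {x : B}
    (h : ∀ _ : φ.P x, Subsingleton (M.obj (φ.f x))) : Subsingleton ((extObj k φ M).obj x) := by
  suffices H : Subsingleton (PLift (φ.P x) → M.obj (φ.f x)) from H
  exact ⟨fun a b => funext fun t => (h t.down).elim _ _⟩

variable {k} in
/-- The identification of values of a representation at equal objects. -/
def eqEquiv (M : Rep k A) {a b : A} (h : a = b) : M.obj a ≃ₗ[k] M.obj b :=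
  LinearEquiv.ofLinearMap (lin M (eqToHom h)) (lin M (eqToHom h.symm))
    (by rw [← lin_comp]; simp) (by rw [← lin_comp]; simp)

variable {k} in
theorem eqEquiv_apply (M : Rep k A) {a b : A} (h : a = b) (v) :
    eqEquiv M h v = lin M (eqToHom h) v := rfl

/-- In a thin category parallel morphisms agree, so a partial functor acts on classes through its
domain and its object map alone. Identities between faces, cuts and spreads reduce to a check on
objects. -/
theorem PMap.gr_congr (φ ψ : PMap B A) (hP : ∀ x, φ.P x ↔ ψ.P x) (hf : ∀ x, φ.P x → φ.f x = ψ.f x) :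
    φ.gr k = ψ.gr k := Gr.hom_ext fun M => by
  rw [PMap.gr_cls, PMap.gr_cls]
  refine Gr.cls_iso (extIso φ M _
    (fun x hx => eqEquiv M (hf x hx) ≪≫ₗ (extEval ψ M x ((hP x).1 hx)).symm)
    (fun x hx => subsingleton_extObj ψ M fun h => (hx ((hP x).2 h)).elim) ?_)
  intro x y hx hy g v
  have hx' := (hP x).1 hx
  have hy' := (hP y).1 hy
  apply (extEval ψ M y hy').injective
  rw [extEval_lin ψ M hx' hy' g (ψ.map hx' hy' g)]
  simp only [LinearEquiv.trans_apply, LinearEquiv.apply_symm_apply, eqEquiv_apply]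
  rw [← lin_comp_apply, ← lin_comp_apply]
  exact DFunLike.congr_fun (lin_thin M _ _) v

/-- Composition of partial functors. -/
abbrev PMap.comp (φ : PMap B A) (ψ : PMap A D) : PMap B D where
  P x := φ.P x ∧ ψ.P (φ.f x)
  f x := ψ.f (φ.f x)
  hom hx hy g := ψ.hom hx.2 hy.2 (φ.map hx.1 hy.1 g)
  convex g h hx hz :=
    have hy := φ.convex g h hx.1 hz.1
    ⟨hy, ψ.convex (φ.map hx.1 hy g) (φ.map hy hz.1 h) hx.2 hz.2⟩

/-- A functor as an everywhere defined partial functor. -/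
abbrev PMap.ofFunctor (F : B ⥤ A) : PMap B A where
  P _ := True
  f := F.obj
  hom _ _ g := ⟨F.map g⟩
  convex _ _ _ _ := trivial

/-- The identity on a convex part. -/
abbrev PMap.cut (P : B → Prop) (h : ∀ {x y z : B}, (x ⟶ y) → (y ⟶ z) → P x → P z → P y) :
    PMap B B where
  P := P
  f := id
  hom _ _ g := ⟨g⟩
  convex := h

theorem PMap.gr_comp (φ : PMap B A) (ψ : PMap A D) (x : Gr (Rep k D)) :
    (φ.comp ψ).gr k x = φ.gr k (ψ.gr k x) := by
  suffices h : (φ.comp ψ).gr k = (φ.gr k).comp (ψ.gr k) from DFunLike.congr_fun h x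
  refine Gr.hom_ext fun M => ?_
  rw [AddMonoidHom.comp_apply, PMap.gr_cls, PMap.gr_cls, PMap.gr_cls]
  refine Gr.cls_iso (extIso (φ.comp ψ) M _
    (fun x hx => (extEval ψ M _ hx.2).symm ≪≫ₗ (extEval φ _ x hx.1).symm)
    (fun x hx => subsingleton_extObj φ _ fun h => subsingleton_extObj ψ _ fun h' =>
      (hx ⟨h, h'⟩).elim) ?_)
  intro x y hx hy g v
  apply (extEval φ _ y hy.1).injective
  rw [extEval_lin φ _ hx.1 hy.1 g (φ.map hx.1 hy.1 g)]
  apply (extEval ψ M _ hy.2).injective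
  rw [extEval_lin ψ M hx.2 hy.2 _ (ψ.map hx.2 hy.2 (φ.map hx.1 hy.1 g))]
  simp only [LinearEquiv.trans_apply, LinearEquiv.apply_symm_apply]
  exact DFunLike.congr_fun (lin_thin M _ _) v

theorem PMap.gr_ofFunctor (F : B ⥤ A) : (PMap.ofFunctor F).gr k = Gr.map (Rep.res k F) :=
  Gr.hom_ext fun M => by
    rw [PMap.gr_cls, Gr.map_cls]
    refine Gr.cls_iso (extIso (PMap.ofFunctor F) M _ (fun x _ => LinearEquiv.refl k _)
      (fun x hx => (hx trivial).elim) ?_)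
    intro x y hx hy g v
    exact DFunLike.congr_fun (lin_thin M _ (F.map g)) v

theorem PMap.gr_eq_zero (φ : PMap B A) (h : ∀ x, ¬ φ.P x) : φ.gr k = 0 := Gr.hom_ext fun M => by
  rw [PMap.gr_cls, AddMonoidHom.zero_apply]
  exact Gr.cls_zero ((Rep.isZero_iff _).2 fun x => subsingleton_extObj φ M fun hx => (h x hx).elim)

theorem PMap.gr_eq_id (φ : PMap B B) (hP : ∀ x, φ.P x) (hf : ∀ x, φ.f x = x) :
    φ.gr k = AddMonoidHom.id _ := by
  have h1 := φ.gr_congr k (PMap.ofFunctor (𝟭 B)) (fun x => ⟨fun _ => trivial, fun _ => hP x⟩)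
    (fun x _ => hf x)
  rw [h1, PMap.gr_ofFunctor]
  refine Gr.hom_ext fun M => ?_
  rw [Gr.map_cls]
  exact Gr.cls_iso (Functor.leftUnitor M)

/-! ### Splitting a representation along a union of connected components. -/

open Classical in
variable {k} in
/-- The projection onto the restriction to a union of components. -/
def toCut (P : B → Prop) (hP) (hPQ : ∀ {x y : B}, (x ⟶ y) → (P x ↔ P y)) (M : Rep k B) :
    M ⟶ extObj k (PMap.cut P hP) M :=
  homMk (N := extObj k (PMap.cut P hP) M)
    (fun x => if h : P x then (extEval (PMap.cut P hP) M x h).symm.toLinearMap else 0)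
    (fun {x y} g v => by
      by_cases hx : P x
      · have hy := (hPQ g).1 hx
        apply (extEval (PMap.cut P hP) M y hy).injective
        simp only [hx, hy, dif_pos]
        rw [extEval_lin (PMap.cut P hP) M hx hy g g]
        simp only [LinearEquiv.coe_coe, LinearEquiv.apply_symm_apply]
      · have hy : ¬ P y := fun h => hx ((hPQ g).2 h)
        simp [hx, hy])

open Classical in
variable {k} in
/-- The inclusion of the restriction to a union of components. -/
def ofCut (P : B → Prop) (hP) (hPQ : ∀ {x y : B}, (x ⟶ y) → (P x ↔ P y)) (M : Rep k B) :
    extObj k (PMap.cut P hP) M ⟶ M :=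
  homMk (M := extObj k (PMap.cut P hP) M)
    (fun x => if h : P x then (extEval (PMap.cut P hP) M x h).toLinearMap else 0)
    (fun {x y} g v => by
      by_cases hx : P x
      · have hy := (hPQ g).1 hx
        simp only [hx, hy, dif_pos]
        exact extEval_lin (PMap.cut P hP) M hx hy g g v
      · have hy : ¬ P y := fun h => hx ((hPQ g).2 h)
        simp [hx, hy])

section Cut

variable {k}
variable (P : B → Prop) (hP : ∀ {x y z : B}, (x ⟶ y) → (y ⟶ z) → P x → P z → P y)
  (hPQ : ∀ {x y : B}, (x ⟶ y) → (P x ↔ P y)) (M : Rep k B)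

theorem app_toCut {x : B} (h : P x) :
    app (toCut P hP hPQ M) x = (extEval (PMap.cut P hP) M x h).symm.toLinearMap :=
  dif_pos h

theorem app_toCut_of_not {x : B} (h : ¬ P x) : app (toCut P hP hPQ M) x = 0 :=
  dif_neg h

theorem app_ofCut {x : B} (h : P x) :
    app (ofCut P hP hPQ M) x = (extEval (PMap.cut P hP) M x h).toLinearMap :=
  dif_pos h

theorem app_ofCut_of_not {x : B} (h : ¬ P x) : app (ofCut P hP hPQ M) x = 0 :=
  dif_neg h

theorem ofCut_toCut : ofCut P hP hPQ M ≫ toCut P hP hPQ M = 𝟙 _ := by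
  refine Rep.hom_ext fun x => ?_
  rw [app_comp]
  by_cases hx : P x
  · rw [app_toCut P hP hPQ M hx, app_ofCut P hP hPQ M hx]
    simp
  · have : Subsingleton ((extObj k (PMap.cut P hP) M).obj x) :=
      subsingleton_extObj _ M fun h => (hx h).elim
    exact LinearMap.ext fun v => Subsingleton.elim _ _

theorem ofCut_toCut_eq_zero (Q : B → Prop)
    (hQ : ∀ {x y z : B}, (x ⟶ y) → (y ⟶ z) → Q x → Q z → Q y)
    (hQP : ∀ {x y : B}, (x ⟶ y) → (Q x ↔ Q y)) (h : ∀ x, P x → ¬ Q x) :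
    ofCut P hP hPQ M ≫ toCut Q hQ hQP M = 0 := by
  refine Rep.hom_ext fun x => ?_
  rw [app_comp]
  by_cases hx : P x
  · rw [app_toCut_of_not Q hQ hQP M (h x hx), LinearMap.zero_comp]
    rfl
  · rw [app_ofCut_of_not P hP hPQ M hx, LinearMap.comp_zero]
    rfl

end Cut

/-- No morphism joins `P` to `Q`, so each cut is both a subobject and a quotient, and the two are
complementary summands. -/
theorem PMap.gr_add_gr (P Q : B → Prop) (hP hQ) (h : ∀ x, P x ↔ ¬ Q x)
    (hPQ : ∀ {x y : B}, (x ⟶ y) → (P x ↔ P y)) :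
    (PMap.cut P hP).gr k + (PMap.cut Q hQ).gr k = AddMonoidHom.id _ := Gr.hom_ext fun M => by
  have hQP : ∀ {x y : B}, (x ⟶ y) → (Q x ↔ Q y) := fun g => by
    rw [← not_iff_not, ← h, ← h]; exact hPQ g
  rw [AddMonoidHom.add_apply, PMap.gr_cls, PMap.gr_cls, ← Gr.cls_biprod, AddMonoidHom.id_apply]
  refine Gr.cls_iso ⟨biprod.desc (ofCut P hP hPQ M) (ofCut Q hQ hQP M),
    biprod.lift (toCut P hP hPQ M) (toCut Q hQ hQP M), ?_, ?_⟩
  · apply biprod.hom_ext' <;> apply biprod.hom_ext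
    · simpa using ofCut_toCut P hP hPQ M
    · simpa using ofCut_toCut_eq_zero P hP hPQ M Q hQ hQP fun x => (h x).1
    · simpa using ofCut_toCut_eq_zero Q hQ hQP M P hP hPQ fun x hx hx' => (h x).1 hx' hx
    · simpa using ofCut_toCut Q hQ hQP M
  · rw [biprod.lift_desc]
    refine Rep.hom_ext fun x => ?_
    rw [app_add, app_comp, app_comp]
    by_cases hx : Q x
    · have hx' : ¬ P x := fun hp => (h x).1 hp hx
      rw [app_toCut_of_not P hP hPQ M hx', app_toCut Q hQ hQP M hx, app_ofCut Q hQ hQP M hx]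
      simp
    · have hx' := (h x).2 hx
      rw [app_toCut_of_not Q hQ hQP M hx, app_toCut P hP hPQ M hx', app_ofCut P hP hPQ M hx']
      simp

end Partial

end

end RepCoh

namespace RepCoh

noncomputable section

/-! ### Levels of semi-simplicial subobjects -/

section Levels

variable {C : Type w} [Category.{v} C] (S : SemiSub C)

/-- The vertices of a simplex. -/
def vtx {S : SemiSub C} {n : ℕ} (x : S.Level n) (i : Fin (n + 1)) : C := x.val.obj i

/-- The vertex functor in degree `0`. -/
def evZero : S.Level 0 ⥤ C where
  obj x := vtx x 0
  map f := f.1.app 0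

/-- The functor from the category to the degree `0` level. -/
def ptZero (ho : ∀ x, x ∈ S.objs 0) (hm : ∀ x y (f : x ⟶ y), S.homs 0 f) : C ⥤ S.Level 0 where
  obj c := ⟨ComposableArrows.mk₀ c, ho _⟩
  map f := ⟨ComposableArrows.homMk₀ f, hm _ _ _⟩
  map_id c := Subtype.ext (ComposableArrows.hom_ext₀ rfl)
  map_comp f g := Subtype.ext (ComposableArrows.hom_ext₀ rfl)

/-- The degree `0` level of the envelope is the category itself. -/
def levelZeroEquiv (ho : ∀ x, x ∈ S.objs 0) (hm : ∀ x y (f : x ⟶ y), S.homs 0 f) :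
    S.Level 0 ≌ C where
  functor := evZero S
  inverse := ptZero S ho hm
  unitIso := NatIso.ofComponents
    (fun x =>
      { hom := ⟨ComposableArrows.homMk₀ (𝟙 (vtx x 0)), hm _ _ _⟩
        inv := ⟨ComposableArrows.homMk₀ (𝟙 (vtx x 0)), hm _ _ _⟩
        hom_inv_id := Subtype.ext (ComposableArrows.hom_ext₀ (Category.comp_id _))
        inv_hom_id := Subtype.ext (ComposableArrows.hom_ext₀ (Category.comp_id _)) })
    (fun f => Subtype.ext (ComposableArrows.hom_ext₀
      ((Category.comp_id _).trans (Category.id_comp _).symm)))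
  counitIso := Iso.refl _
  functor_unitIso_comp x := Category.comp_id _

end Levels

section PosetLevels

variable {P : Type w} [PartialOrder P]

instance (S : SemiSub P) (n : ℕ) : Quiver.IsThin (S.Level n) := fun _ _ =>
  ⟨fun f g => Subtype.ext (by ext; exact Subsingleton.elim _ _)⟩

theorem Level.ext_vtx {S : SemiSub P} {n : ℕ} {x y : S.Level n} (h : ∀ i, vtx x i = vtx y i) :
    x = y := by
  obtain ⟨x, hx⟩ := x
  obtain ⟨y, hy⟩ := y
  have : x = y := CategoryTheory.Functor.ext h fun _ _ _ => Subsingleton.elim _ _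
  subst this
  rfl

theorem vtx_strictMono_E {n : ℕ} (x : (E P).Level n) : StrictMono (vtx x) :=
  (PartialOrder.mem_nerve_nonDegenerate_iff_strictMono (X := P) _).1 x.mem

theorem vtx_strictMono_G {n : ℕ} (x : (G P).Level n) : StrictMono (vtx x) :=
  (PartialOrder.mem_nerve_nonDegenerate_iff_strictMono (X := P) _).1 x.mem

/-- A nondegenerate simplex from its vertices. -/
def simplexE {n : ℕ} (v : Fin (n + 1) → P) (hv : StrictMono v) : (E P).Level n :=
  ⟨hv.monotone.functor, (PartialOrder.mem_nerve_nonDegenerate_iff_strictMono (X := P) _).2 hv⟩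

/-- A nondegenerate simplex from its vertices. -/
def simplexG {n : ℕ} (v : Fin (n + 1) → P) (hv : StrictMono v) : (G P).Level n :=
  ⟨hv.monotone.functor, (PartialOrder.mem_nerve_nonDegenerate_iff_strictMono (X := P) _).2 hv⟩

theorem nonempty_hom_E {n : ℕ} (x y : (E P).Level n) :
    Nonempty (x ⟶ y) ↔ ∀ i, vtx x i ≤ vtx y i :=
  ⟨fun ⟨f⟩ i => leOfHom (f.1.app i), fun h =>
    ⟨⟨{ app := fun i => homOfLE (h i), naturality := fun _ _ _ => Subsingleton.elim _ _ }, trivial⟩⟩⟩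

theorem nonempty_hom_G {n : ℕ} (x y : (G P).Level n) :
    Nonempty (x ⟶ y) ↔ x = y ∨ vtx x (Fin.last n) ≤ vtx y 0 := by
  constructor
  · rintro ⟨f, hf⟩
    rcases hf with ⟨h, -⟩ | ⟨g, -⟩
    · exact Or.inl (Level.ext_vtx fun i => by rw [vtx, h]; rfl)
    · exact Or.inr (leOfHom g)
  · rintro (rfl | h)
    · exact ⟨𝟙 _⟩
    · refine ⟨⟨{ app := fun i => x.val.map (homOfLE (Fin.le_last i)) ≫ homOfLE h ≫
          y.val.map (homOfLE (Fin.zero_le i)), naturality := fun _ _ _ => Subsingleton.elim _ _ },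
          Or.inr ⟨homOfLE h, fun i => rfl⟩⟩⟩

theorem mem_objs_E (x : ComposableArrows P 0) : x ∈ (E P).objs 0 :=
  (PartialOrder.mem_nerve_nonDegenerate_iff_strictMono (X := P) _).2
    (Subsingleton.strictMono (α := Fin 1) _)

theorem mem_objs_G (x : ComposableArrows P 0) : x ∈ (G P).objs 0 := mem_objs_E x

theorem mem_homs_G (x y : ComposableArrows P 0) (f : x ⟶ y) : (G P).homs 0 f :=
  Or.inr ⟨f.app 0, fun i => Subsingleton.elim _ _⟩

end PosetLevels

/-! ### Cohomology in degree zero -/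

section HZero

variable (k : Type u) [Field k] {C : Type w} [Category.{v} C]

/-- The cohomology in degree zero is the group of cocycles. -/
def hZeroEquiv (S : SemiSub C) : H k S 0 ≃+ cocycles k S 0 :=
  (QuotientAddGroup.quotientAddEquivOfEq (by
    change AddSubgroup.addSubgroupOf ⊥ _ = ⊥
    simp)).trans QuotientAddGroup.quotientBot

theorem coboundary_zero (S : SemiSub C) (x : Cochain k S 0) :
    coboundary k S 0 x = coface k S 0 0 x - coface k S 0 1 x := by
  simp [coboundary, Fin.sum_univ_two, sub_eq_add_neg]

theorem coboundary_one (S : SemiSub C) (x : Cochain k S 1) :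
    coboundary k S 1 x = coface k S 1 0 x - coface k S 1 1 x + coface k S 1 2 x := by
  simp [coboundary, Fin.sum_univ_three, sub_eq_add_neg]

theorem mem_cocycles_zero (S : SemiSub C) (x : Cochain k S 0) :
    x ∈ cocycles k S 0 ↔ coface k S 0 0 x = coface k S 0 1 x := by
  rw [cocycles, AddMonoidHom.mem_ker, coboundary_zero, sub_eq_zero]

end HZero

end

end RepCoh

namespace RepCoh

noncomputable section

/-! ### Thin representations -/

section Thin

variable (k : Type u) [Field k] (B : Type u₁) [Category.{v₁} B] {A : Type u₂} [Category.{v₂} A]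

/-- The constant representation. -/
def constRep : Rep k B := (Functor.const B).obj (FGModuleCat.of k k)

variable [Quiver.IsThin A] [Quiver.IsThin B]

variable {B}

variable {k} in
/-- The values of the constant representation. -/
def constEquiv (x : A) : (constRep k A).obj x ≃ₗ[k] k := LinearEquiv.refl k k

variable {k} in
theorem constEquiv_lin {x y : A} (g : x ⟶ y) (v) :
    constEquiv y (lin (constRep k A) g v) = constEquiv x v := rfl

variable {k} in
/-- The values of a thin representation on its support. -/
def indEval (φ : PMap B A) (x : B) (h : φ.P x) : (extObj k φ (constRep k A)).obj x ≃ₗ[k] k :=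
  extEval φ (constRep k A) x h ≪≫ₗ constEquiv _

variable {k} in
theorem indEval_lin (φ : PMap B A) {x y : B} (hx : φ.P x) (hy : φ.P y) (g : x ⟶ y) (v) :
    indEval φ y hy (lin (extObj k φ (constRep k A)) g v) = indEval φ x hx v := by
  rw [indEval, LinearEquiv.trans_apply, extEval_lin φ _ hx hy g (φ.map hx hy g), constEquiv_lin]
  rfl

/-- All values of the constant representation coincide and all its maps are identities, so even the
object map of the partial functor drops out. -/
theorem gr_constRep_congr (φ ψ : PMap B A) (h : ∀ x, φ.P x ↔ ψ.P x) :
    φ.gr k (Gr.cls (constRep k A)) = ψ.gr k (Gr.cls (constRep k A)) := by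
  rw [PMap.gr_cls, PMap.gr_cls]
  refine Gr.cls_iso (extIso φ _ _
    (fun x hx => constEquiv _ ≪≫ₗ (indEval ψ x ((h x).1 hx)).symm)
    (fun x hx => subsingleton_extObj ψ _ fun h' => (hx ((h x).2 h')).elim) ?_)
  intro x y hx hy g v
  have hx' := (h x).1 hx
  have hy' := (h y).1 hy
  apply (indEval ψ y hy').injective
  rw [indEval_lin ψ hx' hy' g, LinearEquiv.trans_apply, LinearEquiv.apply_symm_apply,
    LinearEquiv.trans_apply, LinearEquiv.apply_symm_apply, constEquiv_lin]

/-- The one-dimensional representation supported on a convex part. -/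
def indRep (P : B → Prop) (h : ∀ {x y z : B}, (x ⟶ y) → (y ⟶ z) → P x → P z → P y) : Rep k B :=
  extObj k (PMap.cut P h) (constRep k B)

theorem finrank_range_lin_extObj_constRep (φ : PMap B A) {x y : B} (f : x ⟶ y) (hx : φ.P x)
    (hy : φ.P y) :
    Module.finrank k (LinearMap.range (lin (extObj k φ (constRep k A)) f)) = 1 := by
  rw [finrank_range_eq_of_conj (indEval φ x hx) (indEval φ y hy) _ LinearMap.id
    (indEval_lin φ hx hy f), LinearMap.range_id, finrank_top, Module.finrank_self]

open Classical in
theorem rk_gr_constRep (φ : PMap B A) {x y : B} (f : x ⟶ y) :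
    rk k f (φ.gr k (Gr.cls (constRep k A))) = if φ.P x ∧ φ.P y then 1 else 0 := by
  rw [PMap.gr_cls, rk_cls]
  split_ifs with h
  · rw [finrank_range_lin_extObj_constRep k φ f h.1 h.2, Nat.cast_one]
  · have : lin (extObj k φ (constRep k A)) f = 0 := by
      rcases not_and_or.1 h with h | h
      · have := subsingleton_extObj φ (constRep k A) (x := x) fun h' => (h h').elim
        exact LinearMap.ext fun v => by rw [Subsingleton.elim v 0, map_zero, map_zero]
      · have := subsingleton_extObj φ (constRep k A) (x := y) fun h' => (h h').elim
        exact LinearMap.ext fun v => Subsingleton.elim _ _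
    rw [this, LinearMap.range_zero, finrank_bot, Nat.cast_zero]

theorem rk_constRep {x y : B} (f : x ⟶ y) : rk k f (Gr.cls (constRep k B)) = 1 := by
  rw [rk_cls, finrank_range_eq_of_conj (constEquiv x) (constEquiv y) _ LinearMap.id
    (constEquiv_lin f), LinearMap.range_id, finrank_top, Module.finrank_self, Nat.cast_one]

variable {k} in
open Classical in
/-- A compatible family of vectors and functionals splits off a one-dimensional representation. -/
theorem indRep_retract (P : B → Prop)
    (h : ∀ {x y z : B}, (x ⟶ y) → (y ⟶ z) → P x → P z → P y) (M : Rep k B)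
    (w : ∀ x, M.obj x) (f : ∀ x, M.obj x →ₗ[k] k)
    (hw : ∀ {x y} (g : x ⟶ y), P x → P y → lin M g (w x) = w y)
    (hw0 : ∀ {x y} (g : x ⟶ y), P x → ¬ P y → lin M g (w x) = 0)
    (hf : ∀ {x y} (g : x ⟶ y), P x → P y → ∀ v, f y (lin M g v) = f x v)
    (hf0 : ∀ {x y} (g : x ⟶ y), ¬ P x → P y → ∀ v, f y (lin M g v) = 0)
    (hfw : ∀ x, P x → f x (w x) = 1) :
    ∃ (i : indRep k P h ⟶ M) (r : M ⟶ indRep k P h), i ≫ r = 𝟙 _ := by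
  have hsub (x : B) (hx : ¬ P x) : Subsingleton ((indRep k P h).obj x) :=
    subsingleton_extObj (PMap.cut P h) _ fun h' => (hx h').elim
  let e (x : B) (hx : P x) : (indRep k P h).obj x ≃ₗ[k] k := indEval (PMap.cut P h) x hx
  have he {x y : B} (hx : P x) (hy : P y) (g : x ⟶ y) (v) :
      e y hy (lin (indRep k P h) g v) = e x hx v := indEval_lin (PMap.cut P h) hx hy g v
  clear_value e
  let i (x : B) : (indRep k P h).obj x →ₗ[k] M.obj x :=
    if hx : P x then LinearMap.toSpanSingleton k _ (w x) ∘ₗ (e x hx).toLinearMap else 0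
  have hi (x : B) (hx : P x) (v) : i x v = e x hx v • w x := by
    simp only [i, dif_pos hx]
    rfl
  let r (x : B) : M.obj x →ₗ[k] (indRep k P h).obj x :=
    if hx : P x then (e x hx).symm.toLinearMap ∘ₗ f x else 0
  have hr (x : B) (hx : P x) (v) : e x hx (r x v) = f x v := by
    simp only [r, dif_pos hx]
    simp
  clear_value i r
  refine ⟨homMk i ?_, homMk r ?_, ?_⟩
  · intro x y g v
    by_cases hx : P x
    · by_cases hy : P y
      · rw [hi x hx, hi y hy, he hx hy, map_smul, hw g hx hy]
      · have := hsub y hy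
        rw [hi x hx, map_smul, hw0 g hx hy, smul_zero, Subsingleton.elim (lin _ g v) 0, map_zero]
    · have := hsub x hx
      rw [Subsingleton.elim v 0, map_zero, map_zero, map_zero, map_zero]
  · intro x y g v
    by_cases hy : P y
    · apply (e y hy).injective
      rw [hr y hy]
      by_cases hx : P x
      · rw [he hx hy, hr x hx, hf g hx hy]
      · have := hsub x hx
        rw [hf0 g hx hy, Subsingleton.elim (r x v) 0, map_zero, map_zero]
    · have := hsub y hy
      exact Subsingleton.elim _ _
  · refine Rep.hom_ext fun x => LinearMap.ext fun v => ?_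
    rw [app_comp, app_homMk, app_homMk, app_id, LinearMap.comp_apply, LinearMap.id_apply]
    by_cases hx : P x
    · apply (e x hx).injective
      rw [hr x hx, hi x hx, map_smul, hfw x hx, smul_eq_mul, mul_one]
    · have := hsub x hx
      exact Subsingleton.elim _ _

theorem indRep_not_isZero (P : B → Prop)
    (h : ∀ {x y z : B}, (x ⟶ y) → (y ⟶ z) → P x → P z → P y) {x : B} (hx : P x) :
    ¬ IsZero (indRep k P h) := fun h0 => by
  have := (Rep.isZero_iff _).1 h0 x
  have h1 := (indEval (k := k) (PMap.cut P h) x hx).toEquiv.subsingleton_congr.1 this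
  exact one_ne_zero (Subsingleton.elim (1 : k) 0)

open Classical in
theorem rk_indRep (P : B → Prop)
    (h : ∀ {x y z : B}, (x ⟶ y) → (y ⟶ z) → P x → P z → P y) {x y : B} (f : x ⟶ y) :
    rk k f (Gr.cls (indRep k P h)) = if P x ∧ P y then 1 else 0 := by
  have := rk_gr_constRep k (PMap.cut P h) f
  rwa [PMap.gr_cls] at this

end Thin

/-! ### Representations of linear orders -/

section Linear

variable {k : Type u} [Field k] {m : ℕ}

theorem exists_vector {V W : Type*} [AddCommGroup V] [Module k V] [AddCommGroup W] [Module k W]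
    [Module.Finite k V] (f : V →ₗ[k] W)
    (h : Module.finrank k (LinearMap.range f) < Module.finrank k V) : ∃ v, v ≠ 0 ∧ f v = 0 := by
  have h1 := f.finrank_range_add_finrank_ker
  have h2 : 0 < Module.finrank k (LinearMap.ker f) := by lia
  rw [Module.finrank_pos_iff] at h2
  obtain ⟨⟨v, hv⟩, hv0⟩ := exists_ne (0 : LinearMap.ker f)
  exact ⟨v, fun h => hv0 (Subtype.ext h), hv⟩

/-- The interval `[a, b]` is a direct summand if the kernels and the support allow it. -/
theorem interval_summand (M : Rep k (Fin m)) (a b : Fin m) (hab : a ≤ b)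
    (hz : ∀ x, x < a → Subsingleton (M.obj x)) (v : M.obj a)
    (hv : lin M (homOfLE hab) v ≠ 0)
    (hv0 : ∀ c (h : a ≤ c), b < c → lin M (homOfLE h) v = 0) :
    ∃ N, Nonempty (M ≅ indRep k (fun x : Fin m => a ≤ x ∧ x ≤ b)
      (fun f g hx hz => ⟨hx.1.trans (leOfHom f), (leOfHom g).trans hz.2⟩) ⊞ N) := by
  classical
  -- The summand is cut out by the images of `v` at the points from `a` on and by the pullbacks of
  -- one functional at `b`, normalised on the image of `v`.
  obtain ⟨φ, hφ⟩ := Module.Projective.exists_dual_eq_one k hv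
  obtain ⟨i, r, hir⟩ := indRep_retract (fun x : Fin m => a ≤ x ∧ x ≤ b)
    (fun f g hx hz => ⟨hx.1.trans (leOfHom f), (leOfHom g).trans hz.2⟩) M
    (fun x => if h : a ≤ x then lin M (homOfLE h) v else 0)
    (fun x => if h : x ≤ b then φ ∘ₗ lin M (homOfLE h) else 0)
    (by
      intro x y g hx hy
      rw [dif_pos hx.1, dif_pos hy.1, ← lin_comp_apply]
      rfl)
    (by
      intro x y g hx hy
      have hy' : a ≤ y := hx.1.trans (leOfHom g)
      rw [dif_pos hx.1, ← lin_comp_apply]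
      exact hv0 y hy' (not_le.1 fun h => hy ⟨hy', h⟩))
    (by
      intro x y g hx hy v
      rw [dif_pos hx.2, dif_pos hy.2, LinearMap.comp_apply, LinearMap.comp_apply, ← lin_comp_apply]
      rfl)
    (by
      intro x y g hx hy v
      have := hz x (not_le.1 fun h => hx ⟨h, (leOfHom g).trans hy.2⟩)
      rw [Subsingleton.elim v 0, map_zero, map_zero])
    (by
      intro x hx
      rw [dif_pos hx.1, dif_pos hx.2, LinearMap.comp_apply, ← lin_comp_apply]
      exact hφ)
  exact exists_iso_biprod_of_retract i r hir

/-- Representations of a linear order are determined by their ranks. -/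
theorem linear_complete (M N : Rep k (Fin m))
    (h : ∀ {x y : Fin m} (f : x ⟶ y), rk k f (Gr.cls M) = rk k f (Gr.cls N)) :
    Gr.cls M = Gr.cls N := by
  induction hn : ∑ x, Module.finrank k (M.obj x) using Nat.strong_induction_on
    generalizing M N with
  | _ n ih =>
    have hdim (L : Rep k (Fin m)) (x : Fin m) : rk k (𝟙 x) (Gr.cls L) = Module.finrank k (L.obj x) := by
      rw [rk_cls, lin_id, LinearMap.range_id, finrank_top]
    have hd (x : Fin m) : Module.finrank k (M.obj x) = Module.finrank k (N.obj x) := by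
      have := h (𝟙 x)
      rw [hdim, hdim] at this
      exact_mod_cast this
    have hr {x y : Fin m} (f : x ⟶ y) : Module.finrank k (LinearMap.range (lin M f)) =
        Module.finrank k (LinearMap.range (lin N f)) := by
      have := h f
      rw [rk_cls, rk_cls] at this
      exact_mod_cast this
    by_cases h0 : ∀ x, Module.finrank k (M.obj x) = 0
    · rw [Gr.cls_zero ((Rep.isZero_iff M).2 fun x => Module.finrank_zero_iff.1 (h0 x)),
        Gr.cls_zero ((Rep.isZero_iff N).2 fun x => Module.finrank_zero_iff.1 (hd x ▸ h0 x))]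
    -- Here `a` is the first vertex with nonzero value and `b` the last one to which the value at
    -- `a` maps injectively. Both are read off from ranks, so the interval [a, b] splits off from
    -- `M` and from `N` alike.
    · obtain ⟨a, ha, hmin⟩ : ∃ a, Module.finrank k (M.obj a) ≠ 0 ∧
          ∀ x, x < a → Module.finrank k (M.obj x) = 0 := by
        push Not at h0
        obtain ⟨a, ha⟩ := WellFounded.has_min (wellFounded_lt (α := Fin m))
          {x | Module.finrank k (M.obj x) ≠ 0} h0
        exact ⟨a, ha.1, fun x hx => by_contra fun hx' => ha.2 x hx' hx⟩
      obtain ⟨b, hab, hb, hmax⟩ : ∃ b, ∃ hab : a ≤ b,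
          Module.finrank k (LinearMap.range (lin M (homOfLE hab))) = Module.finrank k (M.obj a) ∧
          ∀ c (h : a ≤ c), b < c →
            Module.finrank k (LinearMap.range (lin M (homOfLE h))) <
              Module.finrank k (M.obj a) := by
        obtain ⟨b, hb⟩ := WellFounded.has_min (wellFounded_gt (α := Fin m))
          {x | ∃ hab : a ≤ x, Module.finrank k (LinearMap.range (lin M (homOfLE hab))) =
            Module.finrank k (M.obj a)} ⟨a, le_rfl, by
              have e : homOfLE (le_refl a) = 𝟙 a := rfl
              rw [e, lin_id, LinearMap.range_id, finrank_top]⟩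
        refine ⟨b, hb.1.1, hb.1.2, fun c hc hbc => lt_of_le_of_ne (LinearMap.finrank_range_le _) ?_⟩
        exact fun h' => hb.2 c ⟨hc, h'⟩ hbc
      have key (L : Rep k (Fin m)) (hL : ∀ x, Module.finrank k (M.obj x) =
          Module.finrank k (L.obj x)) (hLr : ∀ {x y : Fin m} (f : x ⟶ y),
          Module.finrank k (LinearMap.range (lin M f)) =
            Module.finrank k (LinearMap.range (lin L f))) :
          ∃ L', Nonempty (L ≅ indRep k (fun x : Fin m => a ≤ x ∧ x ≤ b)
            (fun f g hx hz => ⟨hx.1.trans (leOfHom f), (leOfHom g).trans hz.2⟩) ⊞ L') := by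
        -- A nonzero vector that dies immediately after `b`: by maximality of `b` the map to the
        -- next vertex has a kernel. If `b` is the last vertex, any nonzero vector serves.
        obtain ⟨v, hv, hv0⟩ : ∃ v : L.obj a, v ≠ 0 ∧
            ∀ c (h : a ≤ c), b < c → lin L (homOfLE h) v = 0 := by
          by_cases hc : ∃ c, b < c
          · obtain ⟨c, hc, hc'⟩ := WellFounded.has_min (wellFounded_lt (α := Fin m)) {c | b < c} hc
            obtain ⟨v, hv, hv0⟩ := exists_vector (lin L (homOfLE (hab.trans hc.le))) (by
              rw [← hL, ← hLr]
              exact hmax c _ hc)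
            refine ⟨v, hv, fun d hd hbd => ?_⟩
            have e : homOfLE hd = homOfLE (hab.trans hc.le) ≫ homOfLE (not_lt.1 (hc' d hbd)) := rfl
            rw [e, lin_comp_apply, hv0, map_zero]
          · have : Nontrivial (L.obj a) := by
              apply Module.nontrivial_of_finrank_pos (R := k)
              rw [← hL]
              exact Nat.pos_of_ne_zero ha
            obtain ⟨v, hv⟩ := exists_ne (0 : L.obj a)
            exact ⟨v, hv, fun c _ hbc => (hc ⟨c, hbc⟩).elim⟩
        refine interval_summand L a b hab
          (fun x hx => Module.finrank_zero_iff.1 ((hL x).symm.trans (hmin x hx))) v ?_ hv0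
        have hker := (lin L (homOfLE hab)).finrank_range_add_finrank_ker
        rw [← hLr, hb, hL, Nat.add_eq_left, Submodule.finrank_eq_zero] at hker
        exact fun h' => hv (LinearMap.ker_eq_bot'.1 hker v h')
      obtain ⟨M', ⟨eM⟩⟩ := key M (fun _ => rfl) (fun _ => rfl)
      obtain ⟨N', ⟨eN⟩⟩ := key N hd hr
      have hM' := Gr.cls_iso eM
      have hN' := Gr.cls_iso eN
      rw [Gr.cls_biprod] at hM' hN'
      rw [hM', hN', ih _ _ M' N' _ rfl]
      · have hx (x : Fin m) : Module.finrank k (M'.obj x) ≤ Module.finrank k (M.obj x) ∧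
            (x = a → Module.finrank k (M'.obj x) < Module.finrank k (M.obj x)) := by
          have h1 := congrArg (rk k (𝟙 x)) hM'
          rw [map_add, rk_indRep, hdim, hdim] at h1
          constructor
          · split_ifs at h1 <;> lia
          · rintro rfl
            rw [if_pos (by simpa using hab)] at h1
            lia
        rw [← hn]
        exact Finset.sum_lt_sum (fun x _ => (hx x).1) ⟨a, Finset.mem_univ _, (hx a).2 rfl⟩
      · intro x y f
        have h1 := h f
        rw [hM', hN', map_add, map_add] at h1
        exact add_left_cancel h1

theorem linear_eq_zero (z : Gr (Rep k (Fin m))) (h : ∀ {x y : Fin m} (f : x ⟶ y), rk k f z = 0) :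
    z = 0 := by
  obtain ⟨M, N, rfl⟩ := Gr.exists_sub z
  rw [sub_eq_zero]
  exact linear_complete M N fun f => by simpa [sub_eq_zero] using h f

end Linear

end

end RepCoh

namespace RepCoh

noncomputable section

/-! ### Cohomology of linear orders -/

section Equivalences

variable (k : Type u) [Field k] {A : Type u₁} [Category.{v₁} A] {B : Type u₂} [Category.{v₂} B]

theorem map_res_functor_inverse (e : A ≌ B) (x : Gr (Rep k A)) :
    Gr.map (Rep.res k e.functor) (Gr.map (Rep.res k e.inverse) x) = x := by
  have : (Gr.map (Rep.res k e.functor)).comp (Gr.map (Rep.res k e.inverse)) =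
      AddMonoidHom.id _ := Gr.hom_ext fun M => by
    rw [AddMonoidHom.comp_apply, Gr.map_cls, Gr.map_cls]
    exact Gr.cls_iso ((Functor.associator _ _ _).symm ≪≫ Functor.isoWhiskerRight e.unitIso.symm M ≪≫
      M.leftUnitor)
  exact DFunLike.congr_fun this x

theorem rk_congr [Quiver.IsThin A] {x y x' y' : A} (hx : x = x') (hy : y = y') (f : x ⟶ y)
    (f' : x' ⟶ y') : rk k f = rk k f' := by
  subst hx hy
  rw [Subsingleton.elim f f']

end Equivalences

/-- The representation that is one-dimensional everywhere with non-identities acting by zero. -/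
def discRep (k : Type u) [Field k] (B : Type u₁) [Category.{v₁} B]
    (hB : ∀ {x y : B}, (x ⟶ y) → (y ⟶ x) → x = y) : Rep k B :=
  open Classical in
  repMk (fun _ => k) (fun {x y} _ => if x = y then LinearMap.id else 0) (fun x => if_pos rfl)
    (fun {x y z} f g => by
      by_cases hxy : x = y
      · subst hxy
        rw [if_pos rfl, LinearMap.comp_id]
      · by_cases hxz : x = z
        · subst hxz
          exact (hxy (hB f g)).elim
        · rw [if_neg hxz, if_neg hxy, LinearMap.comp_zero])

section Disc

variable (k : Type u) [Field k] {A : Type u₁} [Category.{v₁} A] {B : Type u₂} [Category.{v₂} B]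
  (hA : ∀ {x y : A}, (x ⟶ y) → (y ⟶ x) → x = y) (hB : ∀ {x y : B}, (x ⟶ y) → (y ⟶ x) → x = y)

/-- The hypothesis on `F` ensures that a morphism between distinct objects, which must act by zero,
is not sent to an endomorphism, which would act by the identity. -/
theorem map_res_discRep (F : B ⥤ A) (hF : ∀ {x y : B}, (x ⟶ y) → F.obj x = F.obj y → x = y) :
    Gr.map (Rep.res k F) (Gr.cls (discRep k A hA)) = Gr.cls (discRep k B hB) := by
  classical
  rw [Gr.map_cls]
  refine Gr.cls_iso (isoMk (fun x => LinearEquiv.refl k k) ?_)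
  intro x y g v
  change (if F.obj x = F.obj y then LinearMap.id else (0 : k →ₗ[k] k)) v =
    (if x = y then LinearMap.id else (0 : k →ₗ[k] k)) v
  by_cases h : x = y
  · rw [if_pos h, if_pos (congrArg F.obj h)]
  · rw [if_neg h, if_neg fun h' => h (hF g h')]

open Classical in
theorem rk_discRep {x y : A} (f : x ⟶ y) :
    rk k f (Gr.cls (discRep k A hA)) = if x = y then 1 else 0 := by
  rw [rk_cls]
  refine (congrArg Nat.cast (finrank_range_eq_of_conj (V' := k) (W' := k) (LinearEquiv.refl k k)
    (LinearEquiv.refl k k) _ (if x = y then LinearMap.id else 0) (fun v => rfl))).trans ?_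
  by_cases h : x = y
  · rw [if_pos h, if_pos h, LinearMap.range_id, finrank_top, Module.finrank_self, Nat.cast_one]
  · rw [if_neg h, if_neg h, LinearMap.range_zero, finrank_bot, Nat.cast_zero]

end Disc

theorem mem_homs_E {P : Type w} [PartialOrder P] (x y : ComposableArrows P 0) (f : x ⟶ y) :
    (E P).homs 0 f := trivial

section LinearOrder

variable (k : Type u) [Field k] {n : ℕ} (S : SemiSub (Fin (n + 1)))
  (ho : ∀ x, x ∈ S.objs 0) (hm : ∀ x y (f : x ⟶ y), S.homs 0 f)

/-- The rank of a cochain of degree zero between two elements. -/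
def rank {i j : Fin (n + 1)} (h : i ≤ j) : Cochain k S 0 →+ ℤ :=
  rk k ((ptZero S ho hm).map (homOfLE h))

theorem eq_zero_of_rank (x : Cochain k S 0)
    (h : ∀ {i j} (h : i ≤ j), rank k S ho hm h x = 0) : x = 0 := by
  rw [← map_res_functor_inverse k (levelZeroEquiv S ho hm) x]
  rw [linear_eq_zero (Gr.map (Rep.res k (levelZeroEquiv S ho hm).inverse) x), map_zero]
  intro i j f
  rw [rk_map_res]
  exact h (leOfHom f)

/-- Evaluate ranks at the morphism of edges `f`: the coface `δ⁰` sees its effect on targets and `δ¹`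
its effect on sources. -/
theorem rank_eq_of_mem_cocycles (x : Cochain k S 0) (hx : x ∈ cocycles k S 0) {s t : S.Level 1}
    (f : s ⟶ t) (h0 : vtx s 0 ≤ vtx t 0) (h1 : vtx s 1 ≤ vtx t 1) :
    rank k S ho hm h0 x = rank k S ho hm h1 x := by
  rw [mem_cocycles_zero] at hx
  have h := congrArg (rk k f) hx
  rw [rk_map_res, rk_map_res] at h
  have e (i : Fin (n + 1)) (s : S.Level 0) (h : vtx s 0 = i) : s = (ptZero S ho hm).obj i :=
    Level.ext_vtx fun j => by
      obtain rfl : j = 0 := Fin.ext (by lia)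
      rw [h]; rfl
  rw [rank, rank,
    ← rk_congr k (e (vtx s 0) ((S.d 0 1).obj s) rfl) (e (vtx t 0) ((S.d 0 1).obj t) rfl)
      ((S.d 0 1).map f) _,
    ← rk_congr k (e (vtx s 1) ((S.d 0 0).obj s) rfl) (e (vtx t 1) ((S.d 0 0).obj t) rfl)
      ((S.d 0 0).map f) _]
  exact h.symm

/-- The class of the constant representation. -/
def constClass : Cochain k S 0 := Gr.cls (constRep k _)

theorem constClass_mem : constClass k S ∈ cocycles k S 0 := by
  rw [mem_cocycles_zero, constClass, Gr.map_cls, Gr.map_cls]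
  rfl

theorem rank_constClass {i j : Fin (n + 1)} (h : i ≤ j) :
    rank k S ho hm h (constClass k S) = 1 := rk_constRep k _

/-- The part above the bottom. -/
def cutBot : PMap (S.Level 0) (S.Level 0) :=
  PMap.cut (fun p => 0 < vtx p 0) fun f _ hx _ => lt_of_lt_of_le hx (leOfHom (f.1.app 0))

/-- The part below the top. -/
def cutTop : PMap (S.Level 0) (S.Level 0) :=
  PMap.cut (fun p => vtx p 0 < Fin.last n) fun _ g _ hz => lt_of_le_of_lt (leOfHom (g.1.app 0)) hz

/-- The class `[1, n] + [0, n-1] - [1, n-1]`. -/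
def jumpClass : Cochain k S 0 :=
  (cutBot S).gr k (constClass k S) + (cutTop S).gr k (constClass k S) -
    ((cutBot S).comp (cutTop S)).gr k (constClass k S)

theorem coface_gr (i : Fin 2) (φ : PMap (S.Level 0) (S.Level 0)) (x : Cochain k S 0) :
    coface k S 0 i (φ.gr k x) = ((PMap.ofFunctor (S.d 0 i)).comp φ).gr k x := by
  rw [PMap.gr_comp, PMap.gr_ofFunctor]

/-- The target of an edge is never the bottom and its source never the top. Hence `δ⁰` does not
notice the cut at the bottom, `δ¹` does not notice the cut at the top, and both cofaces reduce to
the constant class. -/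
theorem jumpClass_mem (hs : ∀ s : S.Level 1, vtx s 0 < vtx s 1) :
    jumpClass k S ∈ cocycles k S 0 := by
  have e0 (s : S.Level 1) : vtx ((S.d 0 0).obj s) 0 = vtx s 1 := rfl
  have e1 (s : S.Level 1) : vtx ((S.d 0 1).obj s) 0 = vtx s 0 := rfl
  have h0 (s : S.Level 1) : 0 < vtx s 1 := lt_of_le_of_lt (Fin.zero_le _) (hs s)
  have h1 (s : S.Level 1) : vtx s 0 < Fin.last n := lt_of_lt_of_le (hs s) (Fin.le_last _)
  rw [mem_cocycles_zero, jumpClass]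
  simp only [map_sub, map_add, coface_gr]
  have a : ((PMap.ofFunctor (S.d 0 0)).comp (cutBot S)).gr k (constClass k S) =
      ((PMap.ofFunctor (S.d 0 1)).comp (cutTop S)).gr k (constClass k S) :=
    gr_constRep_congr k _ _ fun s => by simp [cutBot, cutTop, e0, e1, h0, h1]
  have b : ((PMap.ofFunctor (S.d 0 0)).comp (cutTop S)).gr k (constClass k S) =
      ((PMap.ofFunctor (S.d 0 0)).comp ((cutBot S).comp (cutTop S))).gr k (constClass k S) :=
    gr_constRep_congr k _ _ fun s => by simp [cutBot, cutTop, e0, h0]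
  have c : ((PMap.ofFunctor (S.d 0 1)).comp (cutBot S)).gr k (constClass k S) =
      ((PMap.ofFunctor (S.d 0 1)).comp ((cutBot S).comp (cutTop S))).gr k (constClass k S) :=
    gr_constRep_congr k _ _ fun s => by simp [cutBot, cutTop, e1, h1]
  rw [a, b, c]
  abel

theorem rank_jumpClass {i j : Fin (n + 1)} (h : i ≤ j) :
    rank k S ho hm h (jumpClass k S) = if i = 0 ∧ j = Fin.last n then 0 else 1 := by
  have e (i : Fin (n + 1)) : vtx ((ptZero S ho hm).obj i) 0 = i := rfl
  have hi : 0 < i ↔ i ≠ 0 := Fin.pos_iff_ne_zero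
  have hj : j < Fin.last n ↔ j ≠ Fin.last n := Fin.lt_last_iff_ne_last
  have hi' : 0 < i → 0 < j := fun h' => h'.trans_le h
  have hj' : j < Fin.last n → i < Fin.last n := fun h' => lt_of_le_of_lt h h'
  rw [rank, jumpClass, map_sub, map_add, constClass, rk_gr_constRep, rk_gr_constRep,
    rk_gr_constRep]
  simp only [cutBot, cutTop, PMap.cut, id, e]
  by_cases h1 : 0 < i <;> by_cases h2 : j < Fin.last n
  · simp [h1, h2, hi' h1, hj' h2, h1.ne']
  · simp [h1, h2, hi' h1, h1.ne']
  · simp [h1, h2, hj' h2, h2.ne]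
  · have h3 : i = 0 := by simpa using h1
    have h4 : j = Fin.last n := by simpa using h2
    simp [h3, h4]

/-- If i = 0 and j < n, the morphism of edges (0, n) → (j, n) gives rank(0, j) = rank(n, n), and the
identity of (0, n) gives rank(0, 0) = rank(n, n). If i > 0, use (0, i) → (0, j). The pair (0, n)
escapes since no edge starts at n or ends at 0. -/
theorem rank_E (x : Cochain k (E (Fin (n + 1))) 0) (hx : x ∈ cocycles k _ 0) (hn : 1 ≤ n)
    {i j : Fin (n + 1)} (h : i ≤ j) (hij : ¬ (i = 0 ∧ j = Fin.last n)) :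
    rank k _ mem_objs_E mem_homs_E h x =
      rank k _ mem_objs_E mem_homs_E (le_refl 0) x := by
  have key {i i' j j' : Fin (n + 1)} (hi : i ≤ i') (hj : j ≤ j') (h1 : i < j) (h2 : i' < j') :
      rank k _ mem_objs_E mem_homs_E hi x =
        rank k _ mem_objs_E mem_homs_E hj x := by
    obtain ⟨f⟩ := (nonempty_hom_E
      (simplexE ![i, j] (by simpa [Fin.strictMono_iff_lt_succ] using h1))
      (simplexE ![i', j'] (by simpa [Fin.strictMono_iff_lt_succ] using h2))).2 (by
        intro a; fin_cases a <;> simpa)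
    exact rank_eq_of_mem_cocycles k _ mem_objs_E mem_homs_E x hx f hi hj
  have h0n : (0 : Fin (n + 1)) < Fin.last n := by
    rw [Fin.lt_def]; simp; lia
  by_cases hi : i = 0
  · have hj : j < Fin.last n := Fin.lt_last_iff_ne_last.2 fun hj => hij ⟨hi, hj⟩
    rw [key h (le_refl (Fin.last n)) (lt_of_le_of_lt h hj) hj,
      key (le_refl 0) (le_refl (Fin.last n)) h0n h0n]
  · have h0 : 0 < i := Fin.pos_iff_ne_zero.2 hi
    exact (key (le_refl 0) h h0 (h0.trans_le h)).symm

/-- The identity of the edge (0, i) relates its two endpoints. -/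
theorem rank_G_refl (x : Cochain k (G (Fin (n + 1))) 0) (hx : x ∈ cocycles k _ 0)
    (i : Fin (n + 1)) :
    rank k _ mem_objs_G mem_homs_G (le_refl i) x =
      rank k _ mem_objs_G mem_homs_G (le_refl 0) x := by
  by_cases hi : i = 0
  · subst hi; rfl
  · have h0 : 0 < i := Fin.pos_iff_ne_zero.2 hi
    exact (rank_eq_of_mem_cocycles k _ mem_objs_G mem_homs_G x hx
      (𝟙 (simplexG ![0, i] (by simpa [Fin.strictMono_iff_lt_succ] using h0)))
      (le_refl 0) (le_refl i)).symm

/-- Compositional morphisms give rank(i, i') = rank(j, j') whenever i < j ≤ i' < j'. This links all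
strict pairs other than (0, n), and never reaches the diagonal. -/
theorem rank_G_lt (x : Cochain k (G (Fin (n + 1))) 0) (hx : x ∈ cocycles k _ 0) (hn : 2 ≤ n)
    {i j : Fin (n + 1)} (h : i < j) (hij : ¬ (i = 0 ∧ j = Fin.last n)) :
    rank k _ mem_objs_G mem_homs_G h.le x =
      rank k _ mem_objs_G mem_homs_G (Fin.zero_le (⟨1, by lia⟩ : Fin (n + 1))) x := by
  have key {i i' j j' : Fin (n + 1)} (h1 : i < j) (h2 : j ≤ i') (h3 : i' < j') :
      rank k _ mem_objs_G mem_homs_G (h1.le.trans h2) x =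
        rank k _ mem_objs_G mem_homs_G (h2.trans h3.le) x := by
    obtain ⟨f⟩ := (nonempty_hom_G
      (simplexG ![i, j] (by simpa [Fin.strictMono_iff_lt_succ] using h1))
      (simplexG ![i', j'] (by simpa [Fin.strictMono_iff_lt_succ] using h3))).2 (Or.inr h2)
    exact rank_eq_of_mem_cocycles k _ mem_objs_G mem_homs_G x hx f _ _
  have h01 : (0 : Fin (n + 1)) < ⟨1, by lia⟩ := by
    rw [Fin.lt_def]; simp
  have h1n : (⟨1, by lia⟩ : Fin (n + 1)) < Fin.last n := by
    rw [Fin.lt_def]; simp; lia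
  have top {i : Fin (n + 1)} (h0 : 0 < i) (h : i < Fin.last n) :
      rank k _ mem_objs_G mem_homs_G h.le x =
        rank k _ mem_objs_G mem_homs_G (Fin.zero_le (⟨1, by lia⟩ : Fin (n + 1))) x := by
    have h1i : (⟨1, by lia⟩ : Fin (n + 1)) ≤ i := by
      rw [Fin.lt_def] at h0
      rw [Fin.le_def]
      exact h0
    have hl : i < Fin.last n := h
    -- The links are rank(i, n) = rank(0, i) = rank(1, n) = rank(0, 1), with n the last vertex.
    rw [key h01 (le_refl _) h1n, ← key h0 (le_refl i) hl]
    exact key h01 h1i hl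
  by_cases hj : j = Fin.last n
  · subst hj
    exact top (Fin.pos_iff_ne_zero.2 fun hi => hij ⟨hi, rfl⟩) h
  · have hj' : j < Fin.last n := Fin.lt_last_iff_ne_last.2 hj
    exact (key h (le_refl j) hj').trans (top (lt_of_le_of_lt (Fin.zero_le i) h) hj')

/-- Cocycles on all chains are determined by two ranks. -/
theorem cocycle_E_ext (hn : 1 ≤ n) {x y : Cochain k (E (Fin (n + 1))) 0}
    (hx : x ∈ cocycles k _ 0) (hy : y ∈ cocycles k _ 0)
    (h1 : rank k _ mem_objs_E mem_homs_E (Fin.zero_le (Fin.last n)) x =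
      rank k _ mem_objs_E mem_homs_E (Fin.zero_le (Fin.last n)) y)
    (h2 : rank k _ mem_objs_E mem_homs_E (le_refl 0) x =
      rank k _ mem_objs_E mem_homs_E (le_refl 0) y) : x = y := by
  rw [← sub_eq_zero]
  refine eq_zero_of_rank k _ mem_objs_E mem_homs_E _ fun {i j} h => ?_
  rw [map_sub, sub_eq_zero]
  by_cases hij : i = 0 ∧ j = Fin.last n
  · obtain ⟨rfl, rfl⟩ := hij
    exact h1
  · rw [rank_E k x hx hn h hij, rank_E k y hy hn h hij, h2]

/-- The cohomology of nondegenerate simplices of a linear order in degree zero. -/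
def cocyclesEEquiv (hn : 1 ≤ n) : cocycles k (E (Fin (n + 1))) 0 ≃+ (Fin 2 → ℤ) :=
  AddEquiv.ofBijective
    (AddMonoidHom.mk' (fun x => ![
      rank k _ mem_objs_E mem_homs_E (Fin.zero_le (Fin.last n)) x.1,
      rank k _ mem_objs_E mem_homs_E (le_refl 0) x.1]) (fun x y => by simp))
    ⟨fun x y h => Subtype.ext (cocycle_E_ext k hn x.2 y.2 (by simpa using congrFun h 0)
      (by simpa using congrFun h 1)), fun v => by
      have h0 : (0 : Fin (n + 1)) ≠ Fin.last n := by
        rw [Ne, Fin.ext_iff]; simp; lia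
      -- The two invariants are (1, 1) on the constant class and (0, 1) on the jump class.
      refine ⟨⟨v 0 • constClass k _ + (v 1 - v 0) • jumpClass k _,
        add_mem (zsmul_mem (constClass_mem k _) _) (zsmul_mem (jumpClass_mem k _ fun s =>
          vtx_strictMono_E s (by simp)) _)⟩, ?_⟩
      ext i
      fin_cases i <;> simp [rank_constClass, rank_jumpClass, h0]⟩

theorem thin_antisymm_G {P : Type w} [PartialOrder P] {m : ℕ} {x y : (G P).Level m}
    (f : x ⟶ y) (g : y ⟶ x) : x = y :=
  Level.ext_vtx fun i => le_antisymm (leOfHom (f.1.app i)) (leOfHom (g.1.app i))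

/-- The class of the representation with zero maps. -/
def discClass : Cochain k (G (Fin (n + 1))) 0 := Gr.cls (discRep k _ thin_antisymm_G)

/-- A compositional morphism that is not an identity moves both the source and the target of an edge
strictly upwards, so zero maps pull back to zero maps along either face. In `E` this fails, for
instance for (0, 1) → (0, 2). -/
theorem discClass_mem : discClass k ∈ cocycles k (G (Fin (n + 1))) 0 := by
  rw [mem_cocycles_zero]
  refine (map_res_discRep k thin_antisymm_G (thin_antisymm_G (m := 1))
    ((G (Fin (n + 1))).d 0 0) ?_).trans (map_res_discRep k thin_antisymm_G
      (thin_antisymm_G (m := 1)) ((G (Fin (n + 1))).d 0 1) ?_).symm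
  · intro s t f h
    refine ((nonempty_hom_G s t).1 ⟨f⟩).resolve_right fun h' => ?_
    have h1 : vtx s 1 = vtx t 1 := congrArg (fun p => vtx p 0) h
    have h2 : vtx t 0 < vtx t 1 := vtx_strictMono_G t (by simp)
    exact absurd (lt_of_le_of_lt h' h2) (not_lt_of_ge h1.ge)
  · intro s t f h
    refine ((nonempty_hom_G s t).1 ⟨f⟩).resolve_right fun h' => ?_
    have h1 : vtx s 0 = vtx t 0 := congrArg (fun p : (G (Fin (n + 1))).Level 0 => vtx p 0) h
    have h2 : vtx s 0 < vtx s 1 := vtx_strictMono_G s (by simp)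
    exact absurd (h2.trans_le h') (not_lt_of_ge h1.ge)

theorem rank_discClass {i j : Fin (n + 1)} (h : i ≤ j) :
    rank k _ mem_objs_G mem_homs_G h (discClass k) = if i = j then 1 else 0 := by
  classical
  rw [rank, discClass, rk_discRep k thin_antisymm_G]
  refine if_congr ⟨fun h' => congrArg (fun p => vtx p 0) h', fun h' => h' ▸ rfl⟩ rfl rfl

/-- The cohomology of nondegenerate simplices of a linear order with compositional morphisms in
degree zero. -/
def cocyclesGEquiv (hn : 2 ≤ n) : cocycles k (G (Fin (n + 1))) 0 ≃+ (Fin 3 → ℤ) :=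
  AddEquiv.ofBijective
    (AddMonoidHom.mk' (fun x => ![
      rank k _ mem_objs_G mem_homs_G (Fin.zero_le (Fin.last n)) x.1,
      rank k _ mem_objs_G mem_homs_G (le_refl 0) x.1,
      rank k _ mem_objs_G mem_homs_G (Fin.zero_le (⟨1, by lia⟩ : Fin (n + 1))) x.1])
      (fun x y => by simp))
    ⟨by
      rw [injective_iff_map_eq_zero]
      rintro ⟨x, hx⟩ h
      have h1 := congrFun h 0
      have h2 := congrFun h 1
      have h3 := congrFun h 2
      refine Subtype.ext (eq_zero_of_rank k _ mem_objs_G mem_homs_G x fun {i j} h => ?_)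
      rcases h.eq_or_lt with rfl | h'
      · rw [rank_G_refl k x hx]
        exact h2
      by_cases hij : i = 0 ∧ j = Fin.last n
      · obtain ⟨rfl, rfl⟩ := hij
        exact h1
      · rw [rank_G_lt k x hx hn h' hij]
        exact h3, fun v => by
      have h0 : (0 : Fin (n + 1)) ≠ Fin.last n := by
        rw [Ne, Fin.ext_iff]; simp; lia
      have h1 : (⟨1, by lia⟩ : Fin (n + 1)) ≠ Fin.last n := by
        rw [Ne, Fin.ext_iff]; simp; lia
      have h2 : (0 : Fin (n + 1)) ≠ ⟨1, by lia⟩ := by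
        rw [Ne, Fin.ext_iff]; simp
      -- The three invariants are (1, 1, 1) on the constant class, (0, 1, 1) on the jump class and
      -- (0, 1, 0) on the class with zero maps; the coefficients invert this matrix.
      refine ⟨⟨v 0 • constClass k _ + (v 2 - v 0) • jumpClass k _ + (v 1 - v 2) • discClass k,
        add_mem (add_mem (zsmul_mem (constClass_mem k _) _) (zsmul_mem (jumpClass_mem k _ fun s =>
          vtx_strictMono_G s (by simp)) _)) (zsmul_mem (discClass_mem k) _)⟩, ?_⟩
      ext i
      fin_cases i <;> simp [rank_constClass, rank_jumpClass, rank_discClass, h0, h1, h2]⟩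

/-- Restriction preserves ranks, so the two ranks that serve as coordinates on the `E` side can be
evaluated on any cocycle for `G`. -/
theorem natEG_split (hn : 1 ≤ n) : ∃ r : H k (G (Fin (n + 1))) 0 →+ H k (E (Fin (n + 1))) 0,
    r.comp (natEG (Fin (n + 1)) k 0) = AddMonoidHom.id _ := by
  let ρ : cocycles k (G (Fin (n + 1))) 0 →+ (Fin 2 → ℤ) :=
    AddMonoidHom.mk' (fun x => ![
      rank k _ mem_objs_G mem_homs_G (Fin.zero_le (Fin.last n)) x.1,
      rank k _ mem_objs_G mem_homs_G (le_refl 0) x.1]) (fun x y => by simp)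
  refine ⟨(hZeroEquiv k _).symm.toAddMonoidHom.comp
    ((cocyclesEEquiv k hn).symm.toAddMonoidHom.comp (ρ.comp (hZeroEquiv k _).toAddMonoidHom)), ?_⟩
  ext x
  apply (hZeroEquiv k _).injective
  apply (cocyclesEEquiv k hn).injective
  have e {i j : Fin (n + 1)} (h : i ≤ j) : rank k _ mem_objs_G mem_homs_G h
      (resCochain k (S := G (Fin (n + 1))) (T := E (Fin (n + 1))) (fun _ => subset_rfl)
        (fun _ => le_top) 0 x.1) = rank k _ mem_objs_E mem_homs_E h x.1 := by
    exact rk_map_res _ _ _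
  simp only [AddMonoidHom.comp_apply, AddMonoidHom.id_apply, AddEquiv.toAddMonoidHom_eq_coe,
    AddMonoidHom.coe_coe, AddEquiv.apply_symm_apply]
  funext i
  fin_cases i
  · exact e (Fin.zero_le (Fin.last n))
  · exact e (le_refl 0)

end LinearOrder

end

end RepCoh

namespace RepCoh

noncomputable section

/-! ### Dandelions: the semi-simplicial category of chains -/

namespace Dandelion

variable {n : ℕ}

theorem le_cases {a b : Dandelion n} (h : a ≤ b) : a = b ∨ a = zero ∨ (a = one ∧ ∃ j, b = leaf j) := by
  rcases h with _ | _ | j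
  · exact Or.inl rfl
  · exact Or.inr (Or.inl rfl)
  · exact Or.inr (Or.inr ⟨rfl, j, rfl⟩)

theorem lt_cases {a b : Dandelion n} (h : a < b) :
    (a = zero ∧ b = one) ∨ (∃ j, a = zero ∧ b = leaf j) ∨ (∃ j, a = one ∧ b = leaf j) := by
  rcases le_cases h.le with rfl | rfl | ⟨rfl, j, rfl⟩
  · exact (lt_irrefl _ h).elim
  · cases b
    · exact (lt_irrefl _ h).elim
    · exact Or.inl ⟨rfl, rfl⟩
    · exact Or.inr (Or.inl ⟨_, rfl, rfl⟩)
  · exact Or.inr (Or.inr ⟨j, rfl, rfl⟩)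

theorem zero_lt_one : (zero : Dandelion n) < one := lt_of_le_of_ne (Dandelion.Le.zero_le _) (by simp)

theorem zero_lt_leaf (j : Fin n) : zero < leaf j := lt_of_le_of_ne (Dandelion.Le.zero_le _) (by simp)

theorem one_lt_leaf (j : Fin n) : one < leaf j :=
  lt_of_le_of_ne (Dandelion.Le.one_le_leaf _) (by simp)

theorem one_not_le_zero : ¬ (one : Dandelion n) ≤ zero := fun h => by cases h

theorem leaf_not_le_zero (j : Fin n) : ¬ leaf j ≤ zero := fun h => by cases h

theorem leaf_not_le_one (j : Fin n) : ¬ leaf j ≤ one := fun h => by cases h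

theorem leaf_le_iff (j : Fin n) (b : Dandelion n) : leaf j ≤ b ↔ b = leaf j :=
  ⟨fun h => by cases h; rfl, fun h => h ▸ le_refl _⟩

/-- The degree zero simplices. -/
def p (a : Dandelion n) : (G (Dandelion n)).Level 0 :=
  simplexG (fun _ => a) (Subsingleton.strictMono (α := Fin 1) _)

/-- The degree one simplices. -/
def e (a b : Dandelion n) (h : a < b) : (G (Dandelion n)).Level 1 :=
  simplexG ![a, b] (by simpa [Fin.strictMono_iff_lt_succ] using h)

/-- The degree two simplices. -/
def t (j : Fin n) : (G (Dandelion n)).Level 2 :=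
  simplexG ![zero, one, leaf j] (by
    rw [Fin.strictMono_iff_lt_succ]
    intro i
    fin_cases i
    · exact zero_lt_one
    · exact one_lt_leaf j)

theorem eq_p (x : (G (Dandelion n)).Level 0) (a) (h : vtx x 0 = a) : x = p a :=
  Level.ext_vtx fun i => by
    obtain rfl : i = 0 := Fin.ext (by lia)
    exact h

theorem eq_e (x : (G (Dandelion n)).Level 1) (a b) (h : a < b) (h0 : vtx x 0 = a)
    (h1 : vtx x 1 = b) : x = e a b h :=
  Level.ext_vtx fun i => by
    fin_cases i
    · exact h0
    · exact h1

theorem cases_zero (x : (G (Dandelion n)).Level 0) : x = p zero ∨ x = p one ∨ ∃ j, x = p (leaf j) := by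
  rcases h : vtx x 0 with _ | _ | j
  · exact Or.inl (eq_p x _ h)
  · exact Or.inr (Or.inl (eq_p x _ h))
  · exact Or.inr (Or.inr ⟨j, eq_p x _ h⟩)

theorem cases_one (x : (G (Dandelion n)).Level 1) : x = e zero one zero_lt_one ∨
    (∃ j, x = e zero (leaf j) (zero_lt_leaf j)) ∨ ∃ j, x = e one (leaf j) (one_lt_leaf j) := by
  have h : vtx x 0 < vtx x 1 := vtx_strictMono_G x (by simp)
  rcases lt_cases h with ⟨h0, h1⟩ | ⟨j, h0, h1⟩ | ⟨j, h0, h1⟩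
  · exact Or.inl (eq_e x _ _ _ h0 h1)
  · exact Or.inr (Or.inl ⟨j, eq_e x _ _ _ h0 h1⟩)
  · exact Or.inr (Or.inr ⟨j, eq_e x _ _ _ h0 h1⟩)

theorem cases_two (x : (G (Dandelion n)).Level 2) : ∃ j, x = t j := by
  have h : vtx x 0 < vtx x 1 := vtx_strictMono_G x (by decide)
  have h' : vtx x 1 < vtx x 2 := vtx_strictMono_G x (by decide)
  rcases lt_cases h with ⟨h0, h1⟩ | ⟨j, h0, h1⟩ | ⟨j, h0, h1⟩ <;>
  rcases lt_cases h' with ⟨h2, h3⟩ | ⟨j', h2, h3⟩ | ⟨j', h2, h3⟩ <;> rw [h1] at h2 <;>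
    try cases h2
  exact ⟨j', Level.ext_vtx fun i => by
    fin_cases i
    · exact h0
    · exact h1
    · exact h3⟩

theorem isEmpty_level (m : ℕ) : IsEmpty ((G (Dandelion n)).Level (m + 3)) := ⟨fun x => by
  have h (i j : Fin (m + 3 + 1)) (hij : i.val < j.val) : vtx x i < vtx x j := vtx_strictMono_G x hij
  have h1 := h ⟨0, by lia⟩ ⟨1, by lia⟩ (by simp)
  have h2 := h ⟨1, by lia⟩ ⟨2, by lia⟩ (by simp)
  have h3 := h ⟨2, by lia⟩ ⟨3, by lia⟩ (by simp)
  rcases lt_cases h3 with ⟨h4, -⟩ | ⟨j, h4, -⟩ | ⟨j, h4, -⟩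
  · rw [h4] at h2
    exact absurd h2.le (by rcases lt_cases h2 with ⟨_, h⟩ | ⟨_, _, h⟩ | ⟨_, _, h⟩ <;> cases h)
  · rw [h4] at h2
    exact absurd h2.le (by rcases lt_cases h2 with ⟨_, h⟩ | ⟨_, _, h⟩ | ⟨_, _, h⟩ <;> cases h)
  · rw [h4] at h2
    rcases lt_cases h2 with ⟨h5, _⟩ | ⟨_, _, h⟩ | ⟨_, _, h⟩
    · rw [h5] at h1
      rcases lt_cases h1 with ⟨_, h⟩ | ⟨_, _, h⟩ | ⟨_, _, h⟩ <;> cases h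
    · cases h
    · cases h⟩

@[simp] theorem vtx_p (a : Dandelion n) (i) : vtx (p a) i = a := rfl
@[simp] theorem vtx_e_zero (a b : Dandelion n) (h) : vtx (e a b h) 0 = a := rfl
@[simp] theorem vtx_e_one (a b : Dandelion n) (h) : vtx (e a b h) 1 = b := rfl

@[simp] theorem d_zero_e (a b : Dandelion n) (h) : ((G (Dandelion n)).d 0 0).obj (e a b h) = p b :=
  eq_p _ _ rfl

@[simp] theorem d_one_e (a b : Dandelion n) (h) : ((G (Dandelion n)).d 0 1).obj (e a b h) = p a :=
  eq_p _ _ rfl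

@[simp] theorem d_zero_t (j : Fin n) :
    ((G (Dandelion n)).d 1 0).obj (t j) = e one (leaf j) (one_lt_leaf j) := eq_e _ _ _ _ rfl rfl

@[simp] theorem d_one_t (j : Fin n) :
    ((G (Dandelion n)).d 1 1).obj (t j) = e zero (leaf j) (zero_lt_leaf j) := eq_e _ _ _ _ rfl rfl

@[simp] theorem d_two_t (j : Fin n) :
    ((G (Dandelion n)).d 1 2).obj (t j) = e zero one zero_lt_one := eq_e _ _ _ _ rfl rfl

/-- Long edges are those omitting the middle. -/
def IsLong (x : (G (Dandelion n)).Level 1) : Prop := vtx x 0 = zero ∧ vtx x 1 ≠ one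

@[simp] theorem isLong_zero_one : ¬ IsLong (e (zero : Dandelion n) one zero_lt_one) := fun h => h.2 rfl

@[simp] theorem isLong_zero_leaf (j : Fin n) : IsLong (e zero (leaf j) (zero_lt_leaf j)) :=
  ⟨rfl, by simp⟩

@[simp] theorem isLong_one_leaf (j : Fin n) : ¬ IsLong (e one (leaf j) (one_lt_leaf j)) :=
  fun h => by cases h.1

/-- A long edge starts at the minimum and ends at a maximal element, so no compositional morphism
except its identity enters or leaves it. -/
theorem isLong_iff {x y : (G (Dandelion n)).Level 1} (f : x ⟶ y) : IsLong x ↔ IsLong y := by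
  rcases (nonempty_hom_G x y).1 ⟨f⟩ with rfl | h
  · rfl
  · rcases cases_one x with rfl | ⟨j, rfl⟩ | ⟨j, rfl⟩ <;>
    rcases cases_one y with rfl | ⟨j', rfl⟩ | ⟨j', rfl⟩ <;> simp
    · exact one_not_le_zero h
    · exact leaf_not_le_zero _ h
    · exact leaf_not_le_one _ h
    · exact leaf_not_le_zero _ h

theorem eq_of_isLong {x y : (G (Dandelion n)).Level 1} (f : x ⟶ y) (hx : IsLong x) : x = y := by
  rcases (nonempty_hom_G x y).1 ⟨f⟩ with rfl | h
  · rfl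
  · obtain ⟨h1, h2⟩ := (isLong_iff f).1 hx
    have h3 : vtx x 0 < vtx x 1 := vtx_strictMono_G x (by simp)
    have h4 := lt_of_lt_of_le h3 h
    rw [h1] at h4
    rcases lt_cases h4 with ⟨_, h⟩ | ⟨_, _, h⟩ | ⟨_, _, h⟩ <;> cases h

/-- The edge ending in a given nonzero element and having no element in between. -/
def edge (x : (G (Dandelion n)).Level 0) : (G (Dandelion n)).Level 1 :=
  match vtx x 0 with
  | leaf j => e one (leaf j) (one_lt_leaf j)
  -- The intended value at `one`, and a junk value at `zero`.
  | _ => e zero one zero_lt_one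

@[simp] theorem edge_one : edge (p (one : Dandelion n)) = e zero one zero_lt_one := rfl
@[simp] theorem edge_leaf (j : Fin n) : edge (p (leaf j)) = e one (leaf j) (one_lt_leaf j) := rfl

/-- Restriction to the star around `1`, extended by zero. -/
def starOf : PMap ((G (Dandelion n)).Level 0) ((G (Dandelion n)).Level 1) where
  P x := vtx x 0 ≠ zero
  f := edge
  hom {x y} hx hy f := by
    have h := (nonempty_hom_G x y).1 ⟨f⟩
    rcases cases_zero x with rfl | rfl | ⟨j, rfl⟩
    · exact (hx rfl).elim
    · rcases cases_zero y with rfl | rfl | ⟨j', rfl⟩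
      · exact (hy rfl).elim
      · exact ⟨𝟙 _⟩
      · exact (nonempty_hom_G _ _).2 (Or.inr (le_refl _))
    · rcases h with rfl | h
      · exact ⟨𝟙 _⟩
      · have : y = p (leaf j) := eq_p _ _ ((leaf_le_iff j _).1 h)
        rw [this]
        exact ⟨𝟙 _⟩
  convex {x y z} f g hx hz h := by
    have h' := leOfHom (f.1.app 0)
    change vtx x 0 ≤ vtx y 0 at h'
    rw [h] at h'
    exact hx (le_antisymm h' (Dandelion.Le.zero_le _))

/-- The part of the poset above `0`. -/
def cutZero : PMap ((G (Dandelion n)).Level 0) ((G (Dandelion n)).Level 0) :=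
  PMap.cut (fun x => vtx x 0 ≠ zero) starOf.convex

/-- Transport of the value at `1` to the leaves. -/
def spread : PMap ((G (Dandelion n)).Level 0) ((G (Dandelion n)).Level 0) where
  P x := ∃ j, vtx x 0 = leaf j
  f _ := p one
  hom _ _ _ := ⟨𝟙 _⟩
  convex {x y z} f g hx hz := by
    obtain ⟨j, hj⟩ := hx
    have h' := leOfHom (f.1.app 0)
    change vtx x 0 ≤ vtx y 0 at h'
    rw [hj, leaf_le_iff] at h'
    exact ⟨j, h'⟩

/-- The short edges. -/
def cutShort : PMap ((G (Dandelion n)).Level 1) ((G (Dandelion n)).Level 1) :=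
  PMap.cut (fun x => ¬ IsLong x) fun f _ hx _ h => hx ((isLong_iff f).2 h)

/-- The long edges. -/
def cutLong : PMap ((G (Dandelion n)).Level 1) ((G (Dandelion n)).Level 1) :=
  PMap.cut IsLong fun f _ hx _ => (isLong_iff f).1 hx

/-- The triangle on a long edge. -/
def tri (j₀ : Fin n) (x : (G (Dandelion n)).Level 1) : (G (Dandelion n)).Level 2 :=
  match vtx x 1 with
  | leaf j => t j
  -- Junk value, not taken on long edges.
  | _ => t j₀

@[simp] theorem tri_e (j₀ j : Fin n) : tri j₀ (e zero (leaf j) (zero_lt_leaf j)) = t j := rfl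

/-- Representations of triangles as representations of long edges. -/
def triOf (j₀ : Fin n) : PMap ((G (Dandelion n)).Level 1) ((G (Dandelion n)).Level 2) where
  P := IsLong
  f := tri j₀
  hom {x y} hx hy f := by
    rw [eq_of_isLong f hx]
    exact ⟨𝟙 _⟩
  convex f g hx hz := (isLong_iff f).1 hx

/-! ### The coboundary seen on the short edges. -/

variable (k : Type u) [Field k]

theorem starOf_d_zero (x : Cochain k (G (Dandelion n)) 0) :
    starOf.gr k (coface k _ 0 0 x) = cutZero.gr k x := by
  rw [coface, ← PMap.gr_ofFunctor, ← PMap.gr_comp]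
  refine DFunLike.congr_fun (PMap.gr_congr k _ _ (fun x => and_iff_left trivial) fun x hx => ?_) x
  rcases cases_zero x with rfl | rfl | ⟨j, rfl⟩
  · exact (hx.1 rfl).elim
  · exact d_zero_e _ _ zero_lt_one
  · exact d_zero_e _ _ (one_lt_leaf j)

/-- The short edge ending at a leaf starts at `one`, and the one ending at `one` starts at the
minimum, where a cut class vanishes. What remains is the value at `one`, copied to the leaves. -/
theorem starOf_d_one (x : Cochain k (G (Dandelion n)) 0) :
    starOf.gr k (coface k _ 0 1 (cutZero.gr k x)) = spread.gr k x := by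
  rw [coface, ← PMap.gr_ofFunctor, ← PMap.gr_comp, ← PMap.gr_comp]
  refine DFunLike.congr_fun (PMap.gr_congr k _ _ (fun x => ?_) fun x hx => ?_) x
  · rcases cases_zero x with rfl | rfl | ⟨j, rfl⟩ <;>
      simp [starOf, cutZero, spread]
  · rcases cases_zero x with rfl | rfl | ⟨j, rfl⟩
    · exact (hx.1.1 rfl).elim
    · exact (hx.2 rfl).elim
    · exact d_one_e _ _ (one_lt_leaf j)

/-- `spread` reads only the value at `one` and writes only at the leaves. This makes `1 - spread`
invertible. -/
theorem spread_spread (x : Cochain k (G (Dandelion n)) 0) : spread.gr k (spread.gr k x) = 0 := by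
  rw [← PMap.gr_comp, PMap.gr_eq_zero, AddMonoidHom.zero_apply]
  rintro x ⟨-, j, h⟩
  cases h

theorem cutZero_starOf (x : Cochain k (G (Dandelion n)) 1) :
    cutZero.gr k (starOf.gr k x) = starOf.gr k x := by
  rw [← PMap.gr_comp]
  exact DFunLike.congr_fun (PMap.gr_congr k (cutZero.comp starOf) starOf
    (fun x => and_self_iff) fun x hx => rfl) x

theorem cutZero_spread (x : Cochain k (G (Dandelion n)) 0) :
    cutZero.gr k (spread.gr k x) = spread.gr k x := by
  rw [← PMap.gr_comp]
  refine DFunLike.congr_fun (PMap.gr_congr k (cutZero.comp spread) spread (fun x => ?_)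
    fun x hx => rfl) x
  refine and_iff_right_of_imp ?_
  rintro ⟨j, h⟩ h'
  cases h.symm.trans h'

theorem short_add_long (x : Cochain k (G (Dandelion n)) 1) :
    cutShort.gr k x + cutLong.gr k x = x := by
  have := PMap.gr_add_gr k (fun x : (G (Dandelion n)).Level 1 => ¬ IsLong x) IsLong
    (fun f _ hx _ h => hx ((isLong_iff f).2 h)) (fun f _ hx _ => (isLong_iff f).1 hx)
    (fun x => Iff.rfl) (fun f => not_congr (isLong_iff f))
  exact DFunLike.congr_fun this x

/-- A short edge is determined by its target, so the short part is the pullback of the star part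
along the target face. -/
theorem cutShort_eq (x : Cochain k (G (Dandelion n)) 1) (h : starOf.gr k x = 0) :
    cutShort.gr k x = 0 := by
  have e : cutShort.gr k x =
      ((cutShort.comp (PMap.ofFunctor ((G (Dandelion n)).d 0 0))).comp starOf).gr k x := by
    refine DFunLike.congr_fun (PMap.gr_congr k _ _ (fun x => ?_) fun x hx => ?_) x
    · rcases cases_one x with rfl | ⟨j, rfl⟩ | ⟨j, rfl⟩ <;> simp [cutShort, starOf]
    · rcases cases_one x with rfl | ⟨j, rfl⟩ | ⟨j, rfl⟩
      · simp [cutShort, starOf]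
      · exact (hx (isLong_zero_leaf j)).elim
      · simp [cutShort, starOf]
  rw [e, PMap.gr_comp, h, map_zero]

/-- The edge 0 < j is the face of the triangle 0 < 1 < j omitting 1, so the long part of a class can
be recovered from its image under `δ¹`. -/
theorem cutLong_eq (j₀ : Fin n) (x : Cochain k (G (Dandelion n)) 1) :
    cutLong.gr k x = (triOf j₀).gr k (coface k _ 1 1 x) := by
  rw [coface, ← PMap.gr_ofFunctor, ← PMap.gr_comp]
  refine DFunLike.congr_fun (PMap.gr_congr k _ _ (fun x => (and_iff_left trivial).symm) fun x hx => ?_) x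
  rcases cases_one x with rfl | ⟨j, rfl⟩ | ⟨j, rfl⟩
  · exact (isLong_zero_one hx).elim
  · exact (d_one_t j).symm
  · exact (isLong_one_leaf j hx).elim

theorem d_zero_triOf (j₀ : Fin n) (x : Cochain k (G (Dandelion n)) 2) :
    coface k _ 1 0 ((triOf j₀).gr k x) = 0 := by
  rw [coface, ← PMap.gr_ofFunctor, ← PMap.gr_comp, PMap.gr_eq_zero, AddMonoidHom.zero_apply]
  rintro x ⟨-, h⟩
  obtain ⟨j, rfl⟩ := cases_two x
  have h' : IsLong (((G (Dandelion n)).d 1 0).obj (t j)) := h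
  rw [d_zero_t] at h'
  exact isLong_one_leaf j h'

theorem d_two_triOf (j₀ : Fin n) (x : Cochain k (G (Dandelion n)) 2) :
    coface k _ 1 2 ((triOf j₀).gr k x) = 0 := by
  rw [coface, ← PMap.gr_ofFunctor, ← PMap.gr_comp, PMap.gr_eq_zero, AddMonoidHom.zero_apply]
  rintro x ⟨-, h⟩
  obtain ⟨j, rfl⟩ := cases_two x
  have h' : IsLong (((G (Dandelion n)).d 1 2).obj (t j)) := h
  rw [d_two_t] at h'
  exact isLong_zero_one h'

theorem d_one_triOf (j₀ : Fin n) (x : Cochain k (G (Dandelion n)) 2) :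
    coface k _ 1 1 ((triOf j₀).gr k x) = x := by
  rw [coface, ← PMap.gr_ofFunctor, ← PMap.gr_comp]
  refine DFunLike.congr_fun (PMap.gr_eq_id k _ (fun x => ?_) fun x => ?_) x
  · obtain ⟨j, rfl⟩ := cases_two x
    refine ⟨trivial, ?_⟩
    change IsLong (((G (Dandelion n)).d 1 1).obj (t j))
    rw [d_one_t]
    exact isLong_zero_leaf j
  · obtain ⟨j, rfl⟩ := cases_two x
    change tri j₀ (((G (Dandelion n)).d 1 1).obj (t j)) = t j
    rw [d_one_t, tri_e]

/-- Degree one cocycles vanish if they vanish on the star around `1`. -/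
theorem eq_zero_of_cocycle (j₀ : Fin n) (x : Cochain k (G (Dandelion n)) 1)
    (hx : x ∈ cocycles k _ 1) (h : starOf.gr k x = 0) : x = 0 := by
  have h1 := short_add_long k x
  rw [cutShort_eq k x h, zero_add, cutLong_eq k j₀] at h1
  have h2 : coboundary k _ 1 x = 0 := hx
  -- The other two faces of a triangle are short, so on long edges the coboundary is `-δ¹`.
  rw [← h1, coboundary_one, d_zero_triOf, d_two_triOf, d_one_triOf] at h2
  rw [← h1, show coface k _ 1 1 x = 0 by simpa using h2, map_zero]

/-- A primitive of a degree one cocycle. -/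
theorem exists_primitive (j₀ : Fin n) (x : Cochain k (G (Dandelion n)) 1)
    (hx : x ∈ cocycles k _ 1) :
    ∃ y : Cochain k (G (Dandelion n)) 0, cutZero.gr k y = y ∧ coboundary k _ 0 y = x := by
  -- On the star the coboundary is `1 - spread`, whose inverse is `1 + spread`; this dictates the
  -- primitive.
  have hy : cutZero.gr k (starOf.gr k x + spread.gr k (starOf.gr k x)) =
      starOf.gr k x + spread.gr k (starOf.gr k x) := by
    rw [map_add, cutZero_starOf, cutZero_spread]
  refine ⟨_, hy, ?_⟩
  rw [← sub_eq_zero]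
  refine eq_zero_of_cocycle k j₀ _ (sub_mem (coboundary_coboundary k _ 0 _) hx) ?_
  rw [map_sub, coboundary_zero, map_sub, starOf_d_zero]
  rw [← hy, starOf_d_one, hy, hy, map_add, spread_spread]
  abel

/-- On the star the cocycle condition reads `x = spread x`; applying it twice gives zero. -/
theorem eq_zero_of_cutZero (x : Cochain k (G (Dandelion n)) 0) (hx : x ∈ cocycles k _ 0)
    (h : cutZero.gr k x = x) : x = 0 := by
  rw [mem_cocycles_zero] at hx
  have h1 := congrArg (starOf.gr k) hx
  rw [starOf_d_zero, h] at h1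
  rw [← h, starOf_d_one] at h1
  rw [h] at h1
  rw [h1, h1, spread_spread]

end Dandelion

end

end RepCoh

namespace RepCoh

noncomputable section

/-! ### Dandelions: cohomology -/

theorem subsingleton_H (k : Type u) [Field k] {C : Type w} [Category.{v} C] (S : SemiSub C) (n : ℕ)
    (h : ∀ x ∈ cocycles k S n, x ∈ coboundaries k S n) : Subsingleton (H k S n) := by
  have : (coboundaries k S n).addSubgroupOf (cocycles k S n) = ⊤ := by
    rw [AddSubgroup.addSubgroupOf_eq_top]
    exact h
  rw [H, this]
  exact QuotientAddGroup.subsingleton_quotient_top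

theorem isZero_fgModule_iff {k : Type u} [Field k] (V : FGModuleCat.{u} k) :
    IsZero V ↔ Subsingleton V := by
  rw [IsZero.iff_id_eq_zero]
  constructor
  · intro h
    have h' : ∀ v : V, v = 0 := fun v => congrArg (fun f => f.hom.hom v) h
    exact ⟨fun a b => (h' a).trans (h' b).symm⟩
  · intro h
    exact FGModuleCat.hom_ext (LinearMap.ext fun v => Subsingleton.elim _ _)

theorem subsingleton_gr_of_isEmpty (k : Type u) [Field k] {C : Type u₁} [Category.{v₁} C]
    [IsEmpty C] : Subsingleton (Gr (Rep k C)) := by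
  have : AddMonoidHom.id (Gr (Rep k C)) = 0 := Gr.hom_ext fun M =>
    Gr.cls_zero ((Rep.isZero_iff M).2 fun x => isEmptyElim x)
  exact ⟨fun x y => (DFunLike.congr_fun this x).trans (DFunLike.congr_fun this y).symm⟩

namespace Dandelion

variable (k : Type u) [Field k] {n : ℕ}

theorem subsingleton_cohomology (j₀ : Fin n) (i : ℕ) (hi : 0 < i) :
    Subsingleton (H k (G (Dandelion n)) i) := by
  refine subsingleton_H k _ i fun x hx => ?_
  match i, hi with
  | 1, _ =>
    obtain ⟨y, -, hy⟩ := exists_primitive k j₀ x hx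
    exact ⟨y, hy⟩
  | 2, _ =>
    -- Place `x` on the long edges; the sign cancels the one carried by `δ¹` in the coboundary.
    refine ⟨-(triOf j₀).gr k x, ?_⟩
    rw [map_neg, coboundary_one, d_zero_triOf, d_one_triOf, d_two_triOf]
    simp
  | m + 3, _ =>
    have := isEmpty_level (n := n) m
    have := subsingleton_gr_of_isEmpty k (C := (G (Dandelion n)).Level (m + 3))
    rw [Subsingleton.elim x 0]
    exact zero_mem _

/-! ### Degree zero cocycles and the indecomposables alive at the minimum. -/

instance : Finite (Dandelion n) :=
  Finite.of_injective (β := Option (Option (Fin n)))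
    (fun | zero => none | one => some none | leaf j => some (some j))
    (by rintro (_ | _ | i) (_ | _ | j) h <;> simp_all)

/-- Cutting off the value at the minimum. -/
def cutMin : PMap (Dandelion n) (Dandelion n) :=
  PMap.cut (fun x => x ≠ zero) fun {x y z} f _ hx _ h => by
    have h' := leOfHom f
    rw [h] at h'
    exact hx (le_antisymm h' (Dandelion.Le.zero_le _))

/-- The indecomposables that do not vanish at the minimum. -/
def toInd (c : IndecAtZero k n) : Ind (Rep k (Dandelion n)) :=
  ⟨c.1, c.2.choose, c.2.choose_spec.1, c.2.choose_spec.2.1⟩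

theorem toInd_injective : Function.Injective (toInd k (n := n)) := fun c _ h =>
  Subtype.ext (congrArg (fun I : Ind _ => I.1) h)

theorem mem_range_toInd (I : Ind (Rep k (Dandelion n))) :
    I ∈ Set.range (toInd k) ↔ ¬ Subsingleton (I.out.obj zero) := by
  constructor
  · rintro ⟨c, rfl⟩ h
    obtain ⟨M, h1, h2, h3⟩ := c.2
    obtain ⟨e⟩ := IsoClass.exact ((toInd k c).mk_out.trans h1.symm)
    exact h3 ((isZero_fgModule_iff (M.obj zero)).2
      ((isoApp e zero).toEquiv.subsingleton_congr.1 h))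
  · intro h
    exact ⟨⟨I.1, I.out, I.mk_out, I.indecomposable, fun h' => h
      ((isZero_fgModule_iff _).1 h')⟩, rfl⟩

/-- The multiplicities of the indecomposables that do not vanish at the minimum. -/
def proj : Gr (Rep k (Dandelion n)) →+ (IndecAtZero k n →₀ ℤ) :=
  (Finsupp.comapDomain.addMonoidHom (toInd_injective k)).comp
    (ksEquiv k (Rep k (Dandelion n))).symm.toAddMonoidHom

theorem proj_apply (x : Gr (Rep k (Dandelion n))) (c : IndecAtZero k n) :
    proj k x c = (ksEquiv k (Rep k (Dandelion n))).symm x (toInd k c) := rfl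

theorem proj_surjective : Function.Surjective (proj k (n := n)) := fun g =>
  ⟨ksEquiv k _ (g.mapDomain (toInd k)), by
    ext c
    rw [proj_apply, AddEquiv.symm_apply_apply, Finsupp.mapDomain_apply (toInd_injective k)]⟩

/-- An indecomposable alive at the minimum is not a summand of a representation that vanishes there.
-/
theorem proj_cls_eq_zero (M : Rep k (Dandelion n)) (h : Subsingleton (M.obj zero)) :
    proj k (Gr.cls M) = 0 := by
  ext c
  rw [proj_apply]
  have h1 := mult_ksHom k (toInd k c) ((ksEquiv k (Rep k (Dandelion n))).symm (Gr.cls M))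
  have h2 : ksHom ((ksEquiv k (Rep k (Dandelion n))).symm (Gr.cls M)) = Gr.cls M :=
    (ksEquiv k (Rep k (Dandelion n))).apply_symm_apply _
  rw [h2, mult_cls_eq_zero, eq_comm, mul_eq_zero] at h1
  · exact h1.resolve_right (mult_cls_self k _)
  · intro f g hfg
    refine (mem_range_toInd k (toInd k c)).1 ⟨c, rfl⟩ ((isoApp (asIso (f ≫ g)) zero).toEquiv.subsingleton_congr.2 ?_)
    refine ⟨fun a b => ?_⟩
    obtain ⟨a, rfl⟩ := (isoApp (asIso (f ≫ g)) zero).surjective a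
    obtain ⟨b, rfl⟩ := (isoApp (asIso (f ≫ g)) zero).surjective b
    change app g zero (app f zero a) = app g zero (app f zero b)
    rw [Subsingleton.elim (app f zero a)]

theorem proj_cutMin (x : Gr (Rep k (Dandelion n))) : proj k (cutMin.gr k x) = 0 := by
  suffices h : (proj k).comp (cutMin.gr k) = 0 from DFunLike.congr_fun h x
  refine Gr.hom_ext fun M => ?_
  rw [AddMonoidHom.comp_apply, PMap.gr_cls, AddMonoidHom.zero_apply]
  exact proj_cls_eq_zero k _ (subsingleton_extObj _ _ fun h => (h rfl).elim)

theorem cutMin_cls (M : Rep k (Dandelion n)) (h : Subsingleton (M.obj zero)) :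
    cutMin.gr k (Gr.cls M) = Gr.cls M := by
  rw [PMap.gr_cls]
  refine Gr.cls_iso (extIso cutMin M M (fun x _ => LinearEquiv.refl k _)
    (fun x hx => ?_) fun {x y} hx hy g v => ?_)
  · rw [not_not.1 hx]
    exact h
  · exact DFunLike.congr_fun (lin_thin M (cutMin.map hx hy g) g) v

/-- Only indecomposables vanishing at the minimum remain in the expansion of `x`, and the cut fixes
each of them. -/
theorem cutMin_of_proj (x : Gr (Rep k (Dandelion n))) (h : proj k x = 0) :
    cutMin.gr k x = x := by
  obtain ⟨f, rfl⟩ := (ksEquiv k (Rep k (Dandelion n))).surjective x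
  change cutMin.gr k (Finsupp.linearCombination ℤ _ f) = Finsupp.linearCombination ℤ _ f
  rw [Finsupp.linearCombination_apply, Finsupp.sum, map_sum]
  refine Finset.sum_congr rfl fun I hI => ?_
  rw [map_zsmul, cutMin_cls]
  by_contra h1
  obtain ⟨c, rfl⟩ := (mem_range_toInd k I).2 h1
  have h2 := DFunLike.congr_fun h c
  rw [proj_apply, AddEquiv.symm_apply_apply] at h2
  exact Finsupp.mem_support_iff.1 hI h2

/-- Cochains in degree `0` as classes of representations of the poset. -/
def onPoset : Cochain k (G (Dandelion n)) 0 →+ Gr (Rep k (Dandelion n)) :=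
  Gr.map (Rep.res k (levelZeroEquiv (G (Dandelion n)) mem_objs_G mem_homs_G).inverse)

theorem onPoset_bijective : Function.Bijective (onPoset k (n := n)) :=
  ⟨Function.LeftInverse.injective
    (map_res_functor_inverse k (levelZeroEquiv (G (Dandelion n)) mem_objs_G mem_homs_G)),
   Function.RightInverse.surjective
    (map_res_functor_inverse k (levelZeroEquiv (G (Dandelion n)) mem_objs_G mem_homs_G).symm)⟩

theorem onPoset_cutZero (x : Cochain k (G (Dandelion n)) 0) :
    onPoset k (cutZero.gr k x) = cutMin.gr k (onPoset k x) := by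
  rw [onPoset, ← PMap.gr_ofFunctor, ← PMap.gr_comp, ← PMap.gr_comp]
  exact DFunLike.congr_fun (PMap.gr_congr k ((PMap.ofFunctor _).comp cutZero)
    (cutMin.comp (PMap.ofFunctor _)) (fun x => and_comm) fun x hx => rfl) x

/-- The cocycles in degree `0`. -/
def cocyclesEquiv (j₀ : Fin n) : cocycles k (G (Dandelion n)) 0 ≃+ (IndecAtZero k n →₀ ℤ) :=
  AddEquiv.ofBijective (((proj k).comp (onPoset k)).comp (AddSubgroup.subtype _)) (by
    constructor
    · rw [injective_iff_map_eq_zero]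
      rintro ⟨x, hx⟩ h
      refine Subtype.ext (eq_zero_of_cutZero k x hx ((onPoset_bijective k).1 ?_))
      rw [onPoset_cutZero]
      exact cutMin_of_proj k _ h
    · intro g
      obtain ⟨y, rfl⟩ := proj_surjective k g
      obtain ⟨x, rfl⟩ := (onPoset_bijective k).2 y
      -- Subtracting the primitive supported above the minimum turns any class into a cocycle
      -- without changing its multiplicities at the minimum.
      obtain ⟨z, hz, hz'⟩ := exists_primitive k j₀ (coboundary k _ 0 x)
        (coboundary_coboundary k _ 0 x)
      refine ⟨⟨x - z, ?_⟩, ?_⟩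
      · rw [cocycles, AddMonoidHom.mem_ker, map_sub, hz', sub_self]
      · change proj k (onPoset k (x - z)) = _
        rw [map_sub, map_sub, ← hz, onPoset_cutZero, proj_cutMin, sub_zero])

end Dandelion

end

end RepCoh

namespace RepCoh

noncomputable section

/-! ### Cyclic modules over a polynomial ring -/

section Cyclic

open Polynomial AdjoinRoot

variable {k : Type u} [Field k]

theorem hom_mk (f h : k[X]) (φ : AdjoinRoot f →ₗ[k] AdjoinRoot h)
    (hφ : ∀ x, φ (root f * x) = root h * φ x) (g : k[X]) : φ (mk f g) = mk h g * φ 1 := by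
  have h1 (n : ℕ) : φ (root f ^ n) = root h ^ n * φ 1 := by
    induction n with
    | zero => simp
    | succ n ih => rw [pow_succ', hφ, ih, pow_succ', mul_assoc]
  have h2 (f : k[X]) (n : ℕ) (a : k) : mk f (monomial n a) = a • root f ^ n := by
    rw [← C_mul_X_pow_eq_monomial, map_mul, map_pow, mk_X, Algebra.smul_def]
    rfl
  induction g using Polynomial.induction_on' with
  | add p q hp hq => rw [map_add, map_add, map_add, hp, hq, add_mul]
  | monomial n a => rw [h2, h2, map_smul, h1, smul_mul_assoc]

theorem endo_eq_mul (f : k[X]) (φ : AdjoinRoot f →ₗ[k] AdjoinRoot f)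
    (h : ∀ x, φ (root f * x) = root f * φ x) (x : AdjoinRoot f) : φ x = x * φ 1 := by
  obtain ⟨g, rfl⟩ := AdjoinRoot.mk_surjective x
  exact hom_mk f f φ h g

/-- Such an endomorphism is multiplication by some `g` with `q ^ m ∣ g * (g - 1)`. As `q` cannot
divide both factors, `q ^ m` divides one of them. -/
theorem endo_idempotent {q : k[X]} (hq : Irreducible q) (m : ℕ)
    (φ : AdjoinRoot (q ^ m) →ₗ[k] AdjoinRoot (q ^ m))
    (h : ∀ x, φ (root (q ^ m) * x) = root (q ^ m) * φ x) (hφ : ∀ x, φ (φ x) = φ x) :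
    φ = 0 ∨ φ = LinearMap.id := by
  obtain ⟨g, hg⟩ := AdjoinRoot.mk_surjective (φ 1)
  have h1 := hφ 1
  rw [endo_eq_mul _ φ h (φ 1), ← hg, ← map_mul, AdjoinRoot.mk_eq_mk] at h1
  have h2 : q ^ m ∣ g * (g - 1) := by
    rwa [mul_sub, mul_one]
  by_cases h3 : q ∣ g
  · left
    have h4 : IsCoprime (q ^ m) (g - 1) := IsCoprime.pow_left <|
      (Irreducible.coprime_iff_not_dvd hq).2 fun h5 =>
        hq.not_isUnit (isUnit_of_dvd_one (by simpa using dvd_sub h3 h5))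
    ext x
    rw [endo_eq_mul _ φ h, ← hg, AdjoinRoot.mk_eq_zero.2 (h4.dvd_of_dvd_mul_right h2)]
    simp
  · right
    have h4 : IsCoprime (q ^ m) g := IsCoprime.pow_left <|
      (Irreducible.coprime_iff_not_dvd hq).2 h3
    ext x
    have h5 := AdjoinRoot.mk_eq_mk.2 (h4.dvd_of_dvd_mul_left h2)
    rw [endo_eq_mul _ φ h, ← hg, h5]
    simp

end Cyclic

/-! ### Dandelions: indecomposable representations -/

namespace Dandelion

section Construction

variable {k : Type u} [Field k] {n : ℕ} (V₀ V₁ W : Type u) [AddCommGroup V₀] [Module k V₀]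
  [Module.Finite k V₀] [AddCommGroup V₁] [Module k V₁] [Module.Finite k V₁] [AddCommGroup W]
  [Module k W] [Module.Finite k W]

/-- The values of a representation with constant value at the leaves. -/
@[reducible] def spaces : Dandelion n → Type u
  | zero => V₀
  | one => V₁
  | leaf _ => W

instance : ∀ x : Dandelion n, AddCommGroup (spaces V₀ V₁ W x)
  | zero => ‹AddCommGroup V₀›
  | one => ‹AddCommGroup V₁›
  | leaf _ => ‹AddCommGroup W›

instance : ∀ x : Dandelion n, Module k (spaces V₀ V₁ W x)
  | zero => ‹Module k V₀›
  | one => ‹Module k V₁›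
  | leaf _ => ‹Module k W›

instance : ∀ x : Dandelion n, Module.Finite k (spaces V₀ V₁ W x)
  | zero => ‹Module.Finite k V₀›
  | one => ‹Module.Finite k V₁›
  | leaf _ => ‹Module.Finite k W›

variable {V₀ V₁ W}

/-- The linear maps of a representation with constant value at the leaves. -/
def maps (a : V₀ →ₗ[k] V₁) (b : Fin n → V₁ →ₗ[k] W) : ∀ x y : Dandelion n,
    spaces V₀ V₁ W x →ₗ[k] spaces V₀ V₁ W y
  | zero, zero => LinearMap.id (M := V₀)
  | zero, one => a
  | zero, leaf j => b j ∘ₗ a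
  | one, one => LinearMap.id (M := V₁)
  | one, leaf j => b j
  | leaf _, leaf _ => LinearMap.id (M := W)
  -- No morphism goes downwards, so this value and the two below play no role.
  | one, zero => 0
  | leaf _, zero => 0
  | leaf _, one => 0

/-- A representation with constant value at the leaves. -/
def mkRep (a : V₀ →ₗ[k] V₁) (b : Fin n → V₁ →ₗ[k] W) : Rep k (Dandelion n) :=
  repMk (spaces V₀ V₁ W) (fun {x y} _ => maps a b x y)
    (fun x => by cases x <;> rfl)
    (fun {x y z} f g => by
      have hf := leOfHom f
      have hg := leOfHom g
      cases x <;> cases y <;> cases z <;> first | rfl | (cases hf; done) | (cases hg; done) | (cases hg; rfl))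

end Construction

variable (k : Type u) [Field k] {n : ℕ}

/-- The leaf maps of the members of an infinite family of indecomposables. -/
def familyMap {W : Type u} [AddCommGroup W] [Module k W] (J : W →ₗ[k] W) (j : Fin n) :
    W × W →ₗ[k] W :=
  if j.val = 0 then LinearMap.fst k W W
  else if j.val = 1 then LinearMap.fst k W W - LinearMap.snd k W W
  else LinearMap.snd k W W - J ∘ₗ LinearMap.fst k W W

/-- An infinite family of indecomposables in the presence of three leaves. -/
def family {W : Type u} [AddCommGroup W] [Module k W] [Module.Finite k W] (J : W →ₗ[k] W) :
    Rep k (Dandelion n) :=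
  mkRep (LinearMap.inl k W W) (familyMap k J)

/-- Four subspaces of `W × W` are at work: the image `W × 0` of the minimum, and the kernels `0 ×
W`, the diagonal and the graph of `J` of the leaf maps. Preserving the first three forces an
endomorphism to be `φ × φ`, and preserving the graph makes `φ` commute with `J`. -/
theorem family_indecomposable (hn : 3 ≤ n) {W : Type u} [AddCommGroup W] [Module k W]
    [Module.Finite k W] [Nontrivial W] (J : W →ₗ[k] W)
    (hJ : ∀ φ : W →ₗ[k] W, (∀ x, φ (J x) = J (φ x)) → (∀ x, φ (φ x) = φ x) →
      φ = 0 ∨ φ = LinearMap.id) : Indecomposable (family k J : Rep k (Dandelion n)) := by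
  refine indecomposable_of_idempotent (fun h => ?_) fun e he => ?_
  · have : Subsingleton W := (Rep.isZero_iff _).1 h zero
    exact not_subsingleton W this
  let φ : W →ₗ[k] W := app e zero
  let ψ : W × W →ₗ[k] W × W := app e one
  let l (j : Fin n) : W →ₗ[k] W := app e (leaf j)
  have h1 (u : W) : ψ (u, 0) = (φ u, 0) := app_lin e (homOfLE zero_lt_one.le) u
  have h2 (j : Fin n) (u : W × W) : l j (familyMap k J j u) = familyMap k J j (ψ u) :=
    app_lin e (homOfLE (one_lt_leaf j).le) u
  have h3 (u : W × W) : ψ u = (φ u.1, 0) + ψ (0, u.2) := by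
    rw [← h1, ← map_add]
    simp
  have hb0 := h2 ⟨0, by lia⟩
  have hb1 := h2 ⟨1, by lia⟩
  have hb2 := h2 ⟨2, by lia⟩
  simp only [familyMap] at hb0 hb1 hb2
  simp at hb0 hb1 hb2
  have h4 (u : W) : ψ (0, u) = (0, φ u) := by
    have e1 := hb0 0 u
    rw [map_zero] at e1
    have e2 := hb1 u u
    rw [sub_self, h3] at e2
    simp [← e1] at e2
    exact Prod.ext e1.symm (sub_eq_zero.1 e2.symm).symm
  have h5 (u w : W) : ψ (u, w) = (φ u, φ w) := by
    rw [h3, h4]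
    simp
  have h6 (u : W) : φ (J u) = J (φ u) := by
    have := hb2 u (J u)
    rw [sub_self, h5] at this
    exact sub_eq_zero.1 this.symm
  -- Every leaf map is surjective, so the action on `W × W` determines the action at the leaves.
  have h7 (j : Fin n) : l j = φ := by
    ext u
    have e0 := h2 j (u, 0)
    have e1 := h2 j (0, u)
    have e2 := h2 j (0, -u)
    rw [h5] at e0 e1 e2
    unfold familyMap at e0 e1 e2
    split_ifs at e0 e1 e2
    · simpa using e0
    · simpa using e2
    · simpa using e1
  have h8 (u : W) : φ (φ u) = φ u := DFunLike.congr_fun (congrArg (fun t => app t zero) he) u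
  rcases hJ φ h6 h8 with h | h
  · left
    refine Rep.hom_ext fun x => ?_
    match x with
    | zero => exact h
    | one =>
      refine LinearMap.ext fun (u : W × W) => ?_
      refine (h5 u.1 u.2).trans ?_
      rw [h]
      rfl
    | leaf j => exact (h7 j).trans h
  · right
    refine Rep.hom_ext fun x => ?_
    match x with
    | zero => exact h
    | one =>
      refine LinearMap.ext fun (u : W × W) => ?_
      refine (h5 u.1 u.2).trans ?_
      rw [h]
      rfl
    | leaf j => exact (h7 j).trans h

open Polynomial in
theorem infinite_indecAtZero (hn : 3 ≤ n) : Infinite (IndecAtZero k n) := by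
  have hX (d : ℕ) : (X ^ (d + 1) : k[X]) ≠ 0 := pow_ne_zero _ X_ne_zero
  have hfin (d : ℕ) : Module.Finite k (AdjoinRoot (X ^ (d + 1) : k[X])) :=
    (AdjoinRoot.powerBasis (hX d)).finite
  have hrk (d : ℕ) : Module.finrank k (AdjoinRoot (X ^ (d + 1) : k[X])) = d + 1 := by
    rw [(AdjoinRoot.powerBasis (hX d)).finrank, AdjoinRoot.powerBasis_dim, natDegree_X_pow]
  have hnt (d : ℕ) : Nontrivial (AdjoinRoot (X ^ (d + 1) : k[X])) :=
    Module.nontrivial_of_finrank_pos (R := k) (by rw [hrk]; lia)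
  -- One nilpotent Jordan block of each positive size; the dimension at the minimum tells the
  -- members apart.
  let J (d : ℕ) : AdjoinRoot (X ^ (d + 1) : k[X]) →ₗ[k] AdjoinRoot (X ^ (d + 1) : k[X]) :=
    LinearMap.mulLeft k (AdjoinRoot.root _)
  have hind (d : ℕ) : Indecomposable (family k (J d) : Rep k (Dandelion n)) :=
    family_indecomposable k hn (J d) fun φ h h' => endo_idempotent irreducible_X (d + 1) φ h h'
  refine Infinite.of_injective (fun d : ℕ => (⟨IsoClass.mk (family k (J d)), _, rfl, hind d,
    fun h => not_subsingleton (AdjoinRoot (X ^ (d + 1) : k[X]))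
      ((isZero_fgModule_iff _).1 h)⟩ : IndecAtZero k n)) fun d d' h => ?_
  obtain ⟨e⟩ := IsoClass.exact (congrArg (fun c : IndecAtZero k n => c.1) h)
  have h1 : Module.finrank k (AdjoinRoot (X ^ (d + 1) : k[X])) =
      Module.finrank k (AdjoinRoot (X ^ (d' + 1) : k[X])) := (isoApp e zero).finrank_eq
  rw [hrk, hrk] at h1
  lia

/-- The supports of the thin indecomposables that do not vanish at `1`. -/
def supp (S : Set (Fin n)) : Dandelion n → Prop
  | zero => True
  | one => True
  | leaf j => j ∈ S

theorem supp_convex (S : Set (Fin n)) {x y z : Dandelion n} (f : x ⟶ y) (g : y ⟶ z)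
    (hx : supp S x) (hz : supp S z) : supp S y := by
  rcases y with _ | _ | j
  · trivial
  · trivial
  · rw [(leaf_le_iff j _).1 (leOfHom g)] at hz
    exact hz

theorem eq_zero_convex {x y z : Dandelion n} (f : x ⟶ y) (g : y ⟶ z) (hx : x = zero)
    (hz : z = zero) : y = zero := by
  have h := leOfHom g
  rw [hz] at h
  exact le_antisymm h (Dandelion.Le.zero_le _)

/-! ### Summands generated by a vector at the minimum, and the case of two leaves. -/

variable {k}

theorem lin_self (M : Rep k (Dandelion n)) {x : Dandelion n} (f : x ⟶ x) (v : M.obj x) :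
    lin M f v = v := by
  rw [lin_thin M f (𝟙 x), lin_id]
  rfl

/-- The map from the minimum to a given element. -/
def start (M : Rep k (Dandelion n)) (x : Dandelion n) : M.obj zero →ₗ[k] M.obj x :=
  lin M (homOfLE (Dandelion.Le.zero_le x))

/-- The map from `1` to a leaf. -/
def branch (M : Rep k (Dandelion n)) (j : Fin n) : M.obj one →ₗ[k] M.obj (leaf j) :=
  lin M (homOfLE (Dandelion.Le.one_le_leaf j))

theorem lin_start (M : Rep k (Dandelion n)) {x y : Dandelion n} (f : x ⟶ y) (v) :
    lin M f (start M x v) = start M y v :=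
  (lin_comp_apply M _ f v).symm

theorem branch_start (M : Rep k (Dandelion n)) (j : Fin n) (v) :
    branch M j (start M one v) = start M (leaf j) v :=
  lin_start M _ v

/-- A vector that dies at `one` spans a copy of the simple representation at the minimum. Any
functional normalised on it gives a retraction, because nothing else maps into the minimum. -/
theorem iso_zero (M : Rep k (Dandelion n)) (hM : Indecomposable M) (v : M.obj zero) (hv : v ≠ 0)
    (h : start M one v = 0) : Nonempty (M ≅ indRep k (fun x => x = zero) eq_zero_convex) := by
  obtain ⟨φ, hφ⟩ := Module.Projective.exists_dual_eq_one k hv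
  obtain ⟨i, r, hir⟩ := indRep_retract (fun x : Dandelion n => x = zero) eq_zero_convex M
    (fun x => start M x v) (fun | zero => φ | one => 0 | leaf _ => 0)
    (fun g _ _ => lin_start M g v)
    (fun {x y} g _ hy => by
      rw [lin_start]
      rcases y with _ | _ | j
      · exact (hy rfl).elim
      · exact h
      · rw [← branch_start, h, map_zero])
    (fun {x y} g hx hy v => by
      subst hx hy
      rw [lin_self])
    (fun {x y} g hx hy => by
      have h' := leOfHom g
      rw [hy] at h'
      exact (hx (le_antisymm h' (Dandelion.Le.zero_le _))).elim)
    (fun x hx => by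
      subst hx
      exact (congrArg φ (lin_self M _ v)).trans hφ)
  exact iso_of_retract_indecomposable hM
    (indRep_not_isZero k _ eq_zero_convex (x := (zero : Dandelion n)) rfl) i r hir

/-- Outside the sum of kernels there is a functional at `one` that is 1 on the image of `v` and
factors through every leaf where `v` survives. With `v` it splits off a thin representation. -/
theorem iso_supp (M : Rep k (Dandelion n)) (hM : Indecomposable M) (v : M.obj zero)
    (h : start M one v ∉ ⨆ j ∈ {j | start M (leaf j) v ≠ 0}, LinearMap.ker (branch M j)) :
    Nonempty (M ≅ indRep k (supp {j | start M (leaf j) v ≠ 0}) (supp_convex _)) := by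
  set S := {j | start M (leaf j) v ≠ 0} with hS
  obtain ⟨ψ, hψ⟩ : ∃ ψ : M.obj one →ₗ[k] k, ψ (start M one v) = 1 ∧
      ∀ j ∈ S, LinearMap.ker (branch M j) ≤ LinearMap.ker ψ := by
    obtain ⟨φ, hφ⟩ := Module.Projective.exists_dual_eq_one k
      (fun h' => h ((Submodule.Quotient.mk_eq_zero _).1 h'))
    refine ⟨φ ∘ₗ Submodule.mkQ _, hφ, fun j hj x hx => ?_⟩
    have : Submodule.Quotient.mk (p := ⨆ j ∈ S, LinearMap.ker (branch M j)) x = 0 :=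
      (Submodule.Quotient.mk_eq_zero _).2 (le_iSup₂ (f := fun j (_ : j ∈ S) =>
        LinearMap.ker (branch M j)) j hj hx)
    exact (congrArg φ this).trans (map_zero φ)
  have hfac (j : Fin n) : ∃ f : M.obj (leaf j) →ₗ[k] k, j ∈ S → f ∘ₗ branch M j = ψ := by
    by_cases hj : j ∈ S
    · have : ψ ∈ LinearMap.range (branch M j).dualMap := by
        rw [LinearMap.range_dualMap_eq_dualAnnihilator_ker, Submodule.mem_dualAnnihilator]
        exact hψ.2 j hj
      obtain ⟨f, hf⟩ := this
      exact ⟨f, fun _ => hf⟩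
    · exact ⟨0, fun h => (hj h).elim⟩
  choose f hf using hfac
  obtain ⟨i, r, hir⟩ := indRep_retract (supp S) (supp_convex S) M
    (fun x => start M x v) (fun | zero => ψ ∘ₗ start M one | one => ψ | leaf j => f j)
    (fun g _ _ => lin_start M g v)
    (fun {x y} g _ hy => by
      rw [lin_start]
      rcases y with _ | _ | j
      · exact (hy trivial).elim
      · exact (hy trivial).elim
      · exact not_not.1 hy)
    (fun {x y} g hx hy v => by
      have h' := leOfHom g
      rcases lt_or_eq_of_le h' with h' | h'
      · rcases lt_cases h' with ⟨rfl, rfl⟩ | ⟨j, rfl, rfl⟩ | ⟨j, rfl, rfl⟩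
        · rfl
        · change f j (start M (leaf j) v) = ψ (start M one v)
          rw [← branch_start, ← hf j hy]
          rfl
        · exact DFunLike.congr_fun (hf j hy) v
      · subst h'
        rw [lin_self])
    (fun {x y} g hx hy => by
      have h' := leOfHom g
      rcases lt_or_eq_of_le h' with h' | h'
      · rcases lt_cases h' with ⟨rfl, rfl⟩ | ⟨j, rfl, rfl⟩ | ⟨j, rfl, rfl⟩ <;> exact (hx trivial).elim
      · subst h'
        exact (hx hy).elim)
    (fun x hx => by
      rcases x with _ | _ | j
      · exact (congrArg (fun t => ψ (start M one t)) (lin_self M _ v)).trans hψ.1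
      · exact hψ.1
      · change f j (start M (leaf j) v) = 1
        rw [← branch_start, ← hψ.1, ← hf j hx]
        rfl)
  exact iso_of_retract_indecomposable hM
    (indRep_not_isZero k _ (supp_convex S) (x := (zero : Dandelion n)) trivial) i r hir

variable (k) in
/-- The indecomposable with a plane at `1`. -/
def plane : Rep k (Dandelion 2) :=
  mkRep (V₀ := k) (V₁ := k × k) (W := k) (LinearMap.id.prod LinearMap.id)
    ![LinearMap.fst k k k, LinearMap.snd k k k]

theorem plane_not_isZero : ¬ IsZero (plane k) := fun h => by
  have : Subsingleton k := (Rep.isZero_iff _).1 h zero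
  exact not_subsingleton k this

/-- The components `a` and `b` of the image of `v` at `one` each survive at exactly one leaf, so
they play the coordinate vectors of the plane. The functionals `f` supply the retraction. -/
theorem iso_plane (M : Rep k (Dandelion 2)) (hM : Indecomposable M) (v : M.obj zero)
    (a b : M.obj one) (hab : start M one v = a + b) (ha : branch M 1 a = 0) (hb : branch M 0 b = 0)
    (f : ∀ j, M.obj (leaf j) →ₗ[k] k) (hf : f 0 ∘ₗ start M (leaf 0) = f 1 ∘ₗ start M (leaf 1))
    (hfv : f 0 (start M (leaf 0) v) = 1) : Nonempty (M ≅ plane k) := by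
  have ha1 : f 0 (branch M 0 a) = 1 := by
    rw [← hfv, ← branch_start, hab, map_add, hb, add_zero]
  have hb1 : f 1 (branch M 1 b) = 1 := by
    have h1 : f 1 (start M (leaf 1) v) = 1 := (DFunLike.congr_fun hf v).symm.trans hfv
    rw [← h1, ← branch_start, hab, map_add, ha, zero_add]
  let i : plane k ⟶ M := homMk (M := plane k) (fun
    | zero => LinearMap.toSpanSingleton k (M.obj zero) v
    | one => (LinearMap.toSpanSingleton k (M.obj one) a).coprod
        (LinearMap.toSpanSingleton k (M.obj one) b)
    | leaf j => LinearMap.toSpanSingleton k (M.obj (leaf j)) (start M (leaf j) v))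
    (fun {x y} g u => by
      rcases lt_or_eq_of_le (leOfHom g) with h' | rfl
      · rcases lt_cases h' with ⟨rfl, rfl⟩ | ⟨j, rfl, rfl⟩ | ⟨j, rfl, rfl⟩
        · change k at u
          change u • a + u • b = start M one (u • v)
          rw [map_smul, hab, smul_add]
        · change k at u
          fin_cases j
          · exact (map_smul (start M (leaf 0)) u v).symm
          · exact (map_smul (start M (leaf 1)) u v).symm
        · change k × k at u
          fin_cases j
          · change u.1 • start M (leaf 0) v = branch M 0 (u.1 • a + u.2 • b)
            rw [← branch_start, hab]
            simp [hb]
          · change u.2 • start M (leaf 1) v = branch M 1 (u.1 • a + u.2 • b)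
            rw [← branch_start, hab]
            simp [ha]
      · rw [lin_self, lin_self])
  let r : M ⟶ plane k := homMk (N := plane k) (fun
    | zero => f 0 ∘ₗ start M (leaf 0)
    | one => (f 0 ∘ₗ branch M 0).prod (f 1 ∘ₗ branch M 1)
    | leaf j => f j)
    (fun {x y} g u => by
      rcases lt_or_eq_of_le (leOfHom g) with h' | rfl
      · rcases lt_cases h' with ⟨rfl, rfl⟩ | ⟨j, rfl, rfl⟩ | ⟨j, rfl, rfl⟩
        · refine Prod.ext ?_ ?_
          · change f 0 (branch M 0 (start M one u)) = f 0 (start M (leaf 0) u)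
            rw [branch_start]
          · change f 1 (branch M 1 (start M one u)) = f 0 (start M (leaf 0) u)
            rw [branch_start]
            exact (DFunLike.congr_fun hf u).symm
        · fin_cases j
          · rfl
          · exact (DFunLike.congr_fun hf u).symm
        · fin_cases j <;> rfl
      · rw [lin_self, lin_self])
  have hfv' : f 1 (start M (leaf 1) v) = 1 := (DFunLike.congr_fun hf v).symm.trans hfv
  refine iso_of_retract_indecomposable hM plane_not_isZero i r (Rep.hom_ext fun x => ?_)
  match x with
  | zero =>
    refine LinearMap.ext fun (u : k) => ?_
    change f 0 (start M (leaf 0) (u • v)) = u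
    rw [map_smul, map_smul, hfv, smul_eq_mul, mul_one]
  | one =>
    refine LinearMap.ext fun (u : k × k) => Prod.ext ?_ ?_
    · change f 0 (branch M 0 (u.1 • a + u.2 • b)) = u.1
      simp [ha1, hb]
    · change f 1 (branch M 1 (u.1 • a + u.2 • b)) = u.2
      simp [hb1, ha]
  | leaf j =>
    refine LinearMap.ext fun (u : k) => ?_
    change f j (u • start M (leaf j) v) = u
    fin_cases j
    · simp [hfv]
    · simp [hfv']

/-- If no vector at the minimum splits off a thin summand, then every nonzero vector survives at
both leaves while its image at `one` lies in the sum of the two kernels; this is the configuration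
of the plane. -/
theorem classification (M : Rep k (Dandelion 2)) (hM : Indecomposable M)
    (h0 : ¬ IsZero (M.obj zero)) :
    Nonempty (M ≅ indRep k (fun x => x = zero) eq_zero_convex) ∨
    (∃ S : Set (Fin 2), Nonempty (M ≅ indRep k (supp S) (supp_convex S))) ∨
    Nonempty (M ≅ plane k) := by
  rw [isZero_fgModule_iff, not_subsingleton_iff_nontrivial] at h0
  by_cases h1 : ∃ v : M.obj zero, v ≠ 0 ∧ start M one v = 0
  · obtain ⟨v, hv, hv0⟩ := h1
    exact Or.inl (iso_zero M hM v hv hv0)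
  by_cases h2 : ∃ v : M.obj zero,
      start M one v ∉ ⨆ j ∈ {j | start M (leaf j) v ≠ 0}, LinearMap.ker (branch M j)
  · obtain ⟨v, hv⟩ := h2
    exact Or.inr (Or.inl ⟨_, iso_supp M hM v hv⟩)
  push Not at h1 h2
  -- If `v` dies at `j`, its image at `one` lies in the kernel towards the other leaf, so `v` dies
  -- there too. The supremum is then empty and `v` dies at `one`, which is excluded.
  have h3 (v : M.obj zero) (hv : v ≠ 0) (j : Fin 2) : start M (leaf j) v ≠ 0 := fun hj => by
    have h4 (i : Fin 2) : start M (leaf i) v = 0 := by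
      by_cases hi : i = j
      · rw [hi, hj]
      · have h5 : ⨆ j ∈ {j | start M (leaf j) v ≠ 0}, LinearMap.ker (branch M j) ≤
            LinearMap.ker (branch M i) := iSup₂_le fun l hl => by
          have hlj : l ≠ j := fun h => hl (h ▸ hj)
          rw [show l = i by lia]
        rw [← branch_start]
        exact h5 (h2 v)
    have h5 : ⨆ j ∈ {j | start M (leaf j) v ≠ 0}, LinearMap.ker (branch M j) ≤ ⊥ :=
      iSup₂_le fun l hl => (hl (h4 l)).elim
    exact h1 v hv (h5 (h2 v))
  obtain ⟨v, hv⟩ := exists_ne (0 : M.obj zero)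
  have h4 : ⨆ j ∈ {j | start M (leaf j) v ≠ 0}, LinearMap.ker (branch M j) ≤
      LinearMap.ker (branch M 0) ⊔ LinearMap.ker (branch M 1) := iSup₂_le fun l _ => by
    fin_cases l
    · exact le_sup_left
    · exact le_sup_right
  obtain ⟨b, hb, a, ha, hab⟩ := Submodule.mem_sup.1 (h4 (h2 v))
  obtain ⟨ψ, hψ⟩ := Module.Projective.exists_dual_eq_one k hv
  -- Left inverses of the injections into the two leaves make both functionals restrict to the same
  -- `ψ` at the minimum.
  have h5 (j : Fin 2) : ∃ g : M.obj (leaf j) →ₗ[k] M.obj zero, g ∘ₗ start M (leaf j) = LinearMap.id :=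
    LinearMap.exists_leftInverse_of_injective _ (LinearMap.ker_eq_bot'.2 fun u hu => by
      by_contra hu0
      exact h3 u hu0 j hu)
  choose g hg using h5
  refine Or.inr (Or.inr (iso_plane M hM v a b (by rw [← hab, add_comm]) ha hb (fun j => ψ ∘ₗ g j) ?_ ?_))
  · rw [LinearMap.comp_assoc, LinearMap.comp_assoc, hg, hg]
  · exact (congrArg ψ (DFunLike.congr_fun (hg 0) v)).trans hψ

variable (k) in
theorem finite_indecAtZero : Finite (IndecAtZero k 2) := by
  let c : Option (Option (Set (Fin 2))) → IsoClass (Rep k (Dandelion 2))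
    | none => IsoClass.mk (plane k)
    | some none => IsoClass.mk (indRep k (fun x => x = zero) eq_zero_convex)
    | some (some S) => IsoClass.mk (indRep k (supp S) (supp_convex S))
  refine ((Set.finite_range c).subset ?_).to_subtype
  rintro _ ⟨M, rfl, hM, h0⟩
  rcases classification M hM h0 with ⟨⟨e⟩⟩ | ⟨S, ⟨e⟩⟩ | ⟨⟨e⟩⟩
  · exact ⟨some none, (IsoClass.sound e).symm⟩
  · exact ⟨some (some S), (IsoClass.sound e).symm⟩
  · exact ⟨none, (IsoClass.sound e).symm⟩

variable (k) in
theorem fg_iff (hn : 2 ≤ n) : AddGroup.FG (H k (G (Dandelion n)) 0) ↔ n ≤ 2 := by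
  let e := (hZeroEquiv k _).trans (cocyclesEquiv k (⟨0, by lia⟩ : Fin n))
  have h1 : AddGroup.FG (H k (G (Dandelion n)) 0) ↔ AddGroup.FG (IndecAtZero k n →₀ ℤ) :=
    ⟨fun _ => AddGroup.fg_of_surjective (f := e.toAddMonoidHom) e.surjective,
     fun _ => AddGroup.fg_of_surjective (f := e.symm.toAddMonoidHom) e.symm.surjective⟩
  rw [h1, ← Module.Finite.iff_addGroup_fg, Module.finite_finsupp_self_iff]
  constructor
  · intro h
    by_contra h2
    have := infinite_indecAtZero k (n := n) (by lia)
    rcases h with h | h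
    · exact not_subsingleton ℤ h
    · exact not_finite (IndecAtZero k n)
  · intro h
    obtain rfl : n = 2 := by lia
    exact Or.inr (finite_indecAtZero k)

end Dandelion

end

end RepCoh

namespace RepCoh

noncomputable section

/-! ### Degree zero cohomology of the simplicial envelope -/

namespace Etilde

section Functors

variable (C : Type w) [Category.{v} C]

/-- The degenerate edges. -/
def idEdge : C ⥤ (Etilde C).Level 1 where
  obj c := ⟨ComposableArrows.mk₁ (𝟙 c), trivial⟩
  map f := ⟨ComposableArrows.homMk₁ f f ((Category.id_comp f).trans (Category.comp_id f).symm), trivial⟩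
  map_id c := Subtype.ext (ComposableArrows.hom_ext₁ rfl rfl)
  map_comp f g := Subtype.ext (ComposableArrows.hom_ext₁ rfl rfl)

/-- The source of an edge. -/
def source : (Etilde C).Level 1 ⥤ C where
  obj x := x.val.obj 0
  map f := f.1.app 0

/-- The target of an edge. -/
def target : (Etilde C).Level 1 ⥤ C where
  obj x := x.val.obj 1
  map f := f.1.app 1

variable {C}

/-- The morphism from the degenerate edge at the source. -/
def fromSource (a : (Etilde C).Level 1) : (idEdge C).obj (a.val.obj 0) ⟶ a :=
  ⟨ComposableArrows.homMk₁ (𝟙 _) (a.val.map' 0 1) (by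
    change 𝟙 _ ≫ _ = 𝟙 _ ≫ _
    rfl), trivial⟩

/-- The morphism to the degenerate edge at the target. -/
def toTarget (a : (Etilde C).Level 1) : a ⟶ (idEdge C).obj (a.val.obj 1) :=
  ⟨ComposableArrows.homMk₁ (a.val.map' 0 1) (𝟙 _) (by
    change _ ≫ 𝟙 _ = _ ≫ 𝟙 _
    rfl), trivial⟩

end Functors

variable {k : Type u} [Field k] {C : Type w} [Category.{v} C]

/-- The functor `idEdge` is left adjoint to `source` with counit `fromSource`, so a morphism out of
a pullback along `source` is determined on degenerate edges. -/
theorem app_source {X : Rep k C} {R : Rep k ((Etilde C).Level 1)}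
    (γ : (Rep.res k (source C)).obj X ⟶ R) (a : (Etilde C).Level 1) (v : X.obj (a.val.obj 0)) :
    app γ a v = lin R (fromSource a) (app γ ((idEdge C).obj (a.val.obj 0)) v) := by
  have h := app_lin γ (fromSource a) v
  rw [← h]
  congr 1
  exact (DFunLike.congr_fun (lin_id X _) v).symm

/-- Dually, `toTarget` is the unit of the adjunction between `target` and its right adjoint
`idEdge`. -/
theorem app_target {X : Rep k C} {R : Rep k ((Etilde C).Level 1)}
    (γ : R ⟶ (Rep.res k (target C)).obj X) (a : (Etilde C).Level 1) (v : R.obj a) :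
    app γ a v = app γ ((idEdge C).obj (a.val.obj 1)) (lin R (toTarget a) v) := by
  have h := app_lin γ (toTarget a) v
  rw [h]
  exact (DFunLike.congr_fun (lin_id X _) (app γ a v)).symm

theorem source_hom_ext {X : Rep k C} {R : Rep k ((Etilde C).Level 1)}
    {γ δ : (Rep.res k (source C)).obj X ⟶ R}
    (h : ∀ c, app γ ((idEdge C).obj c) = app δ ((idEdge C).obj c)) : γ = δ :=
  Rep.hom_ext fun a => LinearMap.ext fun v => by
    refine (app_source γ a v).trans (Eq.trans ?_ (app_source δ a v).symm)
    rw [h]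

/-- Only the objects of `C` enter the bound. A path category may have infinitely many edges, so
finiteness of the category of edges is not available. -/
instance [Finite C] (X : Rep k C) (R : Rep k ((Etilde C).Level 1)) :
    Module.Finite k ((Rep.res k (source C)).obj X ⟶ R) := by
  let φ : ((Rep.res k (source C)).obj X ⟶ R) →ₗ[k]
      (∀ c : C, X.obj c →ₗ[k] R.obj ((idEdge C).obj c)) :=
    { toFun := fun f c => app f ((idEdge C).obj c)
      map_add' := fun _ _ => rfl
      map_smul' := fun _ _ => rfl }
  exact Module.Finite.of_injective φ fun f g h => source_hom_ext fun c => congrFun h c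

/-- The restriction of an endomorphism to degenerate edges. -/
def atId {M N : Rep k ((Etilde C).Level 1)} (γ : M ⟶ N) :
    (Rep.res k (idEdge C)).obj M ⟶ (Rep.res k (idEdge C)).obj N := (Rep.res k (idEdge C)).map γ

/-- Restriction to degenerate edges embeds the endomorphisms of the pullback into those of `X`. -/
theorem isLocalObj_source [Finite C] {X : Rep k C} (hX : Indecomposable X) :
    IsLocalObj ((Rep.res k (source C)).obj X) := by
  refine isLocalObj_of_idempotent k (fun h => hX.1 ?_) fun p hp => ?_
  · rw [Rep.isZero_iff] at h ⊢
    exact fun c => h ((idEdge C).obj c)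
  · let q : X ⟶ X := atId p
    have hq : q ≫ q = q := congrArg atId hp
    rcases idempotent_of_indecomposable hX q hq with h | h
    · exact Or.inl (source_hom_ext fun c => congrArg (fun t => app t c) h)
    · exact Or.inr (source_hom_ext fun c => congrArg (fun t => app t c) h)

/-- A representation in which all morphisms act invertibly. -/
def _root_.RepCoh.IsLocalSystem (M : Rep k C) : Prop :=
  ∀ ⦃x y : C⦄ (f : x ⟶ y), Function.Bijective (lin M f)

theorem _root_.RepCoh.IsLocalSystem.of_iso {M N : Rep k C} (h : IsLocalSystem M) (e : M ≅ N) :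
    IsLocalSystem N := fun x y f => by
  have h1 : ⇑(lin N f) = isoApp e y ∘ lin M f ∘ (isoApp e x).symm := by
    funext v
    obtain ⟨v, rfl⟩ := (isoApp e x).surjective v
    simp only [Function.comp_apply, LinearEquiv.symm_apply_apply]
    exact (app_lin e.hom f v).symm
  rw [h1]
  exact (isoApp e y).bijective.comp ((h f).comp (isoApp e x).symm.bijective)

/-- On degenerate edges `f` and `g` are bijective by finite dimension. At any edge, `g` followed by
`f` is governed by its target, hence bijective, and so `f` is bijective at that edge. There `f` is
its value at the source followed by the action of the edge, so the edge acts bijectively. -/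
theorem isLocalSystem_of_retract (X : Rep k C)
    (f : (Rep.res k (source C)).obj X ⟶ (Rep.res k (target C)).obj X)
    (g : (Rep.res k (target C)).obj X ⟶ (Rep.res k (source C)).obj X) (h : IsIso (f ≫ g)) :
    IsLocalSystem X := by
  have h1 (a : (Etilde C).Level 1) : Function.Bijective (app g a ∘ app f a) :=
    (isoApp (asIso (f ≫ g)) a).bijective
  let f' (c : C) : X.obj c →ₗ[k] X.obj c := app f ((idEdge C).obj c)
  let g' (c : C) : X.obj c →ₗ[k] X.obj c := app g ((idEdge C).obj c)
  have h2 (c : C) : Function.Bijective (f' c) := by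
    have : Function.Injective (f' c) := (h1 ((idEdge C).obj c)).injective.of_comp
    exact ⟨this, LinearMap.injective_iff_surjective.1 this⟩
  have h3 (c : C) : Function.Bijective (g' c) := by
    have : Function.Surjective (g' c) := (h1 ((idEdge C).obj c)).surjective.of_comp
    exact ⟨LinearMap.injective_iff_surjective.2 this, this⟩
  have h4 (a : (Etilde C).Level 1) (v : X.obj (a.val.obj 1)) :
      app f a (app g a v) = f' _ (g' _ v) := by
    have := app_target (g ≫ f) a v
    refine this.trans ?_
    change f' _ (g' _ (lin X (𝟙 _) v)) = _
    rw [lin_id]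
    rfl
  have h5 (a : (Etilde C).Level 1) : Function.Bijective (app f a) := by
    refine ⟨(h1 a).injective.of_comp, fun v => ?_⟩
    obtain ⟨u, rfl⟩ := ((h2 _).comp (h3 _)).surjective v
    exact ⟨_, h4 a u⟩
  intro x y φ
  let a : (Etilde C).Level 1 := ⟨ComposableArrows.mk₁ φ, trivial⟩
  have h6 : ⇑(app f a) = lin X φ ∘ f' x := funext fun v => app_source f a v
  have h7 := h5 a
  rw [h6] at h7
  exact (Function.Bijective.of_comp_iff _ (h2 x)).1 h7

/-- A local system has isomorphic pullbacks along source and target. -/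
def sourceIsoTarget {X : Rep k C} (hX : IsLocalSystem X) :
    (Rep.res k (source C)).obj X ≅ (Rep.res k (target C)).obj X :=
  isoMk (M := (Rep.res k (source C)).obj X) (N := (Rep.res k (target C)).obj X)
    (fun a => LinearEquiv.ofBijective (lin X (a.val.map' 0 1)) (hX _)) (fun {a b} g v => by
      exact (lin_comp_apply X (g.1.app 0) (b.val.map' 0 1) v).symm.trans
        ((congrArg (fun t => lin X t v) (g.1.naturality _).symm).trans
          (lin_comp_apply X (a.val.map' 0 1) (g.1.app 1) v)))

variable (k)

theorem mem_cocycles_iff (x : Gr (Rep k C)) :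
    Gr.map (Rep.res k (evZero (Etilde C))) x ∈ cocycles k (Etilde C) 0 ↔
      Gr.map (Rep.res k (source C)) x = Gr.map (Rep.res k (target C)) x := by
  have h1 : (coface k (Etilde C) 0 0).comp (Gr.map (Rep.res k (evZero (Etilde C)))) =
      Gr.map (Rep.res k (target C)) := Gr.hom_ext fun M => by
    rw [AddMonoidHom.comp_apply, Gr.map_cls, coface, Gr.map_cls, Gr.map_cls]
    rfl
  have h2 : (coface k (Etilde C) 0 1).comp (Gr.map (Rep.res k (evZero (Etilde C)))) =
      Gr.map (Rep.res k (source C)) := Gr.hom_ext fun M => by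
    rw [AddMonoidHom.comp_apply, Gr.map_cls, coface, Gr.map_cls, Gr.map_cls]
    rfl
  rw [mem_cocycles_zero, ← h1, ← h2, eq_comm]
  rfl

variable (C)

/-- The isomorphism classes of indecomposable local systems. -/
abbrev IndLocal : Type _ := {I : Ind (Rep k C) // IsLocalSystem I.out}

variable {C}

variable [Finite C]

/-- Compare the multiplicities of the source pullback of `J` on both sides. On the left only `J`
contributes; on the right an `I ≠ J` contributes nothing, since on degenerate edges `J` would be a
retract of `I`, and `J` itself contributes only if it is a local system. -/
theorem isLocalSystem_of_mem (f : Ind (Rep k C) →₀ ℤ)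
    (h : Gr.map (Rep.res k (source C)) (ksHom f) = Gr.map (Rep.res k (target C)) (ksHom f))
    (J : Ind (Rep k C)) (hJ : f J ≠ 0) : IsLocalSystem J.out := by
  by_contra hloc
  have hZ := isLocalObj_source J.indecomposable
  have h1 := congrArg (mult k hZ) h
  change mult k hZ (Gr.map _ (Finsupp.linearCombination ℤ _ f)) =
    mult k hZ (Gr.map _ (Finsupp.linearCombination ℤ _ f)) at h1
  simp only [Finsupp.linearCombination_apply, Finsupp.sum, map_sum, map_zsmul, Gr.map_cls] at h1
  rw [Finset.sum_eq_single J, Finset.sum_eq_zero] at h1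
  · rw [smul_eq_zero] at h1
    exact h1.elim hJ (mult_cls_self k hZ)
  · intro I _
    rw [mult_cls_eq_zero, smul_zero]
    intro φ ψ hφψ
    by_cases hIJ : I = J
    · subst hIJ
      exact hloc (isLocalSystem_of_retract _ φ ψ hφψ)
    · have h2 : IsIso (atId (φ ≫ ψ)) := inferInstanceAs (IsIso ((Rep.res k (idEdge C)).map (φ ≫ ψ)))
      let φ' : J.out ⟶ I.out := atId φ
      let ψ' : I.out ⟶ J.out := atId ψ
      have h3 : IsIso (φ' ≫ ψ') := h2
      exact not_isIso_comp_of_indecomposable J.indecomposable I.indecomposable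
        ⟨fun e => hIJ (Ind.eq_of_iso e).symm⟩ φ' ψ' h3
  · intro I _ hIJ
    rw [mult_cls_eq_zero, smul_zero]
    intro φ ψ hφψ
    have h2 : IsIso (atId (φ ≫ ψ)) := inferInstanceAs (IsIso ((Rep.res k (idEdge C)).map (φ ≫ ψ)))
    let φ' : J.out ⟶ I.out := atId φ
    let ψ' : I.out ⟶ J.out := atId ψ
    have h3 : IsIso (φ' ≫ ψ') := h2
    exact not_isIso_comp_of_indecomposable J.indecomposable I.indecomposable
      ⟨fun e => hIJ (Ind.eq_of_iso e).symm⟩ φ' ψ' h3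
  · intro h2
    rw [Finsupp.notMem_support_iff.1 h2, zero_smul]

/-- The class of a combination of local systems. -/
def localHom : (IndLocal k C →₀ ℤ) →+ Gr (Rep k C) :=
  ksHom.comp (Finsupp.mapDomain.addMonoidHom Subtype.val)

theorem source_localHom (f : IndLocal k C →₀ ℤ) :
    Gr.map (Rep.res k (source C)) (localHom k f) = Gr.map (Rep.res k (target C)) (localHom k f) := by
  suffices h : (Gr.map (Rep.res k (source C))).comp (localHom k) =
      (Gr.map (Rep.res k (target C))).comp (localHom k) from DFunLike.congr_fun h f
  refine Finsupp.addHom_ext fun I n => ?_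
  change Gr.map _ (ksHom (Finsupp.mapDomain _ _)) = Gr.map _ (ksHom (Finsupp.mapDomain _ _))
  rw [Finsupp.mapDomain_single, ksHom_single, map_zsmul, map_zsmul, Gr.map_cls, Gr.map_cls,
    Gr.cls_iso (sourceIsoTarget I.2)]

/-- Degree zero cocycles of the simplicial envelope are combinations of local systems. -/
def cocyclesEquiv : (IndLocal k C →₀ ℤ) ≃+ cocycles k (Etilde C) 0 :=
  AddEquiv.ofBijective
    (((Gr.map (Rep.res k (evZero (Etilde C)))).comp (localHom k)).codRestrict _ fun f =>
      (mem_cocycles_iff k _).2 (source_localHom k f)) (by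
    have hinv := map_res_functor_inverse k
      (levelZeroEquiv (Etilde C) (fun _ => trivial) (fun _ _ _ => trivial))
    have hinv' := map_res_functor_inverse k
      (levelZeroEquiv (Etilde C) (fun _ => trivial) (fun _ _ _ => trivial)).symm
    constructor
    · intro f g h
      have h1 : Gr.map (Rep.res k (evZero (Etilde C))) (localHom k f) =
        Gr.map (Rep.res k (evZero (Etilde C))) (localHom k g) := congrArg Subtype.val h
      have h2 := Function.LeftInverse.injective (g := Gr.map (Rep.res k (ptZero (Etilde C)
        (fun _ => trivial) (fun _ _ _ => trivial)))) hinv' h1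
      exact Finsupp.mapDomain_injective Subtype.val_injective (ksHom_injective k h2)
    · rintro ⟨x, hx⟩
      obtain ⟨y, rfl⟩ : ∃ y, Gr.map (Rep.res k (evZero (Etilde C))) y = x := ⟨_, hinv x⟩
      obtain ⟨f, rfl⟩ := ksHom_surjective k y
      rw [mem_cocycles_iff] at hx
      have h1 := isLocalSystem_of_mem k f hx
      refine ⟨f.comapDomain Subtype.val Subtype.val_injective.injOn, Subtype.ext ?_⟩
      change Gr.map _ (ksHom (Finsupp.mapDomain _ _)) = _
      rw [Finsupp.mapDomain_comapDomain _ Subtype.val_injective]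
      intro J hJ
      exact ⟨⟨J, h1 J (Finsupp.mem_support_iff.1 hJ)⟩, rfl⟩)

end Etilde

end

end RepCoh

namespace RepCoh

noncomputable section

/-! ### Cyclic modules with an invertible action of the variable -/

section Cyclic

open Polynomial AdjoinRoot

variable {k : Type u} [Field k]

theorem isUnit_root {p : k[X]} (hp : Irreducible p) (h0 : p.coeff 0 ≠ 0) (m : ℕ) :
    IsUnit (root (p ^ m)) := by
  have h1 : IsCoprime X p := (Irreducible.coprime_iff_not_dvd irreducible_X).2 fun h =>
    h0 (X_dvd_iff.1 h)
  obtain ⟨a, b, hab⟩ := h1.pow_right (n := m)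
  have h2 := congrArg (mk (p ^ m)) hab
  rw [map_add, map_mul, map_mul, mk_self, mul_zero, add_zero, mk_X, map_one] at h2
  exact IsUnit.of_mul_eq_one_right _ h2

/-- If `p = X * q`, the class of `q * p ^ (m - 1)` is nonzero but is killed by the variable. -/
theorem coeff_zero_ne_zero {p : k[X]} (hp : Irreducible p) {m : ℕ} (hm : m ≠ 0)
    (h : Function.Injective fun x : AdjoinRoot (p ^ m) => root (p ^ m) * x) : p.coeff 0 ≠ 0 := by
  intro h0
  obtain ⟨q, hq⟩ := X_dvd_iff.2 h0
  obtain ⟨m, rfl⟩ := Nat.exists_eq_succ_of_ne_zero hm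
  have h1 : mk (p ^ (m + 1)) (q * p ^ m) = 0 := h (by
    change root _ * mk _ (q * p ^ m) = root _ * 0
    rw [mul_zero, ← mk_X, ← map_mul, ← mul_assoc, ← hq, ← pow_succ', mk_self])
  rw [mk_eq_zero, pow_succ'] at h1
  have h2 : p ∣ q := (mul_dvd_mul_iff_right (pow_ne_zero m hp.ne_zero)).1 h1
  rcases hp.isUnit_or_isUnit hq with h3 | h3
  · exact not_isUnit_X h3
  · exact hp.not_isUnit (isUnit_of_dvd_unit h2 h3)

/-- The polynomial `g` kills the target, hence the source, whose annihilator is generated by `f`. -/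
theorem pow_dvd_of_equiv {f g : k[X]} (φ : AdjoinRoot f ≃ₗ[k] AdjoinRoot g)
    (hφ : ∀ x, φ (root f * x) = root g * φ x) : f ∣ g := by
  rw [← mk_eq_zero, ← φ.map_eq_zero_iff]
  refine (hom_mk f g φ.toLinearMap hφ g).trans ?_
  rw [mk_self, zero_mul]

theorem eq_of_cyclic_equiv {p q : k[X]} (hp : Irreducible p) (hq : Irreducible q) (hpm : p.Monic)
    (hqm : q.Monic) {m l : ℕ} (hm : m ≠ 0) (φ : AdjoinRoot (p ^ m) ≃ₗ[k] AdjoinRoot (q ^ l))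
    (hφ : ∀ x, φ (root (p ^ m) * x) = root (q ^ l) * φ x) : p = q ∧ m = l := by
  have h1 := pow_dvd_of_equiv φ hφ
  have h2 := pow_dvd_of_equiv φ.symm fun x => by
    rw [LinearEquiv.symm_apply_eq, hφ, LinearEquiv.apply_symm_apply]
  have h3 : p ∣ q := hp.prime.dvd_of_dvd_pow ((dvd_pow_self p hm).trans h1)
  obtain rfl : p = q :=
    eq_of_monic_of_associated hpm hqm (hp.associated_of_dvd hq h3)
  have h4 : p ^ m = p ^ l :=
    eq_of_monic_of_associated (hpm.pow m) (hpm.pow l) (associated_of_dvd_dvd h1 h2)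
  have h5 := congrArg natDegree h4
  rw [natDegree_pow, natDegree_pow] at h5
  exact ⟨rfl, Nat.eq_of_mul_eq_mul_right hp.natDegree_pos h5⟩

/-- An invertible endomorphism of a nonzero space has a cyclic primary direct summand. -/
theorem exists_cyclic_summand {W : Type u} [AddCommGroup W] [Module k W] [Module.Finite k W]
    [Nontrivial W] (T : W →ₗ[k] W) : ∃ (p : k[X]) (m : ℕ) (_ : p.Monic) (_ : Irreducible p)
      (_ : m ≠ 0) (i : AdjoinRoot (p ^ m) →ₗ[k] W) (r : W →ₗ[k] AdjoinRoot (p ^ m)),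
      (∀ x, i (root (p ^ m) * x) = T (i x)) ∧ (∀ x, r (T x) = root (p ^ m) * r x) ∧
      ∀ x, r (i x) = x := by
  classical
  have htor : Module.IsTorsion k[X] (Module.AEval' T) :=
    Module.AEval.isTorsion_of_finiteDimensional k W T
  obtain ⟨ι, _, p, hp, e, ⟨φ⟩⟩ := Module.equiv_directSum_of_isTorsion htor
  -- The structure theorem allows exponent zero, that is, trivial summands; a nonzero `W` has a
  -- nontrivial one.
  obtain ⟨j, hj⟩ : ∃ j, e j ≠ 0 := by
    by_contra! h
    have h1 (j : ι) : Subsingleton (k[X] ⧸ Submodule.span k[X] {p j ^ e j}) := by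
      rw [h j, pow_zero, Submodule.Quotient.subsingleton_iff]
      exact Ideal.span_singleton_one
    have h2 : Subsingleton (DirectSum ι fun i => k[X] ⧸ Submodule.span k[X] {p i ^ e i}) :=
      ⟨fun a b => DFinsupp.ext fun j => Subsingleton.elim _ _⟩
    have h3 : Subsingleton W :=
      ((Module.AEval'.of T).toEquiv.trans φ.toEquiv).subsingleton_congr.2 h2
    exact not_subsingleton W h3
  -- Pass to the monic associate of the prime, which generates the same ideal.
  have hassoc : Associated (p j ^ e j) (normalize (p j) ^ e j) :=
    (associated_normalize (p j)).pow_pow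
  have hspan : (Submodule.span k[X] {p j ^ e j} : Submodule k[X] k[X]) =
      Ideal.span {normalize (p j) ^ e j} := Ideal.span_singleton_eq_span_singleton.2 hassoc
  let q : (k[X] ⧸ Submodule.span k[X] {p j ^ e j}) ≃ₗ[k[X]]
    (k[X] ⧸ Ideal.span {normalize (p j) ^ e j}) := Submodule.quotEquivOfEq _ _ hspan
  let i : (k[X] ⧸ Ideal.span {normalize (p j) ^ e j}) →ₗ[k[X]] Module.AEval' T :=
    φ.symm.toLinearMap ∘ₗ (DirectSum.lof k[X] ι (fun i => k[X] ⧸ Submodule.span k[X] {p i ^ e i}) j)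
      ∘ₗ q.symm.toLinearMap
  let r : Module.AEval' T →ₗ[k[X]] (k[X] ⧸ Ideal.span {normalize (p j) ^ e j}) :=
    q.toLinearMap ∘ₗ (DirectSum.component k[X] ι (fun i => k[X] ⧸ Submodule.span k[X] {p i ^ e i}) j)
      ∘ₗ φ.toLinearMap
  have hri (x) : r (i x) = x := by
    simp only [i, r, LinearMap.comp_apply, LinearEquiv.coe_coe, LinearEquiv.apply_symm_apply,
      DirectSum.component.lof_self]
  have hsmul (x : k[X] ⧸ Ideal.span {normalize (p j) ^ e j}) :
      HMul.hMul (α := AdjoinRoot (normalize (p j) ^ e j))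
        (β := AdjoinRoot (normalize (p j) ^ e j)) (root (normalize (p j) ^ e j)) x =
      (X : k[X]) • x := by
    obtain ⟨g, rfl⟩ := Ideal.Quotient.mk_surjective x
    rfl
  refine ⟨normalize (p j), e j, monic_normalize (hp j).ne_zero,
    (associated_normalize (p j)).irreducible (hp j), hj,
    (Module.AEval'.of T).symm.toLinearMap ∘ₗ i.restrictScalars k,
    r.restrictScalars k ∘ₗ (Module.AEval'.of T).toLinearMap, fun (x : k[X] ⧸ Ideal.span {normalize (p j) ^ e j}) => ?_, fun x => ?_,
    fun (x : k[X] ⧸ Ideal.span {normalize (p j) ^ e j}) => ?_⟩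
  · refine (congrArg (fun y => (Module.AEval'.of T).symm (i y)) (hsmul x)).trans ?_
    change (Module.AEval'.of T).symm (i ((X : k[X]) • x)) = T ((Module.AEval'.of T).symm (i x))
    rw [map_smul, Module.AEval'.of_symm_X_smul]
  · refine Eq.trans ?_ (hsmul (r (Module.AEval'.of T x))).symm
    change r (Module.AEval'.of T (T x)) = _
    rw [← Module.AEval'.X_smul_of, map_smul]
  · refine Eq.trans ?_ (hri x)
    change r ((Module.AEval'.of T) ((Module.AEval'.of T).symm (i x))) = _
    rw [LinearEquiv.apply_symm_apply]

end Cyclic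

/-! ### Local systems on a cyclic quiver -/

namespace CyclicQuiver

variable {k : Type u} [Field k] {V : Type w} [Quiver.{v} V]

/-- A morphism of representations of a quiver may be checked on arrows. -/
theorem naturality_of_arrows (M N : Rep k (Paths V)) (f : ∀ x : Paths V, M.obj x →ₗ[k] N.obj x)
    (h : ∀ {x y : V} (e : x ⟶ y) (v), f ((Paths.of V).obj y) (lin M ((Paths.of V).map e) v) =
      lin N ((Paths.of V).map e) (f ((Paths.of V).obj x) v)) {x y : Paths V} (p : x ⟶ y)
    (v : M.obj x) : f y (lin M p v) = lin N p (f x v) := by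
  induction p using Paths.induction_fixed_source with
  | id => rw [lin_id, lin_id]; rfl
  | comp p e ih => rw [lin_comp_apply, lin_comp_apply, ← ih, h e]

theorem isLocalSystem_of_arrows (M : Rep k (Paths V))
    (h : ∀ {x y : V} (e : x ⟶ y), Function.Bijective (lin M ((Paths.of V).map e))) :
    IsLocalSystem M := fun x y p => by
  induction p using Paths.induction_fixed_source with
  | id => rw [lin_id]; exact Function.bijective_id
  | comp p e ih => rw [lin_comp]; exact (h e).comp ih

/-- The representation with constant values given by automorphisms. -/
def auto {W : Type u} [AddCommGroup W] [Module k W] [Module.Finite k W]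
    (g : Quiver.Total V → (W ≃ₗ[k] W)) : Rep k (Paths V) :=
  Paths.lift { obj := fun _ => FGModuleCat.of k W
               map := fun {x y} e => FGModuleCat.ofHom (g ⟨x, y, e⟩).toLinearMap }

theorem lin_auto {W : Type u} [AddCommGroup W] [Module k W] [Module.Finite k W]
    (g : Quiver.Total V → (W ≃ₗ[k] W)) {x y : V} (e : x ⟶ y) (v : W) :
    lin (auto g) ((Paths.of V).map e) v = g ⟨x, y, e⟩ v := by
  have : (auto g).map ((Paths.of V).map e) = FGModuleCat.ofHom (g ⟨x, y, e⟩).toLinearMap :=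
    Paths.lift_toPath _ e
  rw [lin, this]
  rfl

theorem isLocalSystem_auto {W : Type u} [AddCommGroup W] [Module k W] [Module.Finite k W]
    (g : Quiver.Total V → (W ≃ₗ[k] W)) : IsLocalSystem (auto g) :=
  isLocalSystem_of_arrows _ fun {x y} e => by
    have : ⇑(lin (auto g) ((Paths.of V).map e)) = g ⟨x, y, e⟩ := funext (lin_auto g e)
    rw [this]
    exact (g _).bijective

variable {n : ℕ} (vert : Fin (n + 1) ≃ V) (arr : Fin (n + 1) ≃ Quiver.Total V)

open Classical in
/-- The automorphisms that are trivial except for the last arrow. -/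
def twist {W : Type u} [AddCommGroup W] [Module k W] (T : W ≃ₗ[k] W) (e : Quiver.Total V) :
    W ≃ₗ[k] W :=
  if arr.symm e = Fin.last n then if e.left = vert (Fin.last n) then T else T.symm
  else LinearEquiv.refl k W

/-- The local system with a given monodromy. -/
def monodromyRep {W : Type u} [AddCommGroup W] [Module k W] [Module.Finite k W]
    (T : W ≃ₗ[k] W) : Rep k (Paths V) := auto (twist vert arr T)

variable {W W' : Type u} [AddCommGroup W] [Module k W] [Module.Finite k W]
  [AddCommGroup W'] [Module k W'] [Module.Finite k W']

theorem twist_comm {T : W ≃ₗ[k] W} {T' : W' ≃ₗ[k] W'} (φ : W →ₗ[k] W')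
    (h : ∀ x, φ (T x) = T' (φ x)) (e : Quiver.Total V) (x : W) :
    φ (twist vert arr T e x) = twist vert arr T' e (φ x) := by
  unfold twist
  split_ifs
  · exact h x
  · rw [LinearEquiv.eq_symm_apply, ← h, LinearEquiv.apply_symm_apply]
  · rfl

/-- The morphism of local systems given by an intertwiner. -/
def monodromyHom {T : W ≃ₗ[k] W} {T' : W' ≃ₗ[k] W'} (φ : W →ₗ[k] W')
    (h : ∀ x, φ (T x) = T' (φ x)) : monodromyRep vert arr T ⟶ monodromyRep vert arr T' :=
  homMk (M := monodromyRep vert arr T) (N := monodromyRep vert arr T') (fun _ => φ)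
    (naturality_of_arrows (monodromyRep vert arr T) (monodromyRep vert arr T') (fun _ => φ)
      fun {x y} e v => by
        refine (congrArg φ (lin_auto (W := W) _ e v)).trans (Eq.trans ?_ (lin_auto (W := W') _ e (φ v)).symm)
        exact twist_comm vert arr φ h ⟨x, y, e⟩ v)

variable (hva : ∀ i, ((arr i).left = vert i ∧ (arr i).right = vert (i + 1)) ∨
  ((arr i).left = vert (i + 1) ∧ (arr i).right = vert i))

include hva

/-- All arrows but the last form a path through every vertex starting at `vert 0`, whatever their
orientations. -/
theorem eq_of_arrows {X : Type*} (φ : V → X)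
    (h : ∀ i : Fin n, φ (arr i.castSucc).left = φ (arr i.castSucc).right) (v : V) :
    φ v = φ (vert 0) := by
  obtain ⟨i, rfl⟩ := vert.surjective v
  induction i using Fin.induction with
  | zero => rfl
  | succ i ih =>
    have h1 := h i
    rcases hva i.castSucc with ⟨h2, h3⟩ | ⟨h2, h3⟩ <;>
      rw [h2, h3, Fin.coeSucc_eq_succ] at h1
    · rw [← h1, ih]
    · rw [h1, ih]

theorem app_monodromyRep {T : W ≃ₗ[k] W} {T' : W' ≃ₗ[k] W'}
    (f : monodromyRep vert arr T ⟶ monodromyRep vert arr T') (x : V) :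
    (app f ((Paths.of V).obj x) : W →ₗ[k] W') = app f ((Paths.of V).obj (vert 0)) := by
  refine eq_of_arrows vert arr hva (X := W →ₗ[k] W')
    (fun v => (app f ((Paths.of V).obj v) : W →ₗ[k] W')) (fun i => ?_) x
  have h1 (U : Type u) [AddCommGroup U] [Module k U] (S : U ≃ₗ[k] U) (u : U) :
      twist vert arr S (arr i.castSucc) u = u := by
    rw [twist, Equiv.symm_apply_apply, if_neg (Fin.castSucc_lt_last i).ne]
    rfl
  refine LinearMap.ext fun (u : W) => ?_
  have h2 := app_lin f ((Paths.of V).map (arr i.castSucc).hom) u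
  have h4 : lin (monodromyRep vert arr T) ((Paths.of V).map (arr i.castSucc).hom) u = u :=
    (lin_auto (twist vert arr T) (arr i.castSucc).hom u).trans (h1 W T u)
  have h5 (u : W') :
      lin (monodromyRep vert arr T') ((Paths.of V).map (arr i.castSucc).hom) u = u :=
    (lin_auto (twist vert arr T') (arr i.castSucc).hom u).trans (h1 W' T' u)
  exact (h5 _).symm.trans (h2.symm.trans
    (congrArg (app f ((Paths.of V).obj (arr i.castSucc).right)) h4))

/-- This is naturality at the last arrow, the only one acting nontrivially. If that arrow points
backwards one gets commutation with the inverses, which is equivalent. -/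
theorem app_comm {T : W ≃ₗ[k] W} {T' : W' ≃ₗ[k] W'}
    (f : monodromyRep vert arr T ⟶ monodromyRep vert arr T') (u : W) :
    (app f ((Paths.of V).obj (vert 0)) : W →ₗ[k] W') (T u) =
      T' ((app f ((Paths.of V).obj (vert 0)) : W →ₗ[k] W') u) := by
  set φ : W →ₗ[k] W' := app f ((Paths.of V).obj (vert 0)) with hφ
  have h1 (u : W) : φ (twist vert arr T (arr (Fin.last n)) u) =
      twist vert arr T' (arr (Fin.last n)) (φ u) := by
    have h2 := app_lin f ((Paths.of V).map (arr (Fin.last n)).hom) u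
    have h3 := app_monodromyRep vert arr hva f
    have h4 : lin (monodromyRep vert arr T) ((Paths.of V).map (arr (Fin.last n)).hom) u = _ :=
      lin_auto (twist vert arr T) (arr (Fin.last n)).hom u
    have h5 : lin (monodromyRep vert arr T') ((Paths.of V).map (arr (Fin.last n)).hom) (φ u) = _ :=
      lin_auto (twist vert arr T') (arr (Fin.last n)).hom (φ u)
    refine Eq.trans ?_ (Eq.trans h2 ?_)
    · refine (DFunLike.congr_fun (h3 (arr (Fin.last n)).right) _).symm.trans ?_
      exact congrArg (app f ((Paths.of V).obj (arr (Fin.last n)).right)) h4.symm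
    · refine (congrArg (lin (monodromyRep vert arr T') ((Paths.of V).map (arr (Fin.last n)).hom))
        (DFunLike.congr_fun (h3 (arr (Fin.last n)).left) u)).trans ?_
      exact h5
  unfold twist at h1
  rw [Equiv.symm_apply_apply, if_pos rfl, if_pos rfl] at h1
  split_ifs at h1
  · exact h1 u
  · have := h1 (T u)
    rw [LinearEquiv.symm_apply_apply, LinearEquiv.eq_symm_apply] at this
    exact this.symm

theorem monodromyRep_indecomposable [Nontrivial W] {T : W ≃ₗ[k] W}
    (hT : ∀ φ : W →ₗ[k] W, (∀ x, φ (T x) = T (φ x)) → (∀ x, φ (φ x) = φ x) →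
      φ = 0 ∨ φ = LinearMap.id) : Indecomposable (monodromyRep vert arr T) := by
  refine indecomposable_of_idempotent (fun h => ?_) fun e he => ?_
  · have : Subsingleton W := (Rep.isZero_iff _).1 h ((Paths.of V).obj (vert 0))
    exact not_subsingleton W this
  · have h1 := app_monodromyRep vert arr hva e
    rcases hT (app e ((Paths.of V).obj (vert 0))) (app_comm vert arr hva e) (fun x =>
      DFunLike.congr_fun (congrArg (fun t => app t ((Paths.of V).obj (vert 0))) he) x) with h | h
    · exact Or.inl (Rep.hom_ext fun x => (h1 x).trans h)
    · exact Or.inr (Rep.hom_ext fun x => (h1 x).trans h)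

/-- Every local system is determined by its monodromy. -/
theorem exists_iso_monodromyRep (M : Rep k (Paths V)) (hM : IsLocalSystem M) :
    ∃ T : M.obj ((Paths.of V).obj (vert 0)) ≃ₗ[k] M.obj ((Paths.of V).obj (vert 0)),
      Nonempty (M ≅ monodromyRep vert arr T) := by
  set W := M.obj ((Paths.of V).obj (vert 0)) with hW
  have hrk := eq_of_arrows vert arr hva (fun v => Module.finrank k (M.obj ((Paths.of V).obj v)))
    fun i => (LinearEquiv.ofBijective _ (hM ((Paths.of V).map (arr i.castSucc).hom))).finrank_eq
  let θ (v : V) : M.obj ((Paths.of V).obj v) ≃ₗ[k] W := LinearEquiv.ofFinrankEq _ _ (hrk v)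
  let g (e : Quiver.Total V) : W ≃ₗ[k] W := (θ e.left).symm ≪≫ₗ
    LinearEquiv.ofBijective _ (hM ((Paths.of V).map e.hom)) ≪≫ₗ θ e.right
  classical
  -- `γ i` is the transport from vertex `i` to vertex `i + 1`, inverted where the arrow points
  -- backwards. The change of basis `h` trivialises all of these but the last, and `T` is the
  -- composite of all transports once around the cycle.
  let γ (i : Fin (n + 1)) : W ≃ₗ[k] W := if (arr i).left = vert i then g (arr i) else (g (arr i))⁻¹
  let h : Fin (n + 1) → (W ≃ₗ[k] W) := fun i =>
    Fin.induction (motive := fun _ => W ≃ₗ[k] W) 1 (fun i a => a * (γ i.castSucc)⁻¹) i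
  have hs (i : Fin n) : h i.succ = h i.castSucc * (γ i.castSucc)⁻¹ := by
    simp only [h, Fin.induction_succ]
  have h0 : h 0 = 1 := rfl
  let T : W ≃ₗ[k] W := γ (Fin.last n) * (h (Fin.last n))⁻¹
  have key (e : Quiver.Total V) : h (vert.symm e.right) * g e =
      twist vert arr T e * h (vert.symm e.left) := by
    obtain ⟨i, rfl⟩ := arr.surjective e
    by_cases hi : (arr i).left = vert i
    · have hg : γ i = g (arr i) := if_pos hi
      have hr : (arr i).right = vert (i + 1) := by
        rcases hva i with h | h
        · exact h.2
        -- Both alternatives for the arrow hold only for a loop, where `i + 1 = i`.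
        · have := vert.injective (hi.symm.trans h.1)
          rw [h.2, ← this]
      rw [← hg, hi, hr, Equiv.symm_apply_apply, Equiv.symm_apply_apply]
      refine Fin.lastCases (motive := fun i => (arr i).left = vert i → h (i + 1) * γ i =
        twist vert arr T (arr i) * h i) (fun hi => ?_) (fun j hi => ?_) i hi
      · rw [Fin.last_add_one, h0, one_mul, twist, Equiv.symm_apply_apply, if_pos rfl, if_pos hi]
        simp only [T, inv_mul_cancel_right]
      · rw [Fin.coeSucc_eq_succ, hs, twist, Equiv.symm_apply_apply,
          if_neg (Fin.castSucc_lt_last j).ne, inv_mul_cancel_right]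
        rfl
    · have hg : (γ i)⁻¹ = g (arr i) := by rw [show γ i = (g (arr i))⁻¹ from if_neg hi, inv_inv]
      obtain ⟨hl, hr⟩ := (hva i).resolve_left fun h => hi h.1
      rw [← hg, hl, hr, Equiv.symm_apply_apply, Equiv.symm_apply_apply]
      refine Fin.lastCases (motive := fun i => ¬ (arr i).left = vert i → h i * (γ i)⁻¹ =
        twist vert arr T (arr i) * h (i + 1)) (fun hi => ?_) (fun j hi => ?_) i hi
      · rw [Fin.last_add_one, h0, mul_one, twist, Equiv.symm_apply_apply, if_pos rfl, if_neg hi]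
        change _ = T⁻¹
        simp only [T, mul_inv_rev, inv_inv]
      · rw [Fin.coeSucc_eq_succ, hs, twist, Equiv.symm_apply_apply,
          if_neg (Fin.castSucc_lt_last j).ne]
        exact (one_mul _).symm
  refine ⟨T, ⟨isoMk (N := monodromyRep vert arr T) (fun v => θ v ≪≫ₗ h (vert.symm v))
    (naturality_of_arrows M (monodromyRep vert arr T)
      (fun v => (θ v ≪≫ₗ h (vert.symm v)).toLinearMap) fun {x y} e v => ?_)⟩⟩
  refine Eq.trans ?_ (lin_auto (twist vert arr T) e _).symm
  have h1 := DFunLike.congr_fun (key ⟨x, y, e⟩) (θ x v)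
  refine Eq.trans ?_ h1
  change h (vert.symm y) (θ y (lin M ((Paths.of V).map e) v)) =
    h (vert.symm y) (θ y (lin M ((Paths.of V).map e) ((θ x).symm (θ x v))))
  rw [LinearEquiv.symm_apply_apply]

/-! ### Indecomposable local systems on a cycle and powers of irreducible polynomials. -/

section Classification

open Polynomial AdjoinRoot

omit hva

/-- Multiplication by the variable on a cyclic module. -/
def rootEquiv {p : k[X]} (hp : Irreducible p) (h0 : p.coeff 0 ≠ 0) (m : ℕ) :
    AdjoinRoot (p ^ m) ≃ₗ[k] AdjoinRoot (p ^ m) :=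
  LinearEquiv.ofBijective (LinearMap.mulLeft k (root (p ^ m))) (by
    obtain ⟨a, ha⟩ := (isUnit_root hp h0 m).exists_right_inv
    refine ⟨fun x y h => (isUnit_root hp h0 m).mul_left_cancel h, fun x => ⟨a * x, ?_⟩⟩
    rw [LinearMap.mulLeft_apply, ← mul_assoc, ha, one_mul])

variable (k) in
/-- The index set of the indecomposable local systems on a cycle. -/
abbrev CycleIndex : Type u :=
  {p : k[X] // p.Monic ∧ Irreducible p ∧ p.coeff 0 ≠ 0} × {m : ℕ // 1 ≤ m}

instance (c : CycleIndex k) : Module.Finite k (AdjoinRoot (c.1.1 ^ c.2.1)) :=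
  (AdjoinRoot.powerBasis (pow_ne_zero _ c.1.2.2.1.ne_zero)).finite

instance (c : CycleIndex k) : Nontrivial (AdjoinRoot (c.1.1 ^ c.2.1)) := by
  refine nontrivial_of_ne 1 0 fun h => ?_
  rw [← map_one (mk _), mk_eq_zero] at h
  exact c.1.2.2.1.not_isUnit (isUnit_of_dvd_one ((dvd_pow_self _ (by have := c.2.2; lia)).trans h))

/-- The indecomposable local system with a given index. -/
def cyclicRep (c : CycleIndex k) : Rep k (Paths V) :=
  monodromyRep vert arr (rootEquiv c.1.2.2.1 c.1.2.2.2 c.2.1)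

include hva

theorem cyclicRep_indecomposable (c : CycleIndex k) : Indecomposable (cyclicRep vert arr c) :=
  monodromyRep_indecomposable vert arr hva fun φ h h' => endo_idempotent c.1.2.2.1 _ φ h h'

/-- The class of an indecomposable local system with a given index. -/
def cyclicInd (c : CycleIndex k) : Etilde.IndLocal k (Paths V) :=
  ⟨Ind.mk (cyclicRep_indecomposable vert arr hva c),
    (isLocalSystem_auto _).of_iso (Ind.out_mk (cyclicRep_indecomposable vert arr hva c)).some.symm⟩

theorem cyclicInd_injective : Function.Injective (cyclicInd (k := k) vert arr hva) := by
  intro c c' h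
  obtain ⟨e⟩ := IsoClass.exact (congrArg (fun I : Etilde.IndLocal k (Paths V) => I.1.1) h)
  obtain ⟨h1, h2⟩ := eq_of_cyclic_equiv c.1.2.2.1 c'.1.2.2.1 c.1.2.1 c'.1.2.1
    (by have := c.2.2; lia) (isoApp e ((Paths.of V).obj (vert 0))) (app_comm vert arr hva e.hom)
  exact Prod.ext (Subtype.ext h1) (Subtype.ext h2)

/-- A cyclic primary summand of the monodromy splits off a nonzero local system, which must be
everything. Invertibility of the monodromy excludes the prime `X`. -/
theorem cyclicInd_surjective : Function.Surjective (cyclicInd (k := k) vert arr hva) := by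
  intro I
  obtain ⟨T, ⟨e⟩⟩ := exists_iso_monodromyRep vert arr hva I.1.out I.2
  have hI := indecomposable_of_iso e I.1.indecomposable
  have hnt : Nontrivial (I.1.out.obj ((Paths.of V).obj (vert 0))) := by
    rw [← not_subsingleton_iff_nontrivial]
    exact fun h => hI.1 ((Rep.isZero_iff _).2 fun _ => h)
  obtain ⟨p, m, hpm, hp, hm, i, r, hi, hr, hir⟩ := exists_cyclic_summand T.toLinearMap
  have hp0 : p.coeff 0 ≠ 0 := coeff_zero_ne_zero hp hm fun x y h => by
    have h1 : i (root (p ^ m) * x) = i (root (p ^ m) * y) := congrArg i h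
    rw [hi, hi] at h1
    rw [← hir x, ← hir y, T.injective h1]
  obtain ⟨c, rfl, rfl⟩ : ∃ c : CycleIndex k, p = c.1.1 ∧ m = c.2.1 :=
    ⟨⟨⟨p, hpm, hp, hp0⟩, ⟨m, by lia⟩⟩, rfl, rfl⟩
  obtain ⟨e'⟩ := iso_of_retract_indecomposable hI (cyclicRep_indecomposable vert arr hva c).1
    (monodromyHom vert arr (T := rootEquiv c.1.2.2.1 c.1.2.2.2 c.2.1) (T' := T) i hi)
    (monodromyHom vert arr (T := T) (T' := rootEquiv c.1.2.2.1 c.1.2.2.2 c.2.1) r hr)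
    (Rep.hom_ext fun x => LinearMap.ext hir)
  exact ⟨c, Subtype.ext (Subtype.ext ((IsoClass.sound (e ≪≫ e')).symm.trans I.1.mk_out))⟩

end Classification

end CyclicQuiver

theorem nonempty_cocycles_cyclicQuiver (k : Type u) [Field k] (V : Type w) [Quiver.{v} V]
    (hV : IsCyclicQuiver V) :
    Nonempty (cocycles k (Etilde (Paths V)) 0 ≃+ (CyclicQuiver.CycleIndex k →₀ ℤ)) := by
  obtain ⟨m, hm, vert, arr, hva⟩ := hV
  -- With the length written as a successor, `ZMod (n + 1)` unfolds to `Fin (n + 1)`, on which the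
  -- constructions above are stated.
  obtain ⟨n, rfl⟩ := Nat.exists_eq_succ_of_ne_zero (n := m) (by lia)
  have : Finite (Paths V) := Finite.of_equiv (Fin (n + 1)) vert
  exact ⟨(Etilde.cocyclesEquiv k).symm.trans (Finsupp.domCongr (Equiv.ofBijective _
    ⟨CyclicQuiver.cyclicInd_injective (n := n) vert arr hva,
      CyclicQuiver.cyclicInd_surjective (n := n) vert arr hva⟩)).symm⟩

end

end RepCoh

theorem mainTheorem6 (k : Type u) [Field k] :
    (∀ n : ℕ, 1 ≤ n →
      Nonempty (RepCoh.H k (RepCoh.E (Fin (n + 1))) 0 ≃+ (Fin 2 → ℤ)) ∧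
      (2 ≤ n → Nonempty (RepCoh.H k (RepCoh.G (Fin (n + 1))) 0 ≃+ (Fin 3 → ℤ))) ∧
      ∃ r : RepCoh.H k (RepCoh.G (Fin (n + 1))) 0 →+ RepCoh.H k (RepCoh.E (Fin (n + 1))) 0,
        r.comp (RepCoh.natEG (Fin (n + 1)) k 0) = AddMonoidHom.id _) ∧
    (∀ n : ℕ, 2 ≤ n →
      (∀ i : ℕ, 0 < i → Subsingleton (RepCoh.H k (RepCoh.G (RepCoh.Dandelion n)) i)) ∧
      Nonempty (RepCoh.H k (RepCoh.G (RepCoh.Dandelion n)) 0 ≃+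
        (RepCoh.IndecAtZero k n →₀ ℤ)) ∧
      (AddGroup.FG (RepCoh.H k (RepCoh.G (RepCoh.Dandelion n)) 0) ↔ n ≤ 2)) ∧
    (∀ (V : Type w) [Quiver.{v} V], RepCoh.IsCyclicQuiver V →
      Nonempty (RepCoh.H k (RepCoh.Etilde (CategoryTheory.Paths V)) 0 ≃+
        ({p : Polynomial k // p.Monic ∧ Irreducible p ∧ p.coeff 0 ≠ 0} × {m : ℕ // 1 ≤ m}
          →₀ ℤ))) := by
  refine ⟨fun n hn => ⟨⟨(RepCoh.hZeroEquiv k _).trans (RepCoh.cocyclesEEquiv k hn)⟩,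
    fun h => ⟨(RepCoh.hZeroEquiv k _).trans (RepCoh.cocyclesGEquiv k h)⟩,
    RepCoh.natEG_split k hn⟩, fun n hn => ⟨fun i hi => ?_, ⟨?_⟩, RepCoh.Dandelion.fg_iff k hn⟩,
    fun V _ hV => ?_⟩
  · exact RepCoh.Dandelion.subsingleton_cohomology k ⟨0, by lia⟩ i hi
  · exact (RepCoh.hZeroEquiv k _).trans (RepCoh.Dandelion.cocyclesEquiv k ⟨0, by lia⟩)
  · obtain ⟨e⟩ := RepCoh.nonempty_cocycles_cyclicQuiver k V hV
    exact ⟨(RepCoh.hZeroEquiv k _).trans e⟩
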